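/- Let $M>0$, $v_0>0$, and consider the Schwarzschild exterior $\{(v,r,\omega): v\in\mathbb R,\ r\ge 2M,\ \omega\in\mathbb S^2\}$ with metric $g=-D\,dv^2+2\,dv\,dr+r^2d\omega^2$, $D(r)=1-\frac{2M}{r}$; the event horizon is $\mathcal H^+=\{r=2M\}$ and $T=\partial_v$ (in $(v,r)$-coordinates) is the stationary Killing field. Let $2M<r_{\mathcal H}<4M<R$ and let $\Sigma_0=\{v=v_{\Sigma_0}(r)\}$, $v_{\Sigma_0}(r)=v_0+\int_{2M}^r h$, with $h$ piecewise smooth, $h=0$ for $r\le r_{\mathcal H}$, $h=2/D$ for $r\ge R$, and $0<h<2/D$ for $r_{\mathcal H}<r<R$. Thus $\Sigma_0$ is ingoing null for $r\le r_{\mathcal H}$, strictly spacelike in between, and outgoing null for $r\geq R$. Let $u=v-2r^*$, $\frac{dr^*}{dr}=\frac1D$, with the additive constant of $r^*$ such that the outgoing part of $\Sigma_0$ is $N_0^{\mathcal I}=\{u=0,\ r\ge R\}$. In double null coordinates $(u,v)$, $\partial_u=-\frac D2\partial_r$ and $L=\partial_v$; in $(u,r)$-coordinates $\partial_r=\frac2D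 L$. Let $N$ be a smooth, time-invariant, spherically symmetric, strictly timelike vector field with $N=T-\partial_r$ (in $(v,r)$-coordinates) for $r\le r_{\mathcal H}$ and $N=T$ for $r\ge R$. Let $\epsilon_\phi>0$, $I_0^{(\mathrm{past})}[\phi]\in\mathbb R$, and let $\phi$ be a spherically symmetric solution of $\Box_g\phi=0$ that is smooth on $\{v\ge v_0,\ r\ge 2M\}$, up to and including $\{v=v_0\}$ and $\mathcal H^+$, and satisfies $$\partial_u(r\phi)(u,v_0)=\frac{2I_0^{(\mathrm{past})}[\phi]}{(1+u)^2}+\mathcal O_4\big(|1+u|^{-2-\epsilon_\phi}\big)\qquad(u<0,\ u\neq-1),\qquad \lim_{u\to-\infty}r\phi(u,v)=0\quad\text{for all } v\ge v_0 .$$ Here $\mathcal O_4(|1+u|^{-q})$ stands for a function $f$ with $|\partial_u^jf|\le C|1+u|^{-q-j}$ for $0\le j\le4$ and a constant $C$. Then the following hold. 1. For all $v\ge v_0$, at fixed $v$, $\lim_{r\to\infty}r^2\partial_r(r\phi)(v,r)=-I_0^{(\mathrm{past})}[\phi]$ (with $\partial_r$ in $(v,r)$-coordinates). 2. The limit $I_0^{\frac{\log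 r}{r^3}}[\phi]:=\lim_{r\to\infty}\frac{r^3}{\log r}\partial_r(r\phi)(u,r)$ (with $\partial_r$ in $(u,r)$-coordinates) exists for every $u\in\mathbb R$, is independent of $u$, and equals $-2M I_0^{(\mathrm{past})}[\phi]$. 3. There are constants $J\in\mathbb R$, $P>0$ and $\beta\in(0,\min(\epsilon_\phi,1))$ such that for all $r\ge R$ $$\Big|\partial_r(r\phi)|_{N_0^{\mathcal I}}(r)-I_0^{\frac{\log r}{r^3}}[\phi]\frac{\log r}{r^3}-\frac J{r^3}\Big|\le P\,r^{-3-\beta}.$$ 4. For every $\epsilon>0$, $\ \widetilde E^{\epsilon}_{0,I_0^{\log}=0;1}[\phi]+\int_{\Sigma_0}J^N[N^2\phi]\cdot n_{\Sigma_0}\,d\mu_{\Sigma_0}<\infty$, where, with $\psi=r\phi$, $J^V[f]=\mathbf T[f](V,\cdot)$, $\mathbf T_{\mu\nu}[f]=\partial_\mu f\,\partial_\nu f-\frac12g_{\mu\nu}\partial^\xi f\,\partial_\xi f$, with $\partial_r$ in $(u,r)$-coordinates, $$\begin{aligned}\widetilde E^{\epsilon}_{0,I_0^{\log}=0;1}[\phi]=&\sum_{i\le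 8}\int_{\Sigma_0}J^N[T^i\phi]\cdot n_{\Sigma_0}d\mu_{\Sigma_0}+\sum_{i\le1}\int_{\Sigma_0}J^N[NT^i\phi]\cdot n_{\Sigma_0}d\mu_{\Sigma_0}+\int_{R}^\infty r^{7-\epsilon}(\partial_r^2\psi)^2dr\\&+\sum_{i\le2}\int_R^\infty r^{5-\epsilon}(\partial_rT^i\psi)^2+r^{4-\epsilon}(\partial_rT^{1+i}\psi)^2+r^{3-\epsilon}(\partial_rT^{2+i}\psi)^2+r^2(\partial_rT^{3+i}\psi)^2+r(\partial_rT^{4+i}\psi)^2\,dr\\&+\sum_{i\le3}\int_R^\infty r^{4-\epsilon}(\partial_rT^i\psi)^2dr+\sum_{i\le1}\int_R^\infty r^{6-\epsilon}(\partial_r^2T^i\psi)^2dr,\end{aligned}$$ the $r$-integrals being along $N_0^{\mathcal I}$. On the spacelike part of $\Sigma_0$, $n_{\Sigma_0}$ is the future unit normal and $d\mu_{\Sigma_0}$ the induced volume form; on the ingoing and outgoing null parts, $n_{\Sigma_0}=\partial_u$, $d\mu_{\Sigma_0}=r^2d\omega\,du$, and $n_{\Sigma_0}=L$, $d\mu_{\Sigma_0}=r^2d\omega\,dv$,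 respectively. In particular, $\phi$ satisfies, for every $\epsilon\in(0,\beta)$, the conditions on data on $\Sigma_0$ (finiteness of $I_0^{\frac{\log r}{r^3}}[\phi]$, the expansion in 3 with $\beta\in(\epsilon,1)$, and finiteness of the energies in 4) under which the late-time asymptotics of solutions with $I_0^{\log}[\phi]=0$ are stated. -/

import Mathlib

open Set Filter Topology MeasureTheory
open scoped ContDiff ENNReal

/-! Spherically symmetric functions on the Schwarzschild exterior are written as functions of
`p = (v, r)`, where `(v, r)` are ingoing Eddington-Finkelstein coordinates; `p.1 = v`, `p.2 = r`.
The metric is `-D(r) dv² + 2 dv dr + r² dω²`. A spherically symmetric vector field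
`X = X¹ ∂_v + X² ∂_r` is a function `p ↦ (X¹, X²)`. -/

namespace Schwarzschild

/-- `h` is smooth on `(a, b)` up to finitely many break points: between two consecutive points of a
finite set containing `a` and `b` it agrees with a smooth function on the line. -/
def PiecewiseSmoothOn (h : ℝ → ℝ) (a b : ℝ) : Prop :=
  ∃ s : Finset ℝ, a ∈ s ∧ b ∈ s ∧ ∀ x ∈ s, ∀ y ∈ s, x < y → (∀ z ∈ s, ¬ (x < z ∧ z < y)) →
    ∃ g : ℝ → ℝ, ContDiff ℝ ∞ g ∧ ∀ r ∈ Ioo x y, h r = g r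

/-- A Schwarzschild exterior of mass `M > 0`, with a spacelike-null hypersurface
`Σ₀ = {v = v₀ + ∫_{2M}^r h}` and a red-shift vector field `N = Nv(r) ∂_v + Nr(r) ∂_r`. -/
structure Setting where
  /-- the mass -/
  M : ℝ
  M_pos : 0 < M
  /-- `{v = v₀}` is the ingoing cone on which data are posed; `Σ₀` starts on it -/
  v₀ : ℝ
  v₀_pos : 0 < v₀
  /-- `Σ₀` is ingoing null for `r ≤ rH` -/
  rH : ℝ
  /-- `Σ₀` is outgoing null for `r ≥ R` -/
  R : ℝ
  two_M_lt_rH : 2 * M < rH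
  rH_lt : rH < 4 * M
  lt_R : 4 * M < R
  /-- the slope `dv/dr` of `Σ₀` -/
  h : ℝ → ℝ
  h_inner : ∀ r, 2 * M ≤ r → r ≤ rH → h r = 0
  h_outer : ∀ r, R ≤ r → h r = 2 / (1 - 2 * M / r)
  h_piecewise : PiecewiseSmoothOn h rH R
  /-- strict spacelikeness of the middle part: the induced metric is
  `h (2 - D h) dr² + r² dω²` -/
  h_spacelike : ∀ r, rH < r → r < R → 0 < h r ∧ (1 - 2 * M / r) * h r < 2
  /-- the `∂_v`-component of `N` -/
  Nv : ℝ → ℝ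
  /-- the `∂_r`-component of `N` -/
  Nr : ℝ → ℝ
  Nv_smooth : ContDiff ℝ ∞ Nv
  Nr_smooth : ContDiff ℝ ∞ Nr
  /-- `N = T - Y` for `r ≤ rH`, where `T = ∂_v` and `Y = ∂_r + h ∂_v = ∂_r` -/
  N_inner : ∀ r, r ≤ rH → Nv r = 1 ∧ Nr r = -1
  /-- `N = T` for `r ≥ R` -/
  N_outer : ∀ r, R ≤ r → Nv r = 1 ∧ Nr r = 0
  /-- `g(N, N) < 0` -/
  N_timelike : ∀ r, rH < r → r < R → -(1 - 2 * M / r) * Nv r ^ 2 + 2 * Nv r * Nr r < 0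

noncomputable section

/-- The radiation field `r φ`. -/
def rad (φ : ℝ × ℝ → ℝ) : ℝ × ℝ → ℝ := fun p => p.2 * φ p

namespace Setting

variable (S : Setting)

/-- `D(r) = 1 - 2M/r`. -/
def D (r : ℝ) : ℝ := 1 - 2 * S.M / r

/-- The future domain `{v ≥ v₀, r ≥ 2M}` of the cone `{v = v₀}`, horizon included. -/
def dom : Set (ℝ × ℝ) := Ici S.v₀ ×ˢ Ici (2 * S.M)

/-- The value of `v` on `Σ₀` at radius `r`. -/
def vSigma (r : ℝ) : ℝ := S.v₀ + ∫ s in (2 * S.M)..r, S.h s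

/-- The tortoise coordinate, `dr*/dr = 1/D`. Its additive constant is chosen so that the outgoing
null part of `Σ₀` is `{u = 0, r ≥ R}`. (Used for `r > 2M` only.) -/
def rstar (r : ℝ) : ℝ := S.vSigma S.R / 2 + ∫ s in S.R..r, (S.D s)⁻¹

/-- The retarded time `u = v - 2 r*`. -/
def u (p : ℝ × ℝ) : ℝ := p.1 - 2 * S.rstar p.2

/-- `X f`, the derivative of the function `f` on the domain along the vector field `X`
(one-sided at the boundary of the domain). -/
def along (X : ℝ × ℝ → ℝ × ℝ) (f : ℝ × ℝ → ℝ) : ℝ × ℝ → ℝ :=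
  fun p => fderivWithin ℝ f S.dom p (X p)

/-- The stationary Killing field `T = ∂_v` in `(v, r)`-coordinates. -/
def T : (ℝ × ℝ → ℝ) → (ℝ × ℝ → ℝ) := S.along fun _ => (1, 0)

/-- `∂_r` in `(v, r)`-coordinates, i.e. at fixed `v`. -/
def drIn : (ℝ × ℝ → ℝ) → (ℝ × ℝ → ℝ) := S.along fun _ => (0, 1)

/-- `∂_u` in double null coordinates `(u, v)`, which is `-(D/2) ∂_r` in `(v, r)`-coordinates. -/
def Lbar : (ℝ × ℝ → ℝ) → (ℝ × ℝ → ℝ) := S.along fun p => (0, -(S.D p.2 / 2))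

/-- `∂_r` in `(u, r)`-coordinates, i.e. at fixed `u`. It equals `(2/D) L`, where
`L = ∂_v + (D/2) ∂_r` (in `(v, r)`-coordinates) is the double null `∂_v`. -/
def drOut : (ℝ × ℝ → ℝ) → (ℝ × ℝ → ℝ) := S.along fun p => (2 / S.D p.2, 1)

/-- The derivative along the red-shift vector field `N`. -/
def N : (ℝ × ℝ → ℝ) → (ℝ × ℝ → ℝ) := S.along fun p => (S.Nv p.2, S.Nr p.2)

/-- The wave operator on spherically symmetric functions,
`□f = |g|^{-1/2} ∂_μ (|g|^{1/2} g^{μν} ∂_ν f)` with `g^{vv} = 0`, `g^{vr} = 1`, `g^{rr} = D`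
and `|g|^{1/2} = r² sin θ`. -/
def box (f : ℝ × ℝ → ℝ) (p : ℝ × ℝ) : ℝ :=
  (p.2 ^ 2)⁻¹ * (S.T (fun q => q.2 ^ 2 * S.drIn f q) p
    + S.drIn (fun q => q.2 ^ 2 * (S.T f q + S.D q.2 * S.drIn f q)) p)

/-- The metric on spherically symmetric vectors at radius `r`. -/
def metric (r : ℝ) (X Y : ℝ × ℝ) : ℝ :=
  -S.D r * X.1 * Y.1 + X.1 * Y.2 + X.2 * Y.1

/-- The energy-momentum tensor `T[f](X, Y) = X f · Y f - ½ g(X, Y) g⁻¹(df, df)` at `p`. -/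
def emTensor (f : ℝ × ℝ → ℝ) (p X Y : ℝ × ℝ) : ℝ :=
  fderivWithin ℝ f S.dom p X * fderivWithin ℝ f S.dom p Y
    - 1 / 2 * S.metric p.2 X Y * (2 * S.T f p * S.drIn f p + S.D p.2 * S.drIn f p ^ 2)

/-- The normal of `Σ₀`, scaled such that `n dμ = normal · r² dr dω` on every part of `Σ₀`.
It is `h ∂_v + (D h - 1) ∂_r`.
On the spacelike part it is orthogonal to the tangent `∂_r + h ∂_v` and has
`g(normal, normal) = -h (2 - D h)`, so that it is `√(h (2 - D h))` times the future unit normal,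
while `dμ = √(h (2 - D h)) r² dr dω`.
For `h = 0` it is `(2/D) ∂_u`, with `|du| = (2/D) dr`; for `h = 2/D` it is `(2/D) L`,
with `dv = (2/D) dr`. -/
def normal (r : ℝ) : ℝ × ℝ := (S.h r, S.D r * S.h r - 1)

/-- `∫_{Σ₀} J^N[f] · n dμ`. The integrand is non-negative. -/
def fluxN (f : ℝ × ℝ → ℝ) : ℝ≥0∞ :=
  ∫⁻ r in Ici (2 * S.M), ENNReal.ofReal
    (4 * Real.pi * r ^ 2 * S.emTensor f (S.vSigma r, r) (S.Nv r, S.Nr r) (S.normal r))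

/-- `∫ r^q f² dr` over the outgoing null part `{u = 0, r ≥ R}` of `Σ₀`. -/
def outerNorm (q : ℝ) (f : ℝ × ℝ → ℝ) : ℝ≥0∞ :=
  ∫⁻ r in Ici S.R, ENNReal.ofReal (r ^ q * f (S.vSigma r, r) ^ 2)

/-- `E^N_k[φ]`. -/
def energyN (k : ℕ) (φ : ℝ × ℝ → ℝ) : ℝ≥0∞ :=
  ∑ i ∈ Finset.range (k + 1), S.fluxN (S.T^[i] φ)

/-- `E^ε_{0, I₀ = 0; k}[φ]`, which is also `E^ε_{0, I₀^log = 0; k}[φ]`. -/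
def energy (ε : ℝ) (k : ℕ) (φ : ℝ × ℝ → ℝ) : ℝ≥0∞ :=
  S.energyN (5 + 3 * k) φ
    + S.outerNorm (5 + 2 * k - ε) (S.drOut^[1 + k] (rad φ))
    + ∑ i ∈ Finset.range (2 * k + 1),
        (S.outerNorm (5 - ε) (S.drOut (S.T^[i] (rad φ)))
          + S.outerNorm (4 - ε) (S.drOut (S.T^[1 + i] (rad φ)))
          + S.outerNorm (3 - ε) (S.drOut (S.T^[2 + i] (rad φ)))
          + S.outerNorm 2 (S.drOut (S.T^[3 + i] (rad φ)))
          + S.outerNorm 1 (S.drOut (S.T^[4 + i] (rad φ))))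
    + ∑ m ∈ Finset.range (k + 1), ∑ i ∈ Finset.range (2 * (k - m) + min k 1 + 1),
        S.outerNorm (4 + 2 * m - ε) (S.drOut^[1 + m] (S.T^[i] (rad φ)))

/-- `Ẽ^ε_{0, I₀ = 0; k}[φ]`, which is also `Ẽ^ε_{0, I₀^log = 0; k}[φ]`. -/
def energyTilde (ε : ℝ) (k : ℕ) (φ : ℝ × ℝ → ℝ) : ℝ≥0∞ :=
  S.energy ε k φ + ∑ i ∈ Finset.range (k + 1), S.fluxN (S.N (S.T^[i] φ))

/-- The limit of `f(r) ∂_r(rφ)` towards future null infinity along the outgoing cone of retarded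
time `u₁` exists and equals `ℓ` (modified Newman-Penrose constant). -/
def HasNPConstant (f : ℝ → ℝ) (φ : ℝ × ℝ → ℝ) (u₁ ℓ : ℝ) : Prop :=
  Tendsto (fun r => f r * S.drOut (rad φ) (u₁ + 2 * S.rstar r, r)) atTop (𝓝 ℓ)

/-- `F = O_k(|1 + u|^{-q})` along the part `u < 0` of the ingoing cone `{v = v₀}`, together with the
first `k` derivatives in `u`; `u = -1`, where `|1 + u|^{-q}` is infinite, is left out. -/
def BigOOnCone (k : ℕ) (q : ℝ) (F : ℝ × ℝ → ℝ) : Prop :=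
  ∃ C : ℝ, ∀ j ≤ k, ∀ r, 2 * S.M < r → S.u (S.v₀, r) < 0 → S.u (S.v₀, r) ≠ -1 →
    |S.Lbar^[j] F (S.v₀, r)| ≤ C * |1 + S.u (S.v₀, r)| ^ (-q - j)

/-- `φ` is a smooth spherically symmetric solution of `□φ = 0` on `{v ≥ v₀}`, up to and including
the event horizon `{r = 2M}`, without incoming radiation from past null infinity and with
`∂_u(rφ) = 2 I / (1+u)² + O_4(|1+u|^{-2-εφ})` for `u < 0` on the cone `{v = v₀}`.
At fixed `v`, `u → -∞` is the same as `r → ∞`. -/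
structure IsScatteringSolution (φ : ℝ × ℝ → ℝ) (I εφ : ℝ) : Prop where
  smooth : ContDiffOn ℝ ∞ φ S.dom
  wave : ∀ p ∈ S.dom, S.box φ p = 0
  data : S.BigOOnCone 4 (2 + εφ) fun p => S.Lbar (rad φ) p - 2 * I / (1 + S.u p) ^ 2
  noIncoming : ∀ v, S.v₀ ≤ v → Tendsto (fun r => rad φ (v, r)) atTop (𝓝 0)

end Setting

end

end Schwarzschild

/-! Let ψ = rφ, which is `rad φ`. The wave equation becomes ∂_u L ψ = -(D/2)(M/r³) ψ. The source is
present only because of the mass and is cubically small, so it can be integrated along ingoing cones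
(for Lψ) and along outgoing cones (for ∂_u ψ). This is done in the region u ≤ u₁, v ≥ v₀ for
arbitrary u₁, which stays away from the horizon; there `delay` = 1 + u₁ - u is at least 1 and at
most a multiple of r.

Leading behaviour: two Grönwall arguments bound ψ. Then ∂_u ψ, carried from v = v₀ along outgoing
cones, changes only by O(delay⁻³), so ∂_u ψ ≈ 2I/delay². Integration from past null infinity, where
ψ vanishes, gives ψ ≈ 2I/delay (`IsWave.exists_abs_sub_le_delay_rpow`). At fixed v the delay is
asymptotic to 2r, whence the first limit.

The logarithm: Lψ vanishes at past null infinity as well (`tendsto_L_zero`), so at radius r on the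
cone u = u₁ it is -∫_r^∞ M x⁻³ ψ dx, with ψ ≈ 2I/(1 + 2(x - r)). The integrand behaves like the
inverse distance up to the scale r, so Lψ ≈ -MI log r / r³ and ∂_r ψ ≈ -2MI log r / r³. The next
coefficient J is reached without expanding this integral: the combination 3Lψ + 2r L²ψ has no
logarithm and equals -MI/r³ up to O(r^(-3-β)) (`IsWave.exists_abs_scaling_le`). Times 2r² it is, to
leading order, the derivative of r³ ∂_r ψ along the cone, so r³ ∂_r ψ + 2MI log r converges with a
rate.

Energies: commuting with L gives L^(k+1) ψ = O(r^(-3-k+η)) for every small η > 0, and T = L + ∂_u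
carries the bounds over to T-derivatives on the cone. The weights 5 - ε and 7 - ε are then
integrable. The rest of Σ₀ is compact and φ is smooth there up to the horizon. -/

namespace Schwarzschild

noncomputable section

namespace Setting

section

variable (S : Setting)

/-! ### Calculus on the exterior of the horizon -/

/-- The part `{v ≥ v₀, r > 2M}` of the domain outside the horizon. -/
def exterior : Set (ℝ × ℝ) := Ici S.v₀ ×ˢ Ioi (2 * S.M)

/-- Smoothness up to the boundary `{v = v₀}` outside the horizon. -/
abbrev IsSmooth (f : ℝ × ℝ → ℝ) : Prop := ContDiffOn ℝ ∞ f S.exterior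

/-- The double null derivative `L = ∂_v + (D/2) ∂_r`. -/
def L : (ℝ × ℝ → ℝ) → (ℝ × ℝ → ℝ) := S.along fun p => (1, S.D p.2 / 2)

variable {S} {f g : ℝ × ℝ → ℝ} {p : ℝ × ℝ} {X : ℝ × ℝ → ℝ × ℝ}

lemma exterior_subset_dom : S.exterior ⊆ S.dom := prod_mono subset_rfl Ioi_subset_Ici_self

lemma mem_exterior : p ∈ S.exterior ↔ S.v₀ ≤ p.1 ∧ 2 * S.M < p.2 := Iff.rfl

lemma uniqueDiffOn_exterior : UniqueDiffOn ℝ S.exterior :=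
  (uniqueDiffOn_Ici _).prod (uniqueDiffOn_Ioi _)

lemma uniqueDiffOn_dom : UniqueDiffOn ℝ S.dom := (uniqueDiffOn_Ici _).prod (uniqueDiffOn_Ici _)

/-- `exterior` is relatively open in `dom`, so derivatives within either set agree off the horizon,
where division by `D` is allowed. -/
lemma exterior_eventuallyEq_dom (hp : p ∈ S.exterior) : S.dom =ᶠ[𝓝 p] S.exterior := by
  have : ∀ᶠ q : ℝ × ℝ in 𝓝 p, 2 * S.M < q.2 :=
    continuous_snd.continuousAt.eventually (lt_mem_nhds (mem_exterior.1 hp).2)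
  filter_upwards [this] with q hq
  refine propext ⟨fun h => ⟨h.1, hq⟩, fun h => exterior_subset_dom h⟩

lemma fderivWithin_dom (hp : p ∈ S.exterior) :
    fderivWithin ℝ f S.dom p = fderivWithin ℝ f S.exterior p :=
  fderivWithin_congr_set (exterior_eventuallyEq_dom hp)

lemma pos_of_mem (hp : p ∈ S.exterior) : 0 < p.2 :=
  lt_trans (by linarith [S.M_pos]) (mem_exterior.1 hp).2

lemma D_pos {r : ℝ} (hr : 2 * S.M < r) : 0 < S.D r := by
  have h0 : 0 < r := lt_trans (by linarith [S.M_pos]) hr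
  have : 2 * S.M / r < 1 := (div_lt_one h0).2 hr
  simp only [D]; linarith

lemma D_le_one {r : ℝ} (hr : 2 * S.M ≤ r) : S.D r ≤ 1 := by
  have hM := S.M_pos
  have h0 : 0 < r := by linarith
  have : 0 ≤ 2 * S.M / r := by positivity
  simp only [D]; linarith

lemma hasDerivAt_D {r : ℝ} (hr : r ≠ 0) : HasDerivAt S.D (2 * S.M / r ^ 2) r := by
  have h := ((hasDerivAt_inv hr).const_mul (2 * S.M)).const_sub 1
  have e : S.D = fun x => 1 - 2 * S.M * x⁻¹ := by
    funext x; simp only [D, div_eq_mul_inv]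
  rw [e]; exact h.congr_deriv (by ring)

lemma IsSmooth.differentiableWithinAt (hf : S.IsSmooth f) (hp : p ∈ S.exterior) :
    DifferentiableWithinAt ℝ f S.exterior p :=
  (ContDiffOn.differentiableOn hf (by simp)) p hp

lemma IsSmooth.differentiableWithinAt_dom (hf : S.IsSmooth f) (hp : p ∈ S.exterior) :
    DifferentiableWithinAt ℝ f S.dom p :=
  (differentiableWithinAt_congr_set (exterior_eventuallyEq_dom hp)).2
    (hf.differentiableWithinAt hp)

lemma along_exterior (hp : p ∈ S.exterior) :
    S.along X f p = fderivWithin ℝ f S.exterior p (X p) := by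
  rw [along, fderivWithin_dom hp]

lemma along_eq (X : ℝ × ℝ → ℝ × ℝ) (f : ℝ × ℝ → ℝ) (p : ℝ × ℝ) :
    S.along X f p = (X p).1 * S.T f p + (X p).2 * S.drIn f p := by
  have : X p = (X p).1 • ((1 : ℝ), (0 : ℝ)) + (X p).2 • ((0 : ℝ), (1 : ℝ)) := by
    ext <;> simp
  simp only [T, drIn, along]
  conv_lhs => rw [this]
  rw [map_add, map_smul, map_smul, smul_eq_mul, smul_eq_mul]

lemma L_eq (f : ℝ × ℝ → ℝ) (p : ℝ × ℝ) : S.L f p = S.T f p + S.D p.2 / 2 * S.drIn f p := by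
  rw [L, along_eq]; simp

lemma Lbar_eq (f : ℝ × ℝ → ℝ) (p : ℝ × ℝ) : S.Lbar f p = -(S.D p.2 / 2) * S.drIn f p := by
  rw [Lbar, along_eq]; simp

lemma drOut_eq (f : ℝ × ℝ → ℝ) (p : ℝ × ℝ) :
    S.drOut f p = 2 / S.D p.2 * S.T f p + S.drIn f p := by
  rw [drOut, along_eq]; simp

lemma drOut_eq_L (hp : p ∈ S.exterior) : S.drOut f p = 2 / S.D p.2 * S.L f p := by
  rw [drOut_eq, L_eq]
  have := (D_pos hp.2).ne'
  field_simp

lemma drIn_eq_Lbar (hp : p ∈ S.exterior) : S.drIn f p = -(2 / S.D p.2) * S.Lbar f p := by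
  rw [Lbar_eq]
  have := (D_pos hp.2).ne'
  field_simp

lemma T_eq (f : ℝ × ℝ → ℝ) (p : ℝ × ℝ) : S.T f p = S.L f p + S.Lbar f p := by
  rw [L_eq, Lbar_eq]; ring

lemma along_congr (h : EqOn f g S.exterior) : EqOn (S.along X f) (S.along X g) S.exterior := by
  intro p hp
  rw [along_exterior hp, along_exterior hp, fderivWithin_congr h (h hp)]

lemma along_add (hf : S.IsSmooth f) (hg : S.IsSmooth g) (hp : p ∈ S.exterior) :
    S.along X (fun q => f q + g q) p = S.along X f p + S.along X g p := by
  simp only [along_exterior hp]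
  rw [fderivWithin_fun_add (uniqueDiffOn_exterior p hp) (hf.differentiableWithinAt hp)
    (hg.differentiableWithinAt hp)]
  rfl

lemma along_neg (hp : p ∈ S.exterior) : S.along X (fun q => -f q) p = -S.along X f p := by
  simp only [along]
  rw [fderivWithin_fun_neg (uniqueDiffOn_dom p (exterior_subset_dom hp))]
  rfl

lemma along_mul (hf : S.IsSmooth f) (hg : S.IsSmooth g) (hp : p ∈ S.exterior) :
    S.along X (fun q => f q * g q) p = S.along X f p * g p + f p * S.along X g p := by
  simp only [along_exterior hp]
  rw [fderivWithin_fun_mul (uniqueDiffOn_exterior p hp) (hf.differentiableWithinAt hp)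
    (hg.differentiableWithinAt hp)]
  simp only [add_apply, smul_apply, smul_eq_mul]
  ring

lemma along_radial {k : ℝ → ℝ} {k' : ℝ} (hp : p ∈ S.exterior) (hk : HasDerivAt k k' p.2) :
    S.along X (fun q => k q.2) p = (X p).2 * k' := by
  rw [along_exterior hp]
  have h := (hk.hasFDerivAt.comp p hasFDerivAt_snd).hasFDerivWithinAt (s := S.exterior)
  have h2 := h.fderivWithin (uniqueDiffOn_exterior p hp)
  have e : (k ∘ Prod.snd : ℝ × ℝ → ℝ) = fun q => k q.2 := rfl
  rw [e] at h2
  rw [h2]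
  simp [mul_comm]

lemma IsSmooth.along (hX : ContDiffOn ℝ ∞ X S.exterior) (hf : S.IsSmooth f) :
    S.IsSmooth (S.along X f) :=
  ((hf.fderivWithin uniqueDiffOn_exterior (by simp)).clm_apply hX).congr
    fun _ hp => along_exterior hp

lemma isSmooth_radial {k : ℝ → ℝ} (hk : ContDiffOn ℝ ∞ k (Ioi (2 * S.M))) :
    S.IsSmooth fun p => k p.2 :=
  hk.comp contDiffOn_snd fun _ hp => hp.2

lemma isSmooth_snd : S.IsSmooth fun p => p.2 := contDiffOn_snd

lemma contDiffOn_D : ContDiffOn ℝ ∞ S.D (Ioi (2 * S.M)) := by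
  refine contDiffOn_const.sub (contDiffOn_const.div contDiffOn_id fun r hr => ?_)
  exact (lt_trans (by linarith [S.M_pos]) hr : (0 : ℝ) < r).ne'

lemma contDiffOn_two_div_D : ContDiffOn ℝ ∞ (fun r => 2 / S.D r) (Ioi (2 * S.M)) :=
  contDiffOn_const.div contDiffOn_D fun _ hr => (D_pos hr).ne'

lemma IsSmooth.T (hf : S.IsSmooth f) : S.IsSmooth (S.T f) := hf.along contDiffOn_const

lemma IsSmooth.drIn (hf : S.IsSmooth f) : S.IsSmooth (S.drIn f) := hf.along contDiffOn_const

lemma IsSmooth.L (hf : S.IsSmooth f) : S.IsSmooth (S.L f) :=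
  hf.along (contDiffOn_const.prodMk ((isSmooth_radial contDiffOn_D).div_const 2))

lemma IsSmooth.Lbar (hf : S.IsSmooth f) : S.IsSmooth (S.Lbar f) :=
  hf.along (contDiffOn_const.prodMk ((isSmooth_radial contDiffOn_D).div_const 2).neg)

lemma IsSmooth.drOut (hf : S.IsSmooth f) : S.IsSmooth (S.drOut f) :=
  hf.along ((isSmooth_radial contDiffOn_two_div_D).prodMk contDiffOn_const)

lemma IsSmooth.iterate_L (hf : S.IsSmooth f) (k : ℕ) : S.IsSmooth (S.L^[k] f) := by
  induction k with
  | zero => exact hf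
  | succ k ih => rw [Function.iterate_succ_apply']; exact ih.L

lemma IsSmooth.iterate_T (hf : S.IsSmooth f) (k : ℕ) : S.IsSmooth (S.T^[k] f) := by
  induction k with
  | zero => exact hf
  | succ k ih => rw [Function.iterate_succ_apply']; exact ih.T

/-- Derivatives at `v = v₀` are one-sided; being a limit of interior points is what makes the second
derivative symmetric there. -/
lemma interior_closure (hp : p ∈ S.exterior) : p ∈ closure (interior S.exterior) := by
  rw [exterior, interior_prod_eq, interior_Ici, interior_Ioi, closure_prod_eq, closure_Ioi,
    closure_Ioi]
  exact ⟨hp.1, le_of_lt (mem_exterior.1 hp).2⟩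

/-- Coordinate derivatives commute. -/
lemma T_drIn (hf : S.IsSmooth f) (hp : p ∈ S.exterior) :
    S.T (S.drIn f) p = S.drIn (S.T f) p := by
  have hsym : IsSymmSndFDerivWithinAt ℝ f S.exterior p :=
    (hf p hp).isSymmSndFDerivWithinAt (by simpa using ENat.LEInfty.out) uniqueDiffOn_exterior (interior_closure hp) hp
  have hd : DifferentiableWithinAt ℝ (fderivWithin ℝ f S.exterior) S.exterior p :=
    ((hf.fderivWithin uniqueDiffOn_exterior (m := ∞) (by simp)).differentiableOn (by simp)) p hp
  have key : ∀ a b : ℝ × ℝ, S.along (fun _ => a) (S.along (fun _ => b) f) p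
      = fderivWithin ℝ (fderivWithin ℝ f S.exterior) S.exterior p a b := by
    intro a b
    rw [along_exterior hp, fderivWithin_congr (fun q hq => along_exterior hq) (along_exterior hp),
      fderivWithin_clm_apply (uniqueDiffOn_exterior p hp) hd (differentiableWithinAt_const _)]
    simp
  simp only [T, drIn]
  rw [key, key]
  exact hsym.eq _ _

/-- The double null coordinate derivatives commute. -/
lemma Lbar_L (hf : S.IsSmooth f) (hp : p ∈ S.exterior) :
    S.Lbar (S.L f) p = S.L (S.Lbar f) p := by
  have hr := (pos_of_mem hp).ne'
  have hDs : S.IsSmooth fun q => S.D q.2 / 2 := (isSmooth_radial contDiffOn_D).div_const 2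
  have hD2 : HasDerivAt (fun r => S.D r / 2) (2 * S.M / p.2 ^ 2 / 2) p.2 :=
    (hasDerivAt_D hr).div_const 2
  have e1 : ∀ X, S.along X (S.L f) p = S.along X (S.T f) p
      + ((X p).2 * (2 * S.M / p.2 ^ 2 / 2) * S.drIn f p
        + S.D p.2 / 2 * S.along X (S.drIn f) p) := by
    intro X
    rw [along_congr (fun q _ => L_eq f q) hp, along_add hf.T (hDs.mul hf.drIn) hp,
      along_mul hDs hf.drIn hp, along_radial hp hD2]
  have e2 : ∀ X, S.along X (S.Lbar f) p =
      -((X p).2 * (2 * S.M / p.2 ^ 2 / 2) * S.drIn f p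
        + S.D p.2 / 2 * S.along X (S.drIn f) p) := by
    intro X
    have : EqOn (S.Lbar f) (fun q => -(S.D q.2 / 2 * S.drIn f q)) S.exterior := by
      intro q _; simp only [Lbar_eq]; ring
    rw [along_congr this hp, along_neg hp, along_mul hDs hf.drIn hp, along_radial hp hD2]
  have h1 := e1 fun p => (0, -(S.D p.2 / 2))
  have h2 := e2 fun p => (1, S.D p.2 / 2)
  have h3 : S.Lbar (S.T f) p = -(S.D p.2 / 2) * S.drIn (S.T f) p := Lbar_eq _ _
  have h4 : S.Lbar (S.drIn f) p = -(S.D p.2 / 2) * S.drIn (S.drIn f) p := Lbar_eq _ _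
  have h5 : S.L (S.drIn f) p = S.T (S.drIn f) p + S.D p.2 / 2 * S.drIn (S.drIn f) p := L_eq _ _
  rw [T_drIn hf hp] at h5
  change S.Lbar (S.L f) p = S.Lbar (S.T f) p + (_ * _ * _ + _ * S.Lbar (S.drIn f) p) at h1
  change S.L (S.Lbar f) p = -(_ * _ * _ + _ * S.L (S.drIn f) p) at h2
  rw [h1, h2, h3, h4, h5]
  ring

/-- Allows the transport equation for `L f` to be differentiated any number of times in `L` without
commutator terms. -/
lemma Lbar_iterate_L (hf : S.IsSmooth f) (k : ℕ) (hp : p ∈ S.exterior) :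
    S.Lbar (S.L^[k] f) p = S.L^[k] (S.Lbar f) p := by
  induction k generalizing p with
  | zero => rfl
  | succ k ih =>
    rw [Function.iterate_succ_apply', Lbar_L (hf.iterate_L k) hp, Function.iterate_succ_apply']
    exact along_congr (fun q hq => ih hq) hp

end

section

variable {S : Setting} {f g : ℝ × ℝ → ℝ} {p : ℝ × ℝ}

/-! ### The radial wave equation -/

variable (S) in
/-- The equation satisfied by the radiation field of a spherically symmetric wave. -/
def IsWave (f : ℝ × ℝ → ℝ) : Prop :=
  ∀ p ∈ S.exterior, 2 * S.T (S.drIn f) p + 2 * S.M / p.2 ^ 2 * S.drIn f p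
    + S.D p.2 * S.drIn (S.drIn f) p = 2 * S.M / p.2 ^ 3 * f p

lemma along_radial_mul {X : ℝ × ℝ → ℝ × ℝ} {k : ℝ → ℝ} {k' : ℝ}
    (hk : ContDiffOn ℝ ∞ k (Ioi (2 * S.M))) (hg : S.IsSmooth g) (hp : p ∈ S.exterior)
    (hk' : HasDerivAt k k' p.2) :
    S.along X (fun q => k q.2 * g q) p = (X p).2 * k' * g p + k p.2 * S.along X g p := by
  rw [along_mul (isSmooth_radial hk) hg hp, along_radial hp hk']

lemma T_radial_mul {k : ℝ → ℝ} (hk : ContDiffOn ℝ ∞ k (Ioi (2 * S.M))) (hg : S.IsSmooth g)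
    (hp : p ∈ S.exterior) : S.T (fun q => k q.2 * g q) p = k p.2 * S.T g p := by
  have hd : HasDerivAt k (deriv k p.2) p.2 :=
    ((hk.differentiableOn (by simp)).differentiableAt (Ioi_mem_nhds hp.2)).hasDerivAt
  have := along_radial_mul (X := fun _ => (1, 0)) hk hg hp hd
  simp only [zero_mul, zero_add] at this
  exact this

lemma drIn_add (hf : S.IsSmooth f) (hg : S.IsSmooth g) (hp : p ∈ S.exterior) :
    S.drIn (fun q => f q + g q) p = S.drIn f p + S.drIn g p := along_add hf hg hp

lemma drIn_radial_mul {k : ℝ → ℝ} {k' : ℝ} (hk : ContDiffOn ℝ ∞ k (Ioi (2 * S.M)))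
    (hg : S.IsSmooth g) (hp : p ∈ S.exterior) (hk' : HasDerivAt k k' p.2) :
    S.drIn (fun q => k q.2 * g q) p = k' * g p + k p.2 * S.drIn g p := by
  have := along_radial_mul (X := fun _ => (0, 1)) hk hg hp hk'
  simp only [one_mul] at this
  exact this

lemma contDiffOn_const_div_pow (c : ℝ) (n : ℕ) :
    ContDiffOn ℝ ∞ (fun r => c / r ^ n) (Ioi (2 * S.M)) := by
  refine contDiffOn_const.div (contDiffOn_id.pow n) fun r hr => pow_ne_zero _ ?_
  exact (lt_trans (by linarith [S.M_pos]) hr : (0 : ℝ) < r).ne'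

lemma IsSmooth.rad (hf : S.IsSmooth f) : S.IsSmooth (rad f) := isSmooth_snd.mul hf

lemma T_rad (hf : S.IsSmooth f) (hp : p ∈ S.exterior) :
    S.T (rad f) p = rad (S.T f) p := T_radial_mul contDiffOn_id hf hp

lemma along_rad {X : ℝ × ℝ → ℝ × ℝ} (hf : S.IsSmooth f) (hp : p ∈ S.exterior) :
    S.along X (rad f) p = (X p).2 * f p + p.2 * S.along X f p := by
  have := along_radial_mul (X := X) contDiffOn_id hf hp (hasDerivAt_id _)
  rw [mul_one] at this
  exact this

lemma iterate_T_rad (hf : S.IsSmooth f) (k : ℕ) :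
    EqOn (S.T^[k] (rad f)) (rad (S.T^[k] f)) S.exterior := by
  induction k with
  | zero => exact fun _ _ => rfl
  | succ k ih =>
    intro p hp
    rw [Function.iterate_succ_apply', Function.iterate_succ_apply', ← T_rad (hf.iterate_T k) hp]
    exact along_congr ih hp

/-- The factor r absorbs the first-order term 2rTφ of the wave operator. What remains of order zero
is D'/r = 2M/r³, which vanishes in flat space. -/
lemma isWave_rad (hf : S.IsSmooth f) (h : ∀ p ∈ S.exterior, S.box f p = 0) :
    S.IsWave (rad f) := by
  intro p hp
  have hr := pos_of_mem hp
  have h0 := h p hp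
  have hD : HasDerivAt (fun r => r ^ 2 * S.D r) (2 * p.2 * S.D p.2 + p.2 ^ 2 * (2 * S.M / p.2 ^ 2))
      p.2 := by
    have := (hasDerivAt_pow 2 p.2).mul (hasDerivAt_D (S := S) hr.ne')
    exact this.congr_deriv (by push_cast; ring)
  have hDs : ContDiffOn ℝ ∞ (fun r => r ^ 2 * S.D r) (Ioi (2 * S.M)) :=
    (contDiffOn_id.pow 2).mul contDiffOn_D
  have hsq : ContDiffOn ℝ ∞ (fun r : ℝ => r ^ 2) (Ioi (2 * S.M)) := contDiffOn_id.pow 2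
  have e1 : S.T (fun q => q.2 ^ 2 * S.drIn f q) p = p.2 ^ 2 * S.T (S.drIn f) p :=
    T_radial_mul hsq hf.drIn hp
  have e2 : S.drIn (fun q => q.2 ^ 2 * (S.T f q + S.D q.2 * S.drIn f q)) p
      = 2 * p.2 * S.T f p + p.2 ^ 2 * S.drIn (S.T f) p
        + ((2 * p.2 * S.D p.2 + p.2 ^ 2 * (2 * S.M / p.2 ^ 2)) * S.drIn f p
          + p.2 ^ 2 * S.D p.2 * S.drIn (S.drIn f) p) := by
    have : (fun q : ℝ × ℝ => q.2 ^ 2 * (S.T f q + S.D q.2 * S.drIn f q))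
        = fun q => q.2 ^ 2 * S.T f q + q.2 ^ 2 * S.D q.2 * S.drIn f q := by
      funext q; ring
    rw [this, drIn_add ((isSmooth_radial hsq).mul hf.T) ((isSmooth_radial hDs).mul hf.drIn)
      hp, drIn_radial_mul hsq hf.T hp (hasDerivAt_pow 2 p.2), drIn_radial_mul hDs hf.drIn hp hD]
    push_cast
    ring
  rw [box, e1, e2, T_drIn hf hp] at h0
  have h1 : p.2 ^ 2 * S.drIn (S.T f) p + (2 * p.2 * S.T f p + p.2 ^ 2 * S.drIn (S.T f) p
        + ((2 * p.2 * S.D p.2 + p.2 ^ 2 * (2 * S.M / p.2 ^ 2)) * S.drIn f p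
          + p.2 ^ 2 * S.D p.2 * S.drIn (S.drIn f) p)) = 0 :=
    (mul_eq_zero.1 h0).resolve_left (by positivity)
  have a1 : EqOn (S.drIn (rad f)) (fun q => f q + rad (S.drIn f) q) S.exterior := by
    intro q hq
    rw [drIn, along_rad hf hq, ← drIn]
    simp [rad]
  have a2 : S.drIn (S.drIn (rad f)) p = 2 * S.drIn f p + p.2 * S.drIn (S.drIn f) p := by
    have : S.drIn (S.drIn (rad f)) p = _ := along_congr a1 hp
    rw [this, along_add hf hf.drIn.rad hp, along_rad hf.drIn hp, ← drIn]
    ring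
  have a3 : S.T (S.drIn (rad f)) p = S.T f p + p.2 * S.drIn (S.T f) p := by
    have : S.T (S.drIn (rad f)) p = _ := along_congr a1 hp
    rw [this, along_add hf hf.drIn.rad hp, along_rad hf.drIn hp, ← T, T_drIn hf hp]
    ring
  rw [a2, a3, a1 hp]
  simp only [rad]
  have hDe : S.D p.2 = 1 - 2 * S.M / p.2 := rfl
  rw [hDe] at h1 ⊢
  field_simp at h1 ⊢
  linear_combination p.2 * h1

lemma IsWave.T (hf : S.IsSmooth f) (h : S.IsWave f) : S.IsWave (S.T f) := by
  intro p hp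
  have s1 := contDiffOn_const_div_pow (S := S) (2 * S.M) 2
  have s2 := contDiffOn_const_div_pow (S := S) (2 * S.M) 3
  have e : EqOn (fun q => 2 * S.T (S.drIn f) q + 2 * S.M / q.2 ^ 2 * S.drIn f q
    + S.D q.2 * S.drIn (S.drIn f) q) (fun q => 2 * S.M / q.2 ^ 3 * f q) S.exterior := h
  have e1 := along_congr (X := fun _ => (1, 0)) e hp
  have c2 : ContDiffOn ℝ ∞ (fun _ : ℝ => (2 : ℝ)) (Ioi (2 * S.M)) := contDiffOn_const
  rw [along_add (((isSmooth_radial c2).mul hf.drIn.T).add ((isSmooth_radial s1).mul hf.drIn))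
      ((isSmooth_radial contDiffOn_D).mul hf.drIn.drIn) hp,
    along_add ((isSmooth_radial c2).mul hf.drIn.T) ((isSmooth_radial s1).mul hf.drIn) hp] at e1
  change S.T _ p + S.T _ p + S.T _ p = S.T _ p at e1
  rw [T_radial_mul c2 hf.drIn.T hp, T_radial_mul s1 hf.drIn hp, T_radial_mul s2 hf hp,
    T_radial_mul contDiffOn_D hf.drIn.drIn hp] at e1
  have b1 : S.T (S.T (S.drIn f)) p = S.T (S.drIn (S.T f)) p :=
    along_congr (fun q hq => T_drIn hf hq) hp
  have b2 : S.T (S.drIn (S.drIn f)) p = S.drIn (S.drIn (S.T f)) p := by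
    rw [T_drIn hf.drIn hp]
    exact along_congr (fun q hq => T_drIn hf hq) hp
  rw [b1, b2, T_drIn hf hp] at e1
  exact e1

lemma IsWave.iterate_T (hf : S.IsSmooth f) (h : S.IsWave f) (k : ℕ) : S.IsWave (S.T^[k] f) := by
  induction k with
  | zero => exact h
  | succ k ih => rw [Function.iterate_succ_apply']; exact ih.T (hf.iterate_T k)

lemma drIn_L_eq (hf : S.IsSmooth f) (hp : p ∈ S.exterior) :
    S.drIn (S.L f) p = S.drIn (S.T f) p + (S.M / p.2 ^ 2 * S.drIn f p
      + S.D p.2 / 2 * S.drIn (S.drIn f) p) := by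
  have hD2 : HasDerivAt (fun r => S.D r / 2) (2 * S.M / p.2 ^ 2 / 2) p.2 :=
    (hasDerivAt_D (pos_of_mem hp).ne').div_const 2
  have hDs : ContDiffOn ℝ ∞ (fun r => S.D r / 2) (Ioi (2 * S.M)) := contDiffOn_D.div_const 2
  have : S.drIn (S.L f) p = S.drIn _ p := along_congr (fun q _ => L_eq f q) hp
  rw [this, drIn_add hf.T ((isSmooth_radial hDs).mul hf.drIn) hp,
    drIn_radial_mul hDs hf.drIn hp hD2]
  ring

/-- The wave equation as a transport equation for `L f` along ingoing cones. -/
lemma IsWave.drIn_L (hf : S.IsSmooth f) (h : S.IsWave f) (hp : p ∈ S.exterior) :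
    S.drIn (S.L f) p = S.M / p.2 ^ 3 * f p := by
  have h1 := h p hp
  rw [T_drIn hf hp] at h1
  rw [drIn_L_eq hf hp]
  linear_combination h1 / 2

lemma IsWave.Lbar_L (hf : S.IsSmooth f) (h : S.IsWave f) (hp : p ∈ S.exterior) :
    S.Lbar (S.L f) p = -(S.D p.2 / 2 * (S.M / p.2 ^ 3)) * f p := by
  rw [Lbar_eq, h.drIn_L hf hp]
  ring

/-- The wave equation as a transport equation for `∂_u f` along outgoing cones. -/
lemma IsWave.drOut_Lbar (hf : S.IsSmooth f) (h : S.IsWave f) (hp : p ∈ S.exterior) :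
    S.drOut (S.Lbar f) p = -(S.M / p.2 ^ 3) * f p := by
  have hD := (D_pos hp.2).ne'
  rw [drOut_eq_L hp, ← Setting.Lbar_L hf hp, h.Lbar_L hf hp]
  field_simp

end

section

variable {S : Setting} {f g : ℝ × ℝ → ℝ} {p : ℝ × ℝ}

/-! ### The tortoise coordinate -/

lemma D_eq {r : ℝ} (hr : 2 * S.M < r) : (S.D r)⁻¹ = 1 + 2 * S.M * (r - 2 * S.M)⁻¹ := by
  have h0 : 0 < r := lt_trans (by linarith [S.M_pos]) hr
  have h1 : r - 2 * S.M ≠ 0 := by linarith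
  have : S.D r = (r - 2 * S.M) / r := by rw [D]; field_simp
  rw [this, inv_div]; field_simp; ring

lemma two_M_lt_R : 2 * S.M < S.R := by linarith [S.lt_R, S.M_pos]

lemma rstar_eq {r : ℝ} (hr : 2 * S.M < r) :
    S.rstar r = S.vSigma S.R / 2 - S.R - 2 * S.M * Real.log (S.R - 2 * S.M)
      + (r + 2 * S.M * Real.log (r - 2 * S.M)) := by
  have hlt : ∀ x ∈ uIcc S.R r, 2 * S.M < x := fun x hx =>
    lt_of_lt_of_le (lt_min two_M_lt_R hr) hx.1
  have hd : ∀ x ∈ uIcc S.R r, HasDerivAt (fun x => x + 2 * S.M * Real.log (x - 2 * S.M))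
      ((S.D x)⁻¹) x := by
    intro x hx
    have hx' := hlt x hx
    have h1 : x - 2 * S.M ≠ 0 := by linarith
    rw [D_eq hx']
    have := (hasDerivAt_id x).add
      ((((hasDerivAt_id x).sub_const (2 * S.M)).log h1).const_mul (2 * S.M))
    exact this.congr_deriv (by simp)
  have hc : ContinuousOn (fun x => (S.D x)⁻¹) (uIcc S.R r) := fun x hx =>
    ((contDiffOn_D.continuousOn.continuousAt (Ioi_mem_nhds (hlt x hx))).inv₀
      (D_pos (hlt x hx)).ne').continuousWithinAt
  rw [rstar, intervalIntegral.integral_eq_sub_of_hasDerivAt hd hc.intervalIntegrable]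
  ring

lemma hasDerivAt_rstar {r : ℝ} (hr : 2 * S.M < r) : HasDerivAt S.rstar (S.D r)⁻¹ r := by
  have h1 : r - 2 * S.M ≠ 0 := by linarith
  have h2 := (((hasDerivAt_id r).add
      ((((hasDerivAt_id r).sub_const (2 * S.M)).log h1).const_mul (2 * S.M))).const_add
      (S.vSigma S.R / 2 - S.R - 2 * S.M * Real.log (S.R - 2 * S.M)))
  rw [D_eq hr]
  refine (h2.congr_deriv (by simp)).congr_of_eventuallyEq ?_
  filter_upwards [Ioi_mem_nhds hr] with x hx
  exact rstar_eq hx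

lemma continuousOn_rstar : ContinuousOn S.rstar (Ioi (2 * S.M)) := fun _ hr =>
  (hasDerivAt_rstar hr).continuousAt.continuousWithinAt

lemma strictMonoOn_rstar : StrictMonoOn S.rstar (Ioi (2 * S.M)) := by
  refine strictMonoOn_of_deriv_pos (convex_Ioi _) continuousOn_rstar fun r hr => ?_
  rw [interior_Ioi] at hr
  rw [(hasDerivAt_rstar hr).deriv]
  exact inv_pos.2 (D_pos hr)

lemma tendsto_rstar_atTop : Tendsto S.rstar atTop atTop := by
  have h1 : Tendsto (fun r => r - 2 * S.M) atTop atTop :=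
    tendsto_atTop_add_const_right _ _ tendsto_id
  have h2 : Tendsto (fun r => r + 2 * S.M * Real.log (r - 2 * S.M)) atTop atTop :=
    tendsto_id.atTop_add_atTop ((Real.tendsto_log_atTop.comp h1).const_mul_atTop
      (by linarith [S.M_pos]))
  refine (tendsto_atTop_add_const_left _
    (S.vSigma S.R / 2 - S.R - 2 * S.M * Real.log (S.R - 2 * S.M)) h2).congr' ?_
  filter_upwards [Ioi_mem_atTop (2 * S.M)] with r hr
  exact (rstar_eq hr).symm

lemma tendsto_rstar_atBot : Tendsto S.rstar (𝓝[>] (2 * S.M)) atBot := by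
  have h1 : Tendsto (fun r => r - 2 * S.M) (𝓝[>] (2 * S.M)) (𝓝[>] 0) := by
    refine tendsto_nhdsWithin_iff.2 ⟨?_, ?_⟩
    · have : Tendsto (fun r => r - 2 * S.M) (𝓝 (2 * S.M)) (𝓝 (2 * S.M - 2 * S.M)) :=
        (continuous_id.sub continuous_const).tendsto _
      rw [sub_self] at this
      exact this.mono_left nhdsWithin_le_nhds
    · filter_upwards [self_mem_nhdsWithin] with r hr
      exact sub_pos.2 (mem_Ioi.1 hr)
  have h2 : Tendsto (fun r => 2 * S.M * Real.log (r - 2 * S.M)) (𝓝[>] (2 * S.M)) atBot :=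
    (Real.tendsto_log_nhdsGT_zero.comp h1).const_mul_atBot (by linarith [S.M_pos])
  have h3 : Tendsto (fun r : ℝ => S.vSigma S.R / 2 - S.R - 2 * S.M * Real.log (S.R - 2 * S.M) + r)
      (𝓝[>] (2 * S.M)) (𝓝 _) :=
    ((continuous_const.add continuous_id).tendsto _).mono_left nhdsWithin_le_nhds
  refine (h3.add_atBot h2).congr' ?_
  filter_upwards [self_mem_nhdsWithin] with r hr
  rw [rstar_eq hr]; ring

lemma exists_rstar_eq (S : Setting) (x : ℝ) : ∃ r, 2 * S.M < r ∧ S.rstar r = x := by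
  have h := isPreconnected_Ioi.intermediate_value_Iii (l₁ := 𝓝[>] (2 * S.M)) (l₂ := atTop)
    (inf_le_right) (le_principal_iff.2 (Ioi_mem_atTop (2 * S.M))) continuousOn_rstar
    tendsto_rstar_atBot tendsto_rstar_atTop
  obtain ⟨r, hr, hx⟩ := h (mem_univ x)
  exact ⟨r, hr, hx⟩

variable (S) in
/-- The inverse of the tortoise coordinate. -/
def radius (x : ℝ) : ℝ := (exists_rstar_eq S x).choose

lemma radius_gt (S : Setting) (x : ℝ) : 2 * S.M < S.radius x := (exists_rstar_eq S x).choose_spec.1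

@[simp] lemma rstar_radius (S : Setting) (x : ℝ) : S.rstar (S.radius x) = x :=
  (exists_rstar_eq S x).choose_spec.2

lemma radius_le_iff {x r : ℝ} (hr : 2 * S.M < r) : S.radius x ≤ r ↔ x ≤ S.rstar r := by
  conv_rhs => rw [← rstar_radius S x]
  exact (strictMonoOn_rstar.le_iff_le (radius_gt S x) hr).symm

lemma le_radius_iff {x r : ℝ} (hr : 2 * S.M < r) : r ≤ S.radius x ↔ S.rstar r ≤ x := by
  conv_rhs => rw [← rstar_radius S x]
  exact (strictMonoOn_rstar.le_iff_le hr (radius_gt S x)).symm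

lemma radius_mono : Monotone S.radius := fun x y h =>
  (radius_le_iff (radius_gt S y)).2 (by rwa [rstar_radius])

lemma rstar_le_rstar {r₁ r₂ : ℝ} (h₁ : 2 * S.M < r₁) (h : r₁ ≤ r₂) : S.rstar r₁ ≤ S.rstar r₂ :=
  (strictMonoOn_rstar.le_iff_le h₁ (h₁.trans_le h)).2 h

/-- The tortoise coordinate grows at least as fast as the radius. -/
lemma sub_le_rstar_sub {r₁ r₂ : ℝ} (h₁ : 2 * S.M < r₁) (h : r₁ ≤ r₂) :
    r₂ - r₁ ≤ S.rstar r₂ - S.rstar r₁ := by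
  rw [rstar_eq h₁, rstar_eq (h₁.trans_le h)]
  have : Real.log (r₁ - 2 * S.M) ≤ Real.log (r₂ - 2 * S.M) :=
    Real.log_le_log (by linarith) (by linarith)
  nlinarith [S.M_pos]

/-- The logarithmic correction of the tortoise coordinate. -/
lemma rstar_sub_le {r₁ r₂ : ℝ} (h₁ : 2 * S.M < r₁) (h : r₁ ≤ r₂) :
    S.rstar r₂ - S.rstar r₁ ≤ r₂ - r₁ + 2 * S.M * ((r₂ - r₁) / (r₁ - 2 * S.M)) := by
  rw [rstar_eq h₁, rstar_eq (h₁.trans_le h)]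
  have h2 : 0 < r₁ - 2 * S.M := by linarith
  have h3 : 0 < r₂ - 2 * S.M := by linarith
  have : Real.log (r₂ - 2 * S.M) - Real.log (r₁ - 2 * S.M) ≤ (r₂ - r₁) / (r₁ - 2 * S.M) := by
    rw [← Real.log_div h3.ne' h2.ne']
    refine (Real.log_le_sub_one_of_pos (by positivity)).trans (le_of_eq ?_)
    field_simp; ring
  nlinarith [S.M_pos]

/-- The logarithm is dominated by r, and the additive constant is absorbed because r > 2M. -/
lemma exists_rstar_le (S : Setting) : ∃ C, 0 < C ∧ ∀ r, 2 * S.M < r → S.rstar r ≤ C * r := by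
  set c := S.vSigma S.R / 2 - S.R - 2 * S.M * Real.log (S.R - 2 * S.M) with hc
  have hM := S.M_pos
  refine ⟨|c| / (2 * S.M) + 1 + 2 * S.M, by positivity, fun r hr => ?_⟩
  have h1 : Real.log (r - 2 * S.M) ≤ r := by
    have := Real.log_le_sub_one_of_pos (x := r - 2 * S.M) (by linarith)
    linarith
  have h2 : c ≤ |c| / (2 * S.M) * r := by
    calc c ≤ |c| := le_abs_self c
      _ = |c| / (2 * S.M) * (2 * S.M) := by field_simp
      _ ≤ _ := by gcongr
  rw [rstar_eq hr, ← hc]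
  nlinarith

/-! ### Mean value inequalities along the null directions -/

/-- Comparison with an explicit primitive `B` replaces all integrals below. Right derivatives
suffice, as they must for an outgoing curve that starts on the boundary `v = v₀`. -/
lemma abs_sub_le_of_abs_deriv_right_le {f f' B B' : ℝ → ℝ} {a b : ℝ} (hab : a ≤ b)
    (hf : ContinuousOn f (Icc a b)) (hf' : ∀ x ∈ Ico a b, HasDerivWithinAt f (f' x) (Ici x) x)
    (hB : ∀ x ∈ Icc a b, HasDerivAt B (B' x) x) (h : ∀ x ∈ Icc a b, |f' x| ≤ B' x) :
    |f b - f a| ≤ B b - B a := by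
  have hBc : ContinuousOn B (Icc a b) := fun x hx => (hB x hx).continuousAt.continuousWithinAt
  have h1 := image_le_of_deriv_right_le_deriv_boundary (f := f) (B := fun x => f a + (B x - B a))
    hf hf' (by simp) (continuousOn_const.add (hBc.sub continuousOn_const))
    (fun x hx => (((hB x (Ico_subset_Icc_self hx)).sub_const _).const_add _).hasDerivWithinAt)
    (fun x hx => (abs_le.1 (h x (Ico_subset_Icc_self hx))).2) (right_mem_Icc.2 hab)
  have h2 := image_le_of_deriv_right_le_deriv_boundary (f := fun x => -f x)
    (B := fun x => -f a + (B x - B a))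
    hf.neg (fun x hx => (hf' x hx).neg) (by simp)
    (continuousOn_const.add (hBc.sub continuousOn_const))
    (fun x hx => (((hB x (Ico_subset_Icc_self hx)).sub_const _).const_add _).hasDerivWithinAt)
    (fun x hx => by linarith [(abs_le.1 (h x (Ico_subset_Icc_self hx))).1])
    (right_mem_Icc.2 hab)
  rw [abs_le]
  constructor <;> linarith

lemma abs_sub_le_of_abs_drIn_le {B B' : ℝ → ℝ} {v r₁ r₂ : ℝ} (hf : S.IsSmooth f) (hv : S.v₀ ≤ v)
    (h₁ : 2 * S.M < r₁) (h₁₂ : r₁ ≤ r₂) (hB : ∀ x ∈ Icc r₁ r₂, HasDerivAt B (B' x) x)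
    (h : ∀ x ∈ Icc r₁ r₂, |S.drIn f (v, x)| ≤ B' x) :
    |f (v, r₂) - f (v, r₁)| ≤ B r₂ - B r₁ := by
  have hmem : ∀ x, r₁ ≤ x → (v, x) ∈ S.exterior := fun x hx => ⟨hv, h₁.trans_le hx⟩
  refine abs_sub_le_of_abs_deriv_right_le (f := fun x => f (v, x)) h₁₂ ?_ (fun x hx => ?_) hB h
  · exact (ContDiffOn.continuousOn hf).comp (by fun_prop) fun x hx => hmem x hx.1
  · have hp := hmem x hx.1
    have hd := (hf.differentiableWithinAt_dom hp).hasFDerivWithinAt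
    exact hd.comp_hasDerivWithinAt (f := fun y => (v, y)) x
      ((hasDerivWithinAt_const _ _ _).prodMk (hasDerivWithinAt_id _ _))
      fun y hy => exterior_subset_dom (hmem y (hx.1.trans hy))

lemma abs_sub_le_of_abs_drOut_le {B B' : ℝ → ℝ} {w r₁ r₂ : ℝ} (hf : S.IsSmooth f)
    (h₁ : 2 * S.M < r₁) (hw : S.v₀ ≤ w + 2 * S.rstar r₁)
    (h₁₂ : r₁ ≤ r₂) (hB : ∀ x ∈ Icc r₁ r₂, HasDerivAt B (B' x) x)
    (h : ∀ x ∈ Icc r₁ r₂, |S.drOut f (w + 2 * S.rstar x, x)| ≤ B' x) :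
    |f (w + 2 * S.rstar r₂, r₂) - f (w + 2 * S.rstar r₁, r₁)| ≤ B r₂ - B r₁ := by
  have hmem : ∀ x, r₁ ≤ x → (w + 2 * S.rstar x, x) ∈ S.exterior := fun x hx =>
    ⟨hw.trans (by have := rstar_le_rstar h₁ hx; simp only; linarith), h₁.trans_le hx⟩
  refine abs_sub_le_of_abs_deriv_right_le (f := fun x => f (w + 2 * S.rstar x, x)) h₁₂ ?_
    (fun x hx => ?_) hB h
  · refine (ContDiffOn.continuousOn hf).comp ?_ fun x hx => hmem x hx.1
    exact (continuousOn_const.add (continuousOn_const.mul (continuousOn_rstar.mono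
      fun x hx => h₁.trans_le hx.1))).prodMk continuousOn_id
  · have hp := hmem x hx.1
    have hd := (hf.differentiableWithinAt_dom hp).hasFDerivWithinAt
    have hc : HasDerivWithinAt (fun y => (w + 2 * S.rstar y, y)) (2 / S.D x, 1) (Ici x) x := by
      have := ((hasDerivAt_rstar (h₁.trans_le hx.1)).const_mul 2).const_add w
      exact (this.hasDerivWithinAt.prodMk (hasDerivWithinAt_id _ _)).congr_deriv
        (by rw [div_eq_mul_inv])
    exact hd.comp_hasDerivWithinAt (f := fun y => (w + 2 * S.rstar y, y)) x hc
      fun y hy => exterior_subset_dom (hmem y (hx.1.trans hy))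

/-- The hypothesis forces `b` to decrease to 0, hence to be nonnegative, and then says that `f` is
Cauchy. -/
lemma exists_tendsto_of_abs_sub_le {f b : ℝ → ℝ} {a : ℝ} (hb : Tendsto b atTop (𝓝 0))
    (h : ∀ x y, a ≤ x → x ≤ y → |f y - f x| ≤ b x - b y) :
    ∃ l, Tendsto f atTop (𝓝 l) ∧ ∀ x, a ≤ x → |f x - l| ≤ b x := by
  have hb0 : ∀ x, a ≤ x → 0 ≤ b x := fun x hx =>
    le_of_tendsto hb (by
      filter_upwards [Ici_mem_atTop x] with y hy
      linarith [(abs_nonneg _).trans (h x y hx hy)])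
  have hC : Cauchy (map f atTop) := by
    rw [← CauchySeq, Metric.cauchySeq_iff']
    intro ε hε
    obtain ⟨N, hN, hN'⟩ := ((hb.eventually (gt_mem_nhds hε)).and (Ici_mem_atTop a)).exists
    refine ⟨N, fun n hn => ?_⟩
    rw [Real.dist_eq]
    have := h N n hN' hn
    have := hb0 n (le_trans hN' hn)
    linarith
  obtain ⟨l, hl⟩ := CompleteSpace.complete hC
  replace hl : Tendsto f atTop (𝓝 l) := hl
  refine ⟨l, hl, fun x hx => ?_⟩
  have h1 : Tendsto (fun y => |f y - f x|) atTop (𝓝 |l - f x|) := (hl.sub_const _).abs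
  rw [abs_sub_comm]
  refine le_of_tendsto h1 ?_
  filter_upwards [Ici_mem_atTop x] with y hy
  have := h x y hx hy
  have := hb0 y (hx.trans hy)
  linarith

lemma abs_le_of_tendsto_zero {f b : ℝ → ℝ} {a : ℝ} (hf : Tendsto f atTop (𝓝 0))
    (hb : ∀ x, a ≤ x → 0 ≤ b x) (h : ∀ y, a ≤ y → |f y - f a| ≤ b a - b y) : |f a| ≤ b a := by
  have h1 : Tendsto (fun y => |f y - f a|) atTop (𝓝 |0 - f a|) := (hf.sub_const _).abs
  rw [zero_sub, abs_neg] at h1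
  refine le_of_tendsto h1 ?_
  filter_upwards [Ici_mem_atTop a] with y hy
  linarith [h y hy, hb y hy]

end

section

variable {S : Setting} {f g : ℝ × ℝ → ℝ} {p : ℝ × ℝ} {u₁ : ℝ}

/-! ### The region to the past of an outgoing cone -/

variable (S) in
/-- The part of the exterior with retarded time at most `u₁`. -/
def region (u₁ : ℝ) : Set (ℝ × ℝ) := {p | p ∈ S.exterior ∧ S.u p ≤ u₁}

variable (S) in
/-- One plus the retarded time elapsed until the cone `{u = u₁}`. -/
def delay (u₁ : ℝ) (p : ℝ × ℝ) : ℝ := 1 + (u₁ - S.u p)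

variable (S) in
/-- The radius of the sphere `{u = u₁, v = v₀}`, the smallest one in the region. -/
def innerRadius (u₁ : ℝ) : ℝ := S.radius ((S.v₀ - u₁) / 2)

variable (S) in
/-- The radius at which the outgoing cone through `p` meets `{v = v₀}`. -/
def initialRadius (p : ℝ × ℝ) : ℝ := S.radius ((S.v₀ - S.u p) / 2)

lemma u_mk (v r : ℝ) : S.u (v, r) = v - 2 * S.rstar r := rfl

lemma two_M_lt_innerRadius : 2 * S.M < S.innerRadius u₁ := radius_gt S _

lemma innerRadius_pos : 0 < S.innerRadius u₁ :=
  lt_trans (by linarith [S.M_pos]) two_M_lt_innerRadius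

lemma innerRadius_le (hp : p ∈ S.region u₁) : S.innerRadius u₁ ≤ p.2 := by
  refine (radius_le_iff hp.1.2).2 ?_
  have h1 := (mem_exterior.1 hp.1).1
  have h2 := hp.2
  simp only [u] at h2
  linarith

lemma one_le_delay (hp : p ∈ S.region u₁) : 1 ≤ S.delay u₁ p := by
  have := hp.2
  simp only [delay]; linarith

lemma delay_pos (hp : p ∈ S.region u₁) : 0 < S.delay u₁ p := one_pos.trans_le (one_le_delay hp)

/-- Together with `outgoing_mem_region`: the region contains the ingoing cones back to past null
infinity and the outgoing cones back to `v = v₀`, so both transport equations can be integrated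
inside it. -/
lemma region_mono_r {v r r' : ℝ} (hp : (v, r) ∈ S.region u₁) (h : r ≤ r') :
    (v, r') ∈ S.region u₁ := by
  have h1 : 2 * S.M < r := hp.1.2
  have h2 := rstar_le_rstar h1 h
  have h3 := hp.2
  rw [u_mk] at h3
  exact ⟨⟨hp.1.1, h1.trans_le h⟩, by rw [u_mk]; linarith⟩

lemma hasDerivAt_delay {v r : ℝ} (hr : 2 * S.M < r) :
    HasDerivAt (fun x => S.delay u₁ (v, x)) (2 / S.D r) r := by
  have h := ((((hasDerivAt_rstar hr).const_mul 2).const_sub v).const_sub u₁).const_add 1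
  exact h.congr_deriv (by ring)

lemma tendsto_delay (S : Setting) (u₁ v : ℝ) :
    Tendsto (fun x => S.delay u₁ (v, x)) atTop atTop := by
  have h := tendsto_atTop_add_const_left atTop (1 + (u₁ - v))
    (tendsto_rstar_atTop (S := S).const_mul_atTop two_pos)
  refine h.congr fun x => ?_
  simp only [delay, u]; ring

/-- The delay is 1 + u₁ - v + 2r*, where v ≥ v₀ and r* grows linearly. Hence decay in r can always
be traded for decay in the delay. -/
lemma exists_delay_le (S : Setting) (u₁ : ℝ) :
    ∃ κ, 0 < κ ∧ ∀ p ∈ S.region u₁, S.delay u₁ p ≤ κ * p.2 := by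
  obtain ⟨C, hC, h⟩ := exists_rstar_le S
  have hM := S.M_pos
  refine ⟨|1 + (u₁ - S.v₀)| / (2 * S.M) + 2 * C, by positivity, fun p hp => ?_⟩
  have h1 := h p.2 hp.1.2
  have h2 := (mem_exterior.1 hp.1)
  have h3 : 1 + (u₁ - S.v₀) ≤ |1 + (u₁ - S.v₀)| / (2 * S.M) * p.2 := by
    calc _ ≤ |1 + (u₁ - S.v₀)| := le_abs_self _
      _ = |1 + (u₁ - S.v₀)| / (2 * S.M) * (2 * S.M) := by field_simp
      _ ≤ _ := by have := h2.2.le; gcongr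
  simp only [delay, u]
  nlinarith [h2.1]

lemma u_initial (p : ℝ × ℝ) : S.u (S.v₀, S.initialRadius p) = S.u p := by
  rw [u_mk, initialRadius, rstar_radius]; ring

lemma delay_initial (p : ℝ × ℝ) : S.delay u₁ (S.v₀, S.initialRadius p) = S.delay u₁ p := by
  rw [delay, u_initial, delay]

lemma initial_mem_region (hp : p ∈ S.region u₁) : (S.v₀, S.initialRadius p) ∈ S.region u₁ :=
  ⟨⟨self_mem_Ici, radius_gt S _⟩, by rw [u_initial]; exact hp.2⟩

lemma initialRadius_le (hp : p ∈ S.exterior) : S.initialRadius p ≤ p.2 := by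
  refine (radius_le_iff hp.2).2 ?_
  have h1 := (mem_exterior.1 hp).1
  simp only [u]
  linarith

lemma u_outgoing (w x : ℝ) : S.u (w + 2 * S.rstar x, x) = w := by rw [u_mk]; ring

lemma delay_outgoing (p : ℝ × ℝ) (x : ℝ) :
    S.delay u₁ (S.u p + 2 * S.rstar x, x) = S.delay u₁ p := by
  rw [delay, u_outgoing, delay]

lemma outgoing_self (p : ℝ × ℝ) : (S.u p + 2 * S.rstar p.2, p.2) = p := by
  ext <;> simp [u]

lemma outgoing_mem_region (hp : p ∈ S.region u₁) {x : ℝ} (hx : S.initialRadius p ≤ x) :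
    (S.u p + 2 * S.rstar x, x) ∈ S.region u₁ := by
  refine ⟨⟨?_, (radius_gt S _).trans_le hx⟩, by rw [u_outgoing]; exact hp.2⟩
  have := (radius_le_iff ((radius_gt S _).trans_le hx)).1 hx
  simp only [mem_Ici]
  linarith

lemma outgoing_fst_le {x : ℝ} (hx : S.initialRadius p ≤ x)
    (hx' : x ≤ p.2) : S.u p + 2 * S.rstar x ≤ p.1 := by
  have := rstar_le_rstar ((radius_gt S _).trans_le hx) hx'
  simp only [u]; linarith

lemma abs_sub_initial_le {B B' : ℝ → ℝ} (hf : S.IsSmooth f) (hp : p ∈ S.region u₁)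
    (hB : ∀ x ∈ Icc (S.initialRadius p) p.2, HasDerivAt B (B' x) x)
    (h : ∀ x ∈ Icc (S.initialRadius p) p.2, |S.drOut f (S.u p + 2 * S.rstar x, x)| ≤ B' x) :
    |f p - f (S.v₀, S.initialRadius p)| ≤ B p.2 - B (S.initialRadius p) := by
  have e : S.u p + 2 * S.rstar (S.initialRadius p) = S.v₀ := by
    rw [initialRadius, rstar_radius]; ring
  have := abs_sub_le_of_abs_drOut_le (w := S.u p) (r₁ := S.initialRadius p) hf (radius_gt S _) e.ge
    (initialRadius_le hp.1) hB h
  rw [outgoing_self, e] at this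
  exact this

lemma hasDerivAt_neg_div_sq (c : ℝ) {x : ℝ} (hx : x ≠ 0) :
    HasDerivAt (fun x => -(c / (2 * x ^ 2))) (c / x ^ 3) x := by
  have h := ((hasDerivAt_pow 2 x).inv (pow_ne_zero 2 hx)).const_mul (-(c / 2))
  have e : (fun x : ℝ => -(c / (2 * x ^ 2))) = fun x => -(c / 2) * (x ^ 2)⁻¹ := by
    funext y; rw [← div_div, div_eq_mul_inv _ (y ^ 2)]; ring
  rw [e]
  refine h.congr_deriv ?_
  push_cast
  field_simp

/-- Transport of `∂_u f` from the initial cone. -/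
lemma IsWave.abs_Lbar_sub_initial_le {E : ℝ} (hf : S.IsSmooth f) (hw : S.IsWave f)
    (hp : p ∈ S.region u₁)
    (h : ∀ x ∈ Icc (S.initialRadius p) p.2, |f (S.u p + 2 * S.rstar x, x)| ≤ E) :
    |S.Lbar f p - S.Lbar f (S.v₀, S.initialRadius p)|
      ≤ S.M * E / (2 * S.initialRadius p ^ 2) := by
  have hM := S.M_pos
  have hq : 0 < S.initialRadius p := lt_trans (by linarith) (radius_gt S _)
  have hE : 0 ≤ E := (abs_nonneg _).trans (h _ (left_mem_Icc.2 (initialRadius_le hp.1)))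
  have := abs_sub_initial_le (f := S.Lbar f) (B := fun x => -(S.M * E / (2 * x ^ 2)))
    (B' := fun x => S.M * E / x ^ 3) hf.Lbar hp
    (fun x hx => hasDerivAt_neg_div_sq _ (hq.trans_le hx.1).ne') (fun x hx => by
      have hx0 := hq.trans_le hx.1
      rw [hw.drOut_Lbar hf (outgoing_mem_region hp hx.1).1, abs_mul, abs_neg,
        abs_of_pos (by positivity), mul_div_right_comm]
      gcongr
      exact h x hx)
  refine this.trans ?_
  have : 0 ≤ S.M * E / (2 * p.2 ^ 2) := by positivity
  linarith

/-! ### Boundedness -/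

/-- The improvement is applied to the supremum itself. `B` only makes the supremum finite and is
absent from the conclusion, so cut-offs used to produce `B` can be removed afterwards. -/
lemma abs_le_two_mul_of_bootstrap {α : Type*} {s : Set α} {f : α → ℝ} {B C : ℝ}
    (hB : ∀ x ∈ s, |f x| ≤ B)
    (h : ∀ A, 0 ≤ A → (∀ x ∈ s, |f x| ≤ A) → ∀ x ∈ s, |f x| ≤ C + A / 2) :
    ∀ x ∈ s, |f x| ≤ 2 * C := by
  intro x hx
  have hbdd : BddAbove ((fun y => |f y|) '' s) := ⟨B, by rintro _ ⟨y, hy, rfl⟩; exact hB y hy⟩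
  set A := sSup ((fun y => |f y|) '' s) with hA
  have h1 : ∀ y ∈ s, |f y| ≤ A := fun y hy => le_csSup hbdd (mem_image_of_mem _ hy)
  have h2 : A ≤ C + A / 2 := csSup_le ⟨_, mem_image_of_mem _ hx⟩ (by
    rintro _ ⟨y, hy, rfl⟩
    exact h A ((abs_nonneg _).trans (h1 x hx)) h1 y hy)
  linarith [h1 x hx]

lemma exists_abs_le_on_box (hf : S.IsSmooth f) (V a b : ℝ) (ha : 2 * S.M < a) :
    ∃ B, 0 ≤ B ∧ ∀ v r, S.v₀ ≤ v → v ≤ V → a ≤ r → r ≤ b → |f (v, r)| ≤ B := by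
  have hK : IsCompact (Icc S.v₀ V ×ˢ Icc a b) := isCompact_Icc.prod isCompact_Icc
  obtain ⟨B, hB⟩ := hK.exists_bound_of_continuousOn ((ContDiffOn.continuousOn hf).mono
    (prod_mono Icc_subset_Ici_self fun x hx => ha.trans_le hx.1))
  exact ⟨max B 0, le_max_right _ _, fun v r h1 h2 h3 h4 =>
    (hB (v, r) ⟨⟨h1, h2⟩, ⟨h3, h4⟩⟩).trans (le_max_left _ _)⟩

lemma exists_abs_le_on_ray (hf : S.IsSmooth f) {v a : ℝ} (hv : S.v₀ ≤ v) (ha : 2 * S.M < a)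
    (h : Tendsto (fun r => f (v, r)) atTop (𝓝 0)) : ∃ B, 0 ≤ B ∧ ∀ r, a ≤ r → |f (v, r)| ≤ B := by
  have h1 : ∀ᶠ r in atTop, |f (v, r)| < 1 := by
    have := h.abs; rw [abs_zero] at this
    exact this.eventually (gt_mem_nhds one_pos)
  obtain ⟨b, hb⟩ := eventually_atTop.1 h1
  obtain ⟨B, hB0, hB⟩ := exists_abs_le_on_box hf v a b ha
  refine ⟨B + 1, by linarith, fun r hr => ?_⟩
  rcases le_total r b with h2 | h2
  · linarith [hB v r hv le_rfl hr h2]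
  · linarith [hb r h2]

/-- A Grönwall argument in v: `L f` is carried outwards from the cone u = u₁, where it is bounded by
compactness for v ≤ V, and then integrated in v from the initial cone. The result depends on V and
only serves as the a priori bound in `IsWave.exists_abs_le_div_delay`. -/
lemma IsWave.exists_abs_le_of_fst_le (hf : S.IsSmooth f) (hw : S.IsWave f)
    (h0 : Tendsto (fun r => f (S.v₀, r)) atTop (𝓝 0)) (u₁ V : ℝ) :
    ∃ B, ∀ p ∈ S.region u₁, p.1 ≤ V → |f p| ≤ B := by
  have hM := S.M_pos
  set a := S.innerRadius u₁ with ha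
  have ha2 : 2 * S.M < a := two_M_lt_innerRadius
  have ha0 : 0 < a := innerRadius_pos
  obtain ⟨C₀, hC₀0, hC₀⟩ := exists_abs_le_on_ray hf le_rfl ha2 h0
  obtain ⟨B₀, hB₀0, hB₀⟩ := exists_abs_le_on_box hf.L V a (S.radius ((V - u₁) / 2)) ha2
  -- For this `l` the integral of (A M / (2a²)) exp(l (v - v₀)) in v is exactly A/2 times (exp(l (v
  -- - v₀)) - 1), the factor 1/2 that the bootstrap needs.
  set l := S.M / a ^ 2 with hl
  have hl0 : 0 < l := by positivity
  -- The cut-off r ≤ ρ provides the a priori bound by compactness; the bound obtained is independent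
  -- of ρ.
  have main : ∀ ρ, ∀ p ∈ {p | p ∈ S.region u₁ ∧ p.1 ≤ V ∧ p.2 ≤ ρ},
      |f p * Real.exp (-(l * (p.1 - S.v₀)))| ≤ 2 * (C₀ + B₀ * (V - S.v₀)) := by
    intro ρ
    obtain ⟨B, hB0, hB⟩ := exists_abs_le_on_box hf V a ρ ha2
    refine abs_le_two_mul_of_bootstrap (B := B) ?_ ?_
    · rintro p ⟨hp, hpV, hpρ⟩
      have h1 := (mem_exterior.1 hp.1).1
      rw [abs_mul, Real.abs_exp]
      calc _ ≤ B * 1 := by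
            gcongr
            · exact hB p.1 p.2 h1 hpV (innerRadius_le hp) hpρ
            · rw [Real.exp_le_one_iff]
              have : 0 ≤ p.1 - S.v₀ := by linarith
              have := mul_nonneg hl0.le this
              linarith
        _ = B := mul_one B
    · intro A hA hAb
      have hA' : ∀ q ∈ S.region u₁, q.1 ≤ V → q.2 ≤ ρ →
          |f q| ≤ A * Real.exp (l * (q.1 - S.v₀)) := by
        intro q hq h1 h2
        have := hAb q ⟨hq, h1, h2⟩
        rw [abs_mul, Real.abs_exp, Real.exp_neg, ← div_eq_mul_inv,
          div_le_iff₀ (Real.exp_pos _)] at this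
        exact this
      have hL : ∀ q ∈ S.region u₁, q.1 ≤ V → q.2 ≤ ρ →
          |S.L f q| ≤ B₀ + A * S.M / (2 * a ^ 2) * Real.exp (l * (q.1 - S.v₀)) := by
        rintro ⟨v, r⟩ hq h1 h2
        simp only at h1 h2 ⊢
        set r₁ := S.radius ((v - u₁) / 2) with hr₁
        have hv : S.v₀ ≤ v := hq.1.1
        have hu := hq.2
        rw [u_mk] at hu
        have hr₁2 : 2 * S.M < r₁ := radius_gt S _
        have har₁ : a ≤ r₁ := radius_mono (by linarith)
        have hr₁r : r₁ ≤ r := (radius_le_iff hq.1.2).2 (by linarith)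
        have hmem : (v, r₁) ∈ S.region u₁ :=
          ⟨⟨hv, hr₁2⟩, by rw [u_mk, hr₁, rstar_radius]; linarith⟩
        set E := A * Real.exp (l * (v - S.v₀)) with hE
        have hE0 : 0 ≤ E := by positivity
        have hsub := abs_sub_le_of_abs_drIn_le (f := S.L f) (B := fun x => -(S.M * E / (2 * x ^ 2)))
          (B' := fun x => S.M * E / x ^ 3) hf.L hv hr₁2 hr₁r
          (fun x hx => hasDerivAt_neg_div_sq _ (by linarith [hx.1])) (fun x hx => by
            have hx0 : 0 < x := by linarith [hx.1]
            have hxm := region_mono_r hmem hx.1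
            rw [hw.drIn_L hf hxm.1, abs_mul, abs_of_pos (by positivity), mul_div_right_comm]
            gcongr
            exact hA' _ hxm h1 (hx.2.trans h2))
        have h3 := hB₀ v r₁ hv h1 har₁ (radius_mono (by linarith))
        have h4 : S.M * E / (2 * r₁ ^ 2) ≤ S.M * E / (2 * a ^ 2) := by gcongr
        have h5 : 0 ≤ S.M * E / (2 * r ^ 2) := by positivity
        have h6 : S.M * E / (2 * a ^ 2) = A * S.M / (2 * a ^ 2) * Real.exp (l * (v - S.v₀)) := by
          rw [hE]; ring
        have h7 := abs_sub_abs_le_abs_sub (S.L f (v, r)) (S.L f (v, r₁))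
        linarith
      rintro p ⟨hp, hpV, hpρ⟩
      have hq2 : 2 * S.M < S.initialRadius p := radius_gt S _
      have hsub := abs_sub_initial_le (f := f)
        (B := fun x => B₀ * (2 * S.rstar x)
          + A / 2 * Real.exp (l * (S.u p + 2 * S.rstar x - S.v₀)))
        (B' := fun x => 2 / S.D x * (B₀ + A * S.M / (2 * a ^ 2) *
          Real.exp (l * (S.u p + 2 * S.rstar x - S.v₀)))) hf hp
        (fun x hx => by
          have hd := (hasDerivAt_rstar (hq2.trans_le hx.1)).const_mul 2
          have h1 := hd.const_mul B₀
          have h2 := ((((hd.const_add (S.u p)).sub_const S.v₀).const_mul l).exp).const_mul (A / 2)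
          refine (h1.add h2).congr_deriv ?_
          rw [hl]; field_simp)
        (fun x hx => by
          have hm := outgoing_mem_region hp hx.1
          have hD := D_pos hm.1.2
          rw [drOut_eq_L hm.1, abs_mul, abs_of_pos (by positivity)]
          gcongr
          exact hL _ hm ((outgoing_fst_le hx.1 hx.2).trans hpV) (hx.2.trans hpρ))
      have e1 : S.u p + 2 * S.rstar (S.initialRadius p) = S.v₀ := by
        rw [initialRadius, rstar_radius]; ring
      have e2 : S.u p + 2 * S.rstar p.2 = p.1 := by simp only [u]; ring
      simp only [e1, e2, sub_self, mul_zero, Real.exp_zero, mul_one] at hsub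
      have hvp := (mem_exterior.1 hp.1).1
      have e3 : B₀ * (2 * S.rstar p.2) - B₀ * (2 * S.rstar (S.initialRadius p))
          = B₀ * (p.1 - S.v₀) := by rw [← e2, ← e1]; ring
      have h1 := hC₀ _ (innerRadius_le (initial_mem_region hp))
      have h2 := abs_sub_abs_le_abs_sub (f p) (f (S.v₀, S.initialRadius p))
      have h3 : B₀ * (p.1 - S.v₀) ≤ B₀ * (V - S.v₀) := by gcongr
      have hexp : 1 ≤ Real.exp (l * (p.1 - S.v₀)) :=
        Real.one_le_exp (mul_nonneg hl0.le (by linarith))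
      rw [abs_mul, Real.abs_exp, Real.exp_neg, ← div_eq_mul_inv, div_le_iff₀ (Real.exp_pos _)]
      have h4 : 0 ≤ B₀ * (V - S.v₀) := mul_nonneg hB₀0 (by linarith)
      nlinarith
  refine ⟨2 * (C₀ + B₀ * (V - S.v₀)) * Real.exp (l * (V - S.v₀)), fun p hp hpV => ?_⟩
  have h1 := main p.2 p ⟨hp, hpV, le_rfl⟩
  rw [abs_mul, Real.abs_exp, Real.exp_neg, ← div_eq_mul_inv, div_le_iff₀ (Real.exp_pos _)] at h1
  refine h1.trans ?_
  have hvp := (mem_exterior.1 hp.1).1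
  have : 0 ≤ B₀ * (V - S.v₀) := mul_nonneg hB₀0 (by linarith)
  gcongr

end

section

variable {S : Setting} {f g : ℝ × ℝ → ℝ} {p : ℝ × ℝ} {u₁ : ℝ}

/-! ### Decay of the radiation field in the retarded time -/

/-- At fixed v the delay has r-derivative 2/D, the factor by which `drIn` differs from `-Lbar`.
Integration along an ingoing cone thus becomes integration in the delay alone. -/
lemma abs_sub_le_of_delay {b b' : ℝ → ℝ} {v r : ℝ} (hf : S.IsSmooth f)
    (hp : (v, r) ∈ S.region u₁) (hb : ∀ y, 1 ≤ y → HasDerivAt b (-b' y) y)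
    (h : ∀ x, r ≤ x → |S.drIn f (v, x)| ≤ 2 / S.D x * b' (S.delay u₁ (v, x)))
    {r' : ℝ} (hr : r ≤ r') :
    |f (v, r') - f (v, r)| ≤ b (S.delay u₁ (v, r)) - b (S.delay u₁ (v, r')) := by
  have := abs_sub_le_of_abs_drIn_le (f := f) (B := fun x => -b (S.delay u₁ (v, x)))
    (B' := fun x => 2 / S.D x * b' (S.delay u₁ (v, x))) hf hp.1.1 hp.1.2 hr
    (fun x hx => by
      have hm := region_mono_r hp hx.1
      have h1 := ((hb _ (one_le_delay hm)).comp x (hasDerivAt_delay (u₁ := u₁) (v := v) hm.1.2)).neg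
      exact h1.congr_deriv (by ring)) (fun x hx => h x hx.1)
  linarith

lemma abs_le_of_delay {b b' : ℝ → ℝ} {v r : ℝ} (hf : S.IsSmooth f)
    (h0 : Tendsto (fun r => f (v, r)) atTop (𝓝 0))
    (hp : (v, r) ∈ S.region u₁) (hb : ∀ y, 1 ≤ y → HasDerivAt b (-b' y) y)
    (hb0 : ∀ y, 1 ≤ y → 0 ≤ b y)
    (h : ∀ x, r ≤ x → |S.drIn f (v, x)| ≤ 2 / S.D x * b' (S.delay u₁ (v, x))) :
    |f (v, r)| ≤ b (S.delay u₁ (v, r)) :=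
  abs_le_of_tendsto_zero (f := fun x => f (v, x)) (b := fun x => b (S.delay u₁ (v, x))) h0
    (fun _ hx => hb0 _ (one_le_delay (region_mono_r hp hx)))
    (fun _ hy => abs_sub_le_of_delay hf hp hb h hy)

lemma hasDerivAt_mul_rpow_neg (C : ℝ) {η y : ℝ} (hη : η ≠ 0) (hy : 1 ≤ y) :
    HasDerivAt (fun y => C / η * y ^ (-η)) (-(C * y ^ (-1 - η))) y := by
  have := (Real.hasDerivAt_rpow_const (p := -η) (Or.inl (by linarith : y ≠ 0))).const_mul (C / η)
  refine this.congr_deriv ?_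
  rw [show -η - 1 = -1 - η by ring]
  field_simp

/-- The source integrates to at most ME/(2r²) with r the initial radius, which is bounded below by
delay/κ. Only values of `f` at earlier v on the same outgoing cone enter, so the estimate can be
bootstrapped on sets v ≤ const. -/
lemma IsWave.exists_abs_Lbar_sub_initial_le (hf : S.IsSmooth f) (hw : S.IsWave f) (u₁ : ℝ) :
    ∃ K, 0 < K ∧ ∀ p ∈ S.region u₁, ∀ E,
      (∀ q ∈ S.region u₁, S.delay u₁ q = S.delay u₁ p → q.1 ≤ p.1 → |f q| ≤ E) →
      |S.Lbar f p - S.Lbar f (S.v₀, S.initialRadius p)| ≤ K * E / S.delay u₁ p ^ 2 := by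
  obtain ⟨κ, hκ, hd⟩ := exists_delay_le S u₁
  have hM := S.M_pos
  refine ⟨S.M * κ ^ 2 / 2, by positivity, fun p hp E hE => ?_⟩
  have h1 := hw.abs_Lbar_sub_initial_le hf hp (E := E) fun x hx =>
    hE _ (outgoing_mem_region hp hx.1) (delay_outgoing p x) (outgoing_fst_le hx.1 hx.2)
  have hE0 : 0 ≤ E := (abs_nonneg _).trans (hE p hp rfl le_rfl)
  have h2 := hd _ (initial_mem_region hp)
  rw [delay_initial] at h2
  simp only at h2
  have hd0 := delay_pos hp
  have hq : 0 < S.initialRadius p := lt_trans (by linarith) (radius_gt S _)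
  have h3 : S.delay u₁ p ^ 2 ≤ κ ^ 2 * S.initialRadius p ^ 2 := by
    rw [← mul_pow]; gcongr
  refine h1.trans ?_
  rw [div_le_div_iff₀ (by positivity) (by positivity)]
  have h4 : 0 ≤ S.M * E := by positivity
  nlinarith [mul_le_mul_of_nonneg_left h3 h4]

lemma IsWave.exists_abs_le_div_delay (hf : S.IsSmooth f) (hw : S.IsWave f)
    (h0 : ∀ v, S.v₀ ≤ v → Tendsto (fun r => f (v, r)) atTop (𝓝 0)) {C : ℝ} (hC : 0 ≤ C)
    (hdata : ∀ r, S.innerRadius u₁ ≤ r → |S.Lbar f (S.v₀, r)| ≤ C / S.delay u₁ (S.v₀, r) ^ 2) :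
    ∃ B, 0 ≤ B ∧ ∀ p ∈ S.region u₁, |f p| ≤ B / S.delay u₁ p := by
  obtain ⟨K, hK, hLbar⟩ := hw.exists_abs_Lbar_sub_initial_le hf u₁
  have hLb : ∀ p ∈ S.region u₁, ∀ E,
      (∀ q ∈ S.region u₁, S.delay u₁ q = S.delay u₁ p → q.1 ≤ p.1 → |f q| ≤ E) →
      |S.drIn f p| ≤ 2 / S.D p.2 * ((C + K * E) / S.delay u₁ p ^ 2) := by
    intro p hp E hE
    have h1 := hLbar p hp E hE
    have h2 := hdata _ (innerRadius_le (initial_mem_region hp))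
    rw [delay_initial] at h2
    have hD := D_pos hp.1.2
    rw [drIn_eq_Lbar hp.1, abs_mul, abs_neg, abs_of_pos (by positivity), add_div]
    gcongr
    have := abs_sub_abs_le_abs_sub (S.Lbar f p) (S.Lbar f (S.v₀, S.initialRadius p))
    linarith
  -- The integral of K A exp(μ/s)/s² over s > y is (K A/μ)(exp(μ/y) - 1). With μ = 2K its prefactor
  -- is A/2, so the bootstrap closes without any smallness of the mass.
  set μ := 2 * K with hμ
  have hμ0 : 0 < μ := by positivity
  have hbdd : ∀ p ∈ S.region u₁, |f p| ≤ 2 * C * Real.exp μ := by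
    intro p₀ hp₀
    have main : ∀ p ∈ {p | p ∈ S.region u₁ ∧ p.1 ≤ p₀.1},
        |f p * Real.exp (-(μ / S.delay u₁ p))| ≤ 2 * C := by
      obtain ⟨B, hB⟩ := hw.exists_abs_le_of_fst_le hf (h0 _ le_rfl) u₁ p₀.1
      refine abs_le_two_mul_of_bootstrap (B := B) ?_ ?_
      · rintro p ⟨hp, hpV⟩
        have hB0 := (abs_nonneg _).trans (hB p hp hpV)
        rw [abs_mul, Real.abs_exp]
        calc _ ≤ B * 1 := by
              gcongr
              · exact hB p hp hpV
              · rw [Real.exp_le_one_iff]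
                have := delay_pos hp
                have : 0 ≤ μ / S.delay u₁ p := by positivity
                linarith
          _ = B := mul_one B
      · intro A hA hAb
        have hA' : ∀ q ∈ S.region u₁, q.1 ≤ p₀.1 → |f q| ≤ A * Real.exp (μ / S.delay u₁ q) := by
          intro q hq h1
          have := hAb q ⟨hq, h1⟩
          rw [abs_mul, Real.abs_exp, Real.exp_neg, ← div_eq_mul_inv,
            div_le_iff₀ (Real.exp_pos _)] at this
          exact this
        rintro ⟨v, r⟩ ⟨hp, hpV⟩
        have h1 := abs_le_of_delay (f := f) (u₁ := u₁)
          (b := fun y => C / y + A / 2 * (Real.exp (μ / y) - 1))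
          (b' := fun y => (C + K * (A * Real.exp (μ / y))) / y ^ 2) hf (h0 v hp.1.1) hp
          (fun y hy => by
            have hy0 : y ≠ 0 := by linarith
            have h1 := (hasDerivAt_inv hy0).const_mul C
            have h2 := ((((hasDerivAt_inv hy0).const_mul μ).exp).sub_const 1).const_mul (A / 2)
            have := h1.add h2
            simp only [← div_eq_mul_inv] at this
            refine this.congr_deriv ?_
            rw [hμ]; field_simp; ring)
          (fun y hy => by
            have hy0 : 0 < y := by linarith
            have : 1 ≤ Real.exp (μ / y) := Real.one_le_exp (by positivity)
            have : 0 ≤ Real.exp (μ / y) - 1 := by linarith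
            positivity)
          (fun x hx => by
            have hm := region_mono_r hp hx
            refine hLb _ hm _ fun q hq h1 h2 => ?_
            rw [← h1]
            exact hA' q hq (h2.trans hpV))
        have hd := one_le_delay hp
        have hd0 := delay_pos hp
        rw [abs_mul, Real.abs_exp, Real.exp_neg, ← div_eq_mul_inv, div_le_iff₀ (Real.exp_pos _)]
        have h2 : C / S.delay u₁ (v, r) ≤ C := div_le_self hC hd
        have h3 : 1 ≤ Real.exp (μ / S.delay u₁ (v, r)) := Real.one_le_exp (by positivity)
        nlinarith
    have h1 := main p₀ ⟨hp₀, le_rfl⟩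
    rw [abs_mul, Real.abs_exp, Real.exp_neg, ← div_eq_mul_inv, div_le_iff₀ (Real.exp_pos _)] at h1
    refine h1.trans ?_
    gcongr
    exact div_le_self hμ0.le (one_le_delay hp₀)
  -- Boundedness goes back into the same estimate: the integrand is now O(delay⁻²) and integrates to
  -- delay⁻¹.
  refine ⟨C + K * (2 * C * Real.exp μ), by positivity, ?_⟩
  rintro ⟨v, r⟩ hp
  refine abs_le_of_delay (f := f) (u₁ := u₁) (b := fun y => (C + K * (2 * C * Real.exp μ)) / y)
    (b' := fun y => (C + K * (2 * C * Real.exp μ)) / y ^ 2) hf (h0 v hp.1.1) hp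
    (fun y hy => ?_) (fun y hy => ?_) (fun x hx => ?_)
  · have h1 := (hasDerivAt_inv (by linarith : y ≠ 0)).const_mul (C + K * (2 * C * Real.exp μ))
    simp only [← div_eq_mul_inv] at h1
    exact h1.congr_deriv (by ring)
  · have hy0 : 0 < y := by linarith
    positivity
  · exact hLb _ (region_mono_r hp hx) _ fun q hq _ _ => hbdd q hq

/-- The leading behaviour of the radiation field in the retarded time, uniformly towards future
null infinity. -/
lemma IsWave.exists_abs_sub_le_delay_rpow (hf : S.IsSmooth f) (hw : S.IsWave f)
    (h0 : ∀ v, S.v₀ ≤ v → Tendsto (fun r => f (v, r)) atTop (𝓝 0)) {C I δ : ℝ} (hC : 0 ≤ C)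
    (hδ : 0 < δ) (hδ1 : δ ≤ 1)
    (hdata : ∀ r, S.innerRadius u₁ ≤ r →
      |S.Lbar f (S.v₀, r) - 2 * I / S.delay u₁ (S.v₀, r) ^ 2|
        ≤ C * S.delay u₁ (S.v₀, r) ^ (-2 - δ)) :
    ∃ B, 0 ≤ B ∧ ∀ p ∈ S.region u₁,
      |f p| ≤ B / S.delay u₁ p ∧
      |S.Lbar f p - 2 * I / S.delay u₁ p ^ 2| ≤ B * S.delay u₁ p ^ (-2 - δ) ∧
      |f p - 2 * I / S.delay u₁ p| ≤ B * S.delay u₁ p ^ (-1 - δ) := by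
  have hrpow : ∀ y : ℝ, 1 ≤ y → y ^ (-2 - δ) ≤ 1 / y ^ 2 := by
    intro y hy
    rw [one_div, ← Real.rpow_natCast, ← Real.rpow_neg (by linarith)]
    exact Real.rpow_le_rpow_of_exponent_le hy (by push_cast; linarith)
  have hdata' : ∀ r, S.innerRadius u₁ ≤ r →
      |S.Lbar f (S.v₀, r)| ≤ (C + 2 * |I|) / S.delay u₁ (S.v₀, r) ^ 2 := by
    intro r hr
    have hm : (S.v₀, r) ∈ S.region u₁ := by
      have h1 : 2 * S.M < r := two_M_lt_innerRadius.trans_le hr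
      refine ⟨⟨self_mem_Ici, h1⟩, ?_⟩
      have := (radius_le_iff h1).1 hr
      rw [u_mk]; linarith
    have hd := one_le_delay hm
    have h1 := hdata r hr
    have h2 := abs_sub_abs_le_abs_sub (S.Lbar f (S.v₀, r)) (2 * I / S.delay u₁ (S.v₀, r) ^ 2)
    have h3 : |2 * I / S.delay u₁ (S.v₀, r) ^ 2| = 2 * |I| / S.delay u₁ (S.v₀, r) ^ 2 := by
      rw [abs_div, abs_mul, abs_two, abs_of_pos (by positivity : 0 < S.delay u₁ (S.v₀, r) ^ 2)]
    have h4 := mul_le_mul_of_nonneg_left (hrpow _ hd) hC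
    rw [mul_one_div] at h4
    rw [add_div]; linarith
  obtain ⟨B, hB0, hB⟩ := hw.exists_abs_le_div_delay hf h0 (by positivity) hdata'
  obtain ⟨K, hK, hLbar⟩ := hw.exists_abs_Lbar_sub_initial_le hf u₁
  have hLb : ∀ p ∈ S.region u₁,
      |S.Lbar f p - 2 * I / S.delay u₁ p ^ 2| ≤ (C + K * B) * S.delay u₁ p ^ (-2 - δ) := by
    intro p hp
    have hd := one_le_delay hp
    have hd0 := delay_pos hp
    have h1 := hLbar p hp (B / S.delay u₁ p) fun q hq h _ => by rw [← h]; exact hB q hq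
    have h2 := hdata _ (innerRadius_le (initial_mem_region hp))
    rw [delay_initial] at h2
    -- The transport error is O(delay⁻³), one power better than the main term, and is absorbed
    -- because δ ≤ 1.
    have h3 : K * (B / S.delay u₁ p) / S.delay u₁ p ^ 2
        ≤ K * B * S.delay u₁ p ^ (-2 - δ) := by
      have : K * (B / S.delay u₁ p) / S.delay u₁ p ^ 2 = K * B * S.delay u₁ p ^ (-3 : ℝ) := by
        rw [Real.rpow_neg hd0.le, show (3 : ℝ) = (3 : ℕ) by norm_num, Real.rpow_natCast]
        field_simp
      rw [this]
      gcongr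
      linarith
    have h4 := abs_sub_le (S.Lbar f p) (S.Lbar f (S.v₀, S.initialRadius p))
      (2 * I / S.delay u₁ p ^ 2)
    linarith
  have hpsi : ∀ p ∈ S.region u₁,
      |f p - 2 * I / S.delay u₁ p| ≤ (C + K * B) / (1 + δ) * S.delay u₁ p ^ (-(1 + δ)) := by
    rintro ⟨v, r⟩ hp
    have hsub : ∀ r', r ≤ r' →
        |(f (v, r') - 2 * I / S.delay u₁ (v, r')) - (f (v, r) - 2 * I / S.delay u₁ (v, r))|
          ≤ (C + K * B) / (1 + δ) * S.delay u₁ (v, r) ^ (-(1 + δ))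
            - (C + K * B) / (1 + δ) * S.delay u₁ (v, r') ^ (-(1 + δ)) := by
      intro r' hr'
      have hm : ∀ x, r ≤ x → (v, x) ∈ S.region u₁ := fun x hx => region_mono_r hp hx
      have hfd : ∀ x ∈ Icc r r',
          HasDerivWithinAt (fun x => f (v, x)) (S.drIn f (v, x)) (Ici x) x := by
        intro x hx
        have hd := (hf.differentiableWithinAt_dom (hm x hx.1).1).hasFDerivWithinAt
        exact hd.comp_hasDerivWithinAt (f := fun y => (v, y)) x
          ((hasDerivWithinAt_const _ _ _).prodMk (hasDerivWithinAt_id _ _))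
          fun y hy => exterior_subset_dom (hm y (hx.1.trans hy)).1
      -- The comparison function 2I/delay is related to 2I/delay² exactly as `f` is to `Lbar f`, so
      -- the error of `Lbar f` can be integrated directly.
      have hid : ∀ x ∈ Icc r r', HasDerivAt (fun x => 2 * I / S.delay u₁ (v, x))
          (-(2 / S.D x * (2 * I / S.delay u₁ (v, x) ^ 2))) x := by
        intro x hx
        have h1 := hasDerivAt_delay (u₁ := u₁) (v := v) (hm x hx.1).1.2
        have h2 := (h1.inv (delay_pos (hm x hx.1)).ne').const_mul (2 * I)
        exact h2.congr_deriv (by ring)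
      have := abs_sub_le_of_abs_deriv_right_le
        (f := fun x => f (v, x) - 2 * I / S.delay u₁ (v, x))
        (f' := fun x => S.drIn f (v, x) - -(2 / S.D x * (2 * I / S.delay u₁ (v, x) ^ 2)))
        (B := fun x => -((C + K * B) / (1 + δ) * S.delay u₁ (v, x) ^ (-(1 + δ))))
        (B' := fun x => 2 / S.D x * ((C + K * B) * S.delay u₁ (v, x) ^ (-1 - (1 + δ)))) hr'
        (ContinuousOn.sub ((ContDiffOn.continuousOn hf).comp (by fun_prop)
          fun x hx => (hm x hx.1).1) fun x hx => (hid x hx).continuousAt.continuousWithinAt)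
        (fun x hx => (hfd x (Ico_subset_Icc_self hx)).sub
          (hid x (Ico_subset_Icc_self hx)).hasDerivWithinAt)
        (fun x hx => by
          have h1 := ((hasDerivAt_mul_rpow_neg (C + K * B) (by positivity : 1 + δ ≠ 0)
            (one_le_delay (hm x hx.1))).comp x
              (hasDerivAt_delay (u₁ := u₁) (v := v) (hm x hx.1).1.2)).neg
          exact h1.congr_deriv (by ring))
        (fun x hx => by
          have hD := D_pos (hm x hx.1).1.2
          rw [drIn_eq_Lbar (hm x hx.1).1]
          have : -(2 / S.D x) * S.Lbar f (v, x) - -(2 / S.D x * (2 * I / S.delay u₁ (v, x) ^ 2))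
              = -(2 / S.D x) * (S.Lbar f (v, x) - 2 * I / S.delay u₁ (v, x) ^ 2) := by ring
          simp only [this]
          rw [abs_mul, abs_neg, abs_of_pos (by positivity),
            show -1 - (1 + δ) = -2 - δ by ring]
          gcongr
          exact hLb _ (hm x hx.1))
      linarith
    have hlim : Tendsto (fun x => f (v, x) - 2 * I / S.delay u₁ (v, x)) atTop (𝓝 0) := by
      have := (h0 v hp.1.1).sub ((tendsto_delay S u₁ v).const_div_atTop (2 * I))
      rwa [sub_zero] at this
    exact abs_le_of_tendsto_zero
      (f := fun x => f (v, x) - 2 * I / S.delay u₁ (v, x))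
      (b := fun x => (C + K * B) / (1 + δ) * S.delay u₁ (v, x) ^ (-(1 + δ))) hlim
      (fun x hx => by have := delay_pos (region_mono_r hp hx); positivity) hsub
  have hCK : 0 ≤ C + K * B := by positivity
  refine ⟨B + (C + K * B), by positivity, fun p hp => ?_⟩
  have hd0 := delay_pos hp
  refine ⟨(hB p hp).trans ?_, (hLb p hp).trans ?_, (hpsi p hp).trans ?_⟩
  · gcongr; linarith
  · exact mul_le_mul_of_nonneg_right (by linarith) (by positivity)
  · rw [neg_add']
    gcongr
    exact (div_le_self hCK (by linarith)).trans (by linarith)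

/-- Passage from 1 + u to the delay, which never vanishes. For very negative u the two have
comparable size and |1 + u| differs from the delay by the constant 2 + u₁, so replacing the inverse
squares costs O(delay⁻³). The remaining u, including u = -1 and u ≥ 0, form a compact piece of the
cone. -/
lemma BigOOnCone.exists_abs_Lbar_sub_le {I ε : ℝ} {k : ℕ} (hf : S.IsSmooth f)
    (h : S.BigOOnCone k (2 + ε) fun p => S.Lbar f p - 2 * I / (1 + S.u p) ^ 2)
    {δ : ℝ} (hδ0 : 0 < δ) (hδε : δ ≤ ε) (hδ1 : δ ≤ 1) (u₁ : ℝ) :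
    ∃ C, 0 ≤ C ∧ ∀ r, S.innerRadius u₁ ≤ r →
      |S.Lbar f (S.v₀, r) - 2 * I / S.delay u₁ (S.v₀, r) ^ 2|
        ≤ C * S.delay u₁ (S.v₀, r) ^ (-2 - δ) := by
  obtain ⟨C, hC⟩ := h
  -- For u ≤ -k the quantity y = -1 - u is at least 2 + 2|u₁|, hence y and the delay y + 2 + u₁
  -- agree up to a factor 2.
  set k := 3 + 2 * |u₁| with hk
  have ha2 : 2 * S.M < S.innerRadius u₁ := two_M_lt_innerRadius
  obtain ⟨B, hB0, hB⟩ := exists_abs_le_on_box hf.Lbar S.v₀ (S.innerRadius u₁)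
    (S.radius ((S.v₀ + k) / 2)) ha2
  have habs := abs_nonneg u₁
  have hle := le_abs_self u₁
  have hge := neg_abs_le u₁
  refine ⟨(|C| * 2 ^ (2 + δ) + 12 * |I| * (2 + |u₁|)) + (B + 2 * |I|) * (1 + |u₁| + k) ^ 3,
    by positivity, fun r hr => ?_⟩
  have hr2 : 2 * S.M < r := ha2.trans_le hr
  have hm : (S.v₀, r) ∈ S.region u₁ := by
    refine ⟨⟨self_mem_Ici, hr2⟩, ?_⟩
    have := (radius_le_iff hr2).1 hr
    rw [u_mk]; linarith
  set d := S.delay u₁ (S.v₀, r) with hd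
  have hd1 : 1 ≤ d := one_le_delay hm
  have hd0 : 0 < d := by linarith
  set w := S.u (S.v₀, r) with hw
  have hdw : d = 1 + (u₁ - w) := rfl
  have hp0 : 0 ≤ d ^ (-2 - δ) := by positivity
  have hd3 : d ^ (-3 : ℝ) ≤ d ^ (-2 - δ) :=
    Real.rpow_le_rpow_of_exponent_le hd1 (by linarith)
  have hd3' : d ^ (-3 : ℝ) = 1 / d ^ 3 := by
    rw [Real.rpow_neg hd0.le, show (3 : ℝ) = (3 : ℕ) by norm_num, Real.rpow_natCast, one_div]
  rcases le_or_gt w (-k) with hwk | hwk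
  · set y := -1 - w with hy
    have hy2 : 2 + 2 * |u₁| ≤ y := by linarith
    have hy0 : 0 < y := by linarith
    have hdy : d ≤ 2 * y := by linarith
    have hyd : y ≤ 2 * d := by linarith
    have h1 := hC 0 (Nat.zero_le _) r hr2 (by linarith) (by intro h; linarith)
    simp only [Function.iterate_zero, id_eq, Nat.cast_zero, sub_zero, ← hw] at h1
    have e1 : |1 + w| = y := by rw [abs_of_nonpos (by linarith)]; ring
    have e2 : (1 + w) ^ 2 = y ^ 2 := by rw [hy]; ring
    rw [e1, e2] at h1
    have h2 : C * y ^ (-(2 + ε)) ≤ |C| * 2 ^ (2 + δ) * d ^ (-2 - δ) := by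
      calc C * y ^ (-(2 + ε)) ≤ |C| * y ^ (-(2 + δ)) := by
            gcongr
            · exact le_abs_self C
            · linarith
        _ ≤ |C| * (d / 2) ^ (-(2 + δ)) := by
            refine mul_le_mul_of_nonneg_left ?_ (abs_nonneg C)
            exact Real.rpow_le_rpow_of_nonpos (by positivity) (by linarith) (by linarith)
        _ = _ := by
            rw [Real.div_rpow hd0.le two_pos.le, Real.rpow_neg two_pos.le, div_inv_eq_mul,
              neg_add', mul_assoc, mul_comm (d ^ _)]
    have h3 : |2 * I / y ^ 2 - 2 * I / d ^ 2| ≤ 12 * |I| * (2 + |u₁|) * d ^ (-2 - δ) := by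
      have e3 : 2 * I / y ^ 2 - 2 * I / d ^ 2 = 2 * I * ((2 + u₁) * (d + y)) / (y ^ 2 * d ^ 2) := by
        have : (2 + u₁) * (d + y) = d ^ 2 - y ^ 2 := by rw [hdw, hy]; ring
        rw [this]; field_simp
      rw [e3, abs_div, abs_mul, abs_mul, abs_mul, abs_two, abs_of_pos (by positivity : 0 < d + y),
        abs_of_pos (by positivity : 0 < y ^ 2 * d ^ 2)]
      calc 2 * |I| * (|2 + u₁| * (d + y)) / (y ^ 2 * d ^ 2)
          ≤ 2 * |I| * ((2 + |u₁|) * (2 * y + y)) / (y ^ 2 * d ^ 2) := by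
            gcongr
            exact (abs_add_le 2 u₁).trans (by rw [abs_two])
        _ = 6 * |I| * (2 + |u₁|) / (y * d ^ 2) := by field_simp; ring
        _ ≤ 6 * |I| * (2 + |u₁|) / (d / 2 * d ^ 2) := by gcongr; linarith
        _ = 12 * |I| * (2 + |u₁|) * d ^ (-3 : ℝ) := by rw [hd3']; field_simp; ring
        _ ≤ _ := by gcongr
    have h4 := abs_sub_le (S.Lbar f (S.v₀, r)) (2 * I / y ^ 2) (2 * I / d ^ 2)
    have h5 : 0 ≤ (B + 2 * |I|) * (1 + |u₁| + k) ^ 3 * d ^ (-2 - δ) := by positivity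
    rw [add_mul, add_mul]
    linarith
  · have hrb : r ≤ S.radius ((S.v₀ + k) / 2) := by
      refine (le_radius_iff hr2).2 ?_
      rw [hw, u_mk] at hwk
      linarith
    have h1 := hB S.v₀ r le_rfl le_rfl hr hrb
    have h2 : |2 * I / d ^ 2| ≤ 2 * |I| := by
      rw [abs_div, abs_mul, abs_two, abs_of_pos (by positivity : 0 < d ^ 2)]
      exact div_le_self (by positivity) (one_le_pow₀ hd1)
    have h3 : 1 ≤ (1 + |u₁| + k) ^ 3 * d ^ (-2 - δ) := by
      calc (1 : ℝ) = d ^ 3 * d ^ (-3 : ℝ) := by rw [hd3']; field_simp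
        _ ≤ (1 + |u₁| + k) ^ 3 * d ^ (-2 - δ) := by gcongr; linarith
    have h4 : B + 2 * |I| ≤ (B + 2 * |I|) * ((1 + |u₁| + k) ^ 3 * d ^ (-2 - δ)) :=
      le_mul_of_one_le_right (by positivity) h3
    have h5 : 0 ≤ (|C| * 2 ^ (2 + δ) + 12 * |I| * (2 + |u₁|)) * d ^ (-2 - δ) := by positivity
    have h6 := abs_sub (S.Lbar f (S.v₀, r)) (2 * I / d ^ 2)
    rw [add_mul]
    linarith

end

section

variable {S : Setting} {f g : ℝ × ℝ → ℝ} {p : ℝ × ℝ} {u₁ : ℝ}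

/-! ### Symbol classes for the derivative `L` -/

variable (S) in
/-- `L^j f = O(w r^{q - j})` on `Γ` for all `j ≤ k`. -/
def IsSymbol (Γ : Set (ℝ × ℝ)) (w : ℝ × ℝ → ℝ) (k : ℕ) (q : ℝ) (f : ℝ × ℝ → ℝ) : Prop :=
  ∀ j ≤ k, ∃ C, 0 ≤ C ∧ ∀ p ∈ Γ, |S.L^[j] f p| ≤ C * (w p * p.2 ^ (q - j))

lemma iterate_L_congr (h : EqOn f g S.exterior) (k : ℕ) :
    EqOn (S.L^[k] f) (S.L^[k] g) S.exterior := by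
  induction k with
  | zero => exact h
  | succ k ih =>
    rw [Function.iterate_succ_apply', Function.iterate_succ_apply']
    exact along_congr ih

lemma iterate_L_add (hf : S.IsSmooth f) (hg : S.IsSmooth g) (k : ℕ) (hp : p ∈ S.exterior) :
    S.L^[k] (fun q => f q + g q) p = S.L^[k] f p + S.L^[k] g p := by
  induction k generalizing p with
  | zero => rfl
  | succ k ih =>
    simp only [Function.iterate_succ_apply']
    have : S.L (S.L^[k] fun q => f q + g q) p = S.L _ p := along_congr (fun q hq => ih hq) hp
    rw [this]
    exact along_add (hf.iterate_L k) (hg.iterate_L k) hp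

lemma iterate_L_neg (k : ℕ) (hp : p ∈ S.exterior) :
    S.L^[k] (fun q => -f q) p = -S.L^[k] f p := by
  induction k generalizing p with
  | zero => rfl
  | succ k ih =>
    simp only [Function.iterate_succ_apply']
    have : S.L (S.L^[k] fun q => -f q) p = S.L _ p := along_congr (fun q hq => ih hq) hp
    rw [this]
    exact along_neg hp

section Symbol

variable {Γ : Set (ℝ × ℝ)} {w : ℝ × ℝ → ℝ} {k l : ℕ} {q q' : ℝ}

lemma IsSymbol.of_le (h : S.IsSymbol Γ w k q f) (hl : l ≤ k) : S.IsSymbol Γ w l q f :=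
  fun j hj => h j (hj.trans hl)

lemma isSymbol_succ_iff : S.IsSymbol Γ w (k + 1) q f ↔
    (∃ C, 0 ≤ C ∧ ∀ p ∈ Γ, |f p| ≤ C * (w p * p.2 ^ q)) ∧ S.IsSymbol Γ w k (q - 1) (S.L f) := by
  constructor
  · intro h
    refine ⟨by simpa using h 0 (Nat.zero_le _), fun j hj => ?_⟩
    obtain ⟨C, hC, h⟩ := h (j + 1) (by omega)
    refine ⟨C, hC, fun p hp => ?_⟩
    have := h p hp
    rw [Function.iterate_succ_apply] at this
    convert this using 4
    push_cast; ring
  · rintro ⟨h0, h1⟩ j hj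
    rcases j with - | j
    · simpa using h0
    · obtain ⟨C, hC, h⟩ := h1 j (by omega)
      refine ⟨C, hC, fun p hp => ?_⟩
      rw [Function.iterate_succ_apply]
      convert h p hp using 4
      push_cast; ring

lemma IsSymbol.congr (hΓ : Γ ⊆ S.exterior) (h : S.IsSymbol Γ w k q f) (hfg : EqOn f g S.exterior) :
    S.IsSymbol Γ w k q g := fun j hj => by
  obtain ⟨C, hC, h⟩ := h j hj
  exact ⟨C, hC, fun p hp => by rw [← iterate_L_congr hfg j (hΓ hp)]; exact h p hp⟩

lemma IsSymbol.add (hΓ : Γ ⊆ S.exterior) (hfs : S.IsSmooth f) (hgs : S.IsSmooth g)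
    (hf : S.IsSymbol Γ w k q f) (hg : S.IsSymbol Γ w k q g) :
    S.IsSymbol Γ w k q fun p => f p + g p := fun j hj => by
  obtain ⟨C, hC, hf⟩ := hf j hj
  obtain ⟨C', hC', hg⟩ := hg j hj
  refine ⟨C + C', by positivity, fun p hp => ?_⟩
  rw [iterate_L_add hfs hgs j (hΓ hp), add_mul]
  exact (abs_add_le _ _).trans (add_le_add (hf p hp) (hg p hp))

lemma IsSymbol.neg (hΓ : Γ ⊆ S.exterior) (hf : S.IsSymbol Γ w k q f) :
    S.IsSymbol Γ w k q fun p => -f p := fun j hj => by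
  obtain ⟨C, hC, hf⟩ := hf j hj
  exact ⟨C, hC, fun p hp => by rw [iterate_L_neg j (hΓ hp), abs_neg]; exact hf p hp⟩

lemma rpow_le_const_mul_rpow {a r q q' : ℝ} (ha : 0 < a) (har : a ≤ r) (hq : q ≤ q') :
    r ^ q ≤ a ^ (q - q') * r ^ q' := by
  have hr : 0 < r := ha.trans_le har
  calc r ^ q = r ^ (q - q') * r ^ q' := by rw [← Real.rpow_add hr]; ring_nf
    _ ≤ _ := by
      gcongr ?_ * _
      exact Real.rpow_le_rpow_of_nonpos ha har (by linarith)

lemma IsSymbol.mono_exponent (hΓ : Γ ⊆ S.exterior) (hw : ∀ p ∈ Γ, 0 ≤ w p) (hq : q ≤ q')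
    (hf : S.IsSymbol Γ w k q f) : S.IsSymbol Γ w k q' f := fun j hj => by
  have hM := S.M_pos
  obtain ⟨C, hC, hf⟩ := hf j hj
  refine ⟨C * (2 * S.M) ^ (q - j - (q' - j)), by positivity, fun p hp => (hf p hp).trans ?_⟩
  have h1 := rpow_le_const_mul_rpow (q := q - j) (q' := q' - j) (by positivity : 0 < 2 * S.M)
    (mem_exterior.1 (hΓ hp)).2.le (by linarith)
  calc C * (w p * p.2 ^ (q - j))
      ≤ C * (w p * ((2 * S.M) ^ (q - j - (q' - j)) * p.2 ^ (q' - j))) := by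
        have := hw p hp; gcongr
    _ = _ := by ring

/-- Leibniz rule by induction on `k`. Only one factor carries the weight, so that it is not squared.
-/
lemma IsSymbol.mul (hΓ : Γ ⊆ S.exterior) (hw : ∀ p ∈ Γ, 0 ≤ w p) (hfs : S.IsSmooth f)
    (hgs : S.IsSmooth g) (hf : S.IsSymbol Γ (fun _ => 1) k q f) (hg : S.IsSymbol Γ w k q' g) :
    S.IsSymbol Γ w k (q + q') fun p => f p * g p := by
  have hzero : ∀ {f g : ℝ × ℝ → ℝ} {q q' : ℝ},
      (∃ C, 0 ≤ C ∧ ∀ p ∈ Γ, |f p| ≤ C * (1 * p.2 ^ q)) →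
      (∃ C, 0 ≤ C ∧ ∀ p ∈ Γ, |g p| ≤ C * (w p * p.2 ^ q')) →
      ∃ C, 0 ≤ C ∧ ∀ p ∈ Γ, |f p * g p| ≤ C * (w p * p.2 ^ (q + q')) := by
    rintro f g q q' ⟨C, hC, hf⟩ ⟨C', hC', hg⟩
    refine ⟨C * C', by positivity, fun p hp => ?_⟩
    have hr := pos_of_mem (hΓ hp)
    have := hw p hp
    rw [abs_mul, Real.rpow_add hr]
    calc |f p| * |g p| ≤ (C * (1 * p.2 ^ q)) * (C' * (w p * p.2 ^ q')) := by
          gcongr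
          · exact hf p hp
          · exact hg p hp
      _ = _ := by ring
  induction k generalizing f g q q' with
  | zero =>
    intro j hj
    obtain rfl : j = 0 := by omega
    have := hzero (by simpa using hf 0 le_rfl) (by simpa using hg 0 le_rfl)
    simpa using this
  | succ k ih =>
    have hf' := isSymbol_succ_iff.1 hf
    have hg' := isSymbol_succ_iff.1 hg
    refine isSymbol_succ_iff.2 ⟨hzero hf'.1 hg'.1, ?_⟩
    have h1 := ih hfs.L hgs hf'.2 (hg.of_le (Nat.le_succ k))
    have h2 := ih hfs hgs.L (hf.of_le (Nat.le_succ k)) hg'.2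
    rw [show q - 1 + q' = q + q' - 1 by ring] at h1
    rw [show q + (q' - 1) = q + q' - 1 by ring] at h2
    exact (h1.add hΓ (hfs.L.mul hgs) (hfs.mul hgs.L) h2).congr hΓ
      fun p hp => (along_mul hfs hgs hp).symm

lemma hasDerivAt_const_div_pow (c : ℝ) (n : ℕ) {r : ℝ} (hr : r ≠ 0) :
    HasDerivAt (fun r => c / r ^ n) (-(n * c) / r ^ (n + 1)) r := by
  have h := ((hasDerivAt_pow n r).inv (pow_ne_zero n hr)).const_mul c
  simp only [Pi.inv_apply, ← div_eq_mul_inv] at h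
  refine h.congr_deriv ?_
  rcases n with - | n
  · simp
  · simp only [Nat.add_sub_cancel]
    field_simp
    ring

/-- `L` sends c/rⁿ to a combination of r^(-n-1) and r^(-n-2); the family is closed under `L`, so the
induction runs over all `c` and `n` at once. -/
lemma isSymbol_const_div_pow (hΓ : Γ ⊆ S.exterior) (c : ℝ) (n k : ℕ) :
    S.IsSymbol Γ (fun _ => 1) k (-n) fun p => c / p.2 ^ n := by
  have hzero : ∀ (c : ℝ) (n : ℕ), ∃ C, 0 ≤ C ∧ ∀ p ∈ Γ,
      |c / p.2 ^ n| ≤ C * (1 * p.2 ^ (-(n : ℝ))) := by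
    refine fun c n => ⟨|c|, abs_nonneg c, fun p hp => ?_⟩
    have hr := pos_of_mem (hΓ hp)
    rw [abs_div, abs_of_pos (by positivity : 0 < p.2 ^ n), Real.rpow_neg hr.le, Real.rpow_natCast,
      one_mul, div_eq_mul_inv]
  induction k generalizing c n with
  | zero =>
    intro j hj
    obtain rfl : j = 0 := by omega
    simpa using hzero c n
  | succ k ih =>
    refine isSymbol_succ_iff.2 ⟨hzero c n, ?_⟩
    have s : ∀ (c : ℝ) (n : ℕ), S.IsSmooth fun p => c / p.2 ^ n := fun c n =>
      isSmooth_radial (contDiffOn_const_div_pow c n)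
    have h1 := ih (-(n * c) / 2) (n + 1)
    have h2 := (ih (S.M * (n * c)) (n + 2)).mono_exponent (q' := -((n + 1 : ℕ) : ℝ)) hΓ
      (fun _ _ => zero_le_one) (by push_cast; linarith)
    rw [show -(n : ℝ) - 1 = -((n + 1 : ℕ) : ℝ) by push_cast; ring]
    refine (h1.add hΓ (s _ _) (s _ _) h2).congr hΓ fun p hp => ?_
    have hr := (pos_of_mem hp).ne'
    have e : S.L (fun p => c / p.2 ^ n) p = S.D p.2 / 2 * (-(n * c) / p.2 ^ (n + 1)) :=
      along_radial hp (hasDerivAt_const_div_pow c n hr)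
    rw [e, D]
    field_simp
    ring

lemma isSymbol_D_div_two (hΓ : Γ ⊆ S.exterior) (k : ℕ) :
    S.IsSymbol Γ (fun _ => 1) k 0 fun p => S.D p.2 / 2 := by
  have s : ∀ (c : ℝ) (n : ℕ), S.IsSmooth fun p => c / p.2 ^ n := fun c n =>
    isSmooth_radial (contDiffOn_const_div_pow c n)
  have h1 := isSymbol_const_div_pow (S := S) hΓ (1 / 2) 0 k
  have h2 := (isSymbol_const_div_pow (S := S) hΓ (-S.M) 1 k).mono_exponent (q' := -((0 : ℕ) : ℝ)) hΓ
    (fun _ _ => zero_le_one) (by norm_num)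
  have h3 := (h1.add hΓ (s _ _) (s _ _) h2).congr (g := fun p => S.D p.2 / 2) hΓ fun p hp => by
    have hr := (pos_of_mem hp).ne'
    simp only [D]; field_simp; ring
  simpa using h3

lemma isSymbol_potential (hΓ : Γ ⊆ S.exterior) (k : ℕ) :
    S.IsSymbol Γ (fun _ => 1) k (-3) fun p => S.D p.2 / 2 * (S.M / p.2 ^ 3) := by
  have := (isSymbol_D_div_two hΓ k).mul hΓ (fun _ _ => zero_le_one)
    (isSmooth_radial (contDiffOn_D.div_const 2)) (isSmooth_radial (contDiffOn_const_div_pow S.M 3))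
    (isSymbol_const_div_pow hΓ S.M 3 k)
  simpa using this

end Symbol

/-! ### Decay of `L`-derivatives -/

lemma region_subset_exterior : S.region u₁ ⊆ S.exterior := fun _ hp => hp.1

lemma drOut_sub_const_mul_fst (hf : S.IsSmooth f) (c : ℝ) (hp : p ∈ S.exterior) :
    S.drOut (fun q => f q + c * q.1) p = 2 / S.D p.2 * (S.L f p + c) := by
  have hs : S.IsSmooth fun q => c * q.1 := contDiffOn_const.mul contDiffOn_fst
  have e : ∀ X, S.along X (fun q => c * q.1) p = c * (X p).1 := by
    intro X
    have h : HasFDerivWithinAt (fun q : ℝ × ℝ => c * q.1) (c • ContinuousLinearMap.fst ℝ ℝ ℝ)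
        S.exterior p := (hasFDerivAt_fst.const_mul c).hasFDerivWithinAt
    rw [along_exterior hp, h.fderivWithin (uniqueDiffOn_exterior p hp)]
    simp
  rw [drOut, along_add hf hs hp, e, ← drOut, drOut_eq_L hp]
  ring

/-- If `f` vanishes at past null infinity, then so does `L f`. -/
lemma tendsto_L_zero (hf : S.IsSmooth f)
    (h0 : ∀ v, S.v₀ ≤ v → Tendsto (fun r => f (v, r)) atTop (𝓝 0)) {C : ℝ}
    (hC : ∀ p ∈ S.region u₁, |S.drIn (S.L f) p| ≤ C / p.2 ^ 2) :
    ∀ v, S.v₀ ≤ v → Tendsto (fun r => S.L f (v, r)) atTop (𝓝 0) := by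
  have hM := S.M_pos
  intro v hv
  have hsub : ∀ v r r', (v, r) ∈ S.region u₁ → r ≤ r' →
      |S.L f (v, r') - S.L f (v, r)| ≤ C / r := by
    intro v r r' hm hr
    have hr0 : 0 < r := pos_of_mem hm.1
    have h1 := abs_sub_le_of_abs_drIn_le (f := S.L f) (B := fun x => -(C / x))
      (B' := fun x => C / x ^ 2) hf.L hm.1.1 hm.1.2 hr
      (fun x hx => by
        have h1 := ((hasDerivAt_inv (hr0.trans_le hx.1).ne').const_mul C).neg
        simp only [← div_eq_mul_inv] at h1
        exact h1.congr_deriv (by ring))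
      (fun x hx => hC _ (region_mono_r hm hx.1))
    have h2 : 0 ≤ C / r' := by
      have h3 := (abs_nonneg _).trans (hC _ (region_mono_r hm hr))
      have hr'0 : 0 < r' := hr0.trans_le hr
      have : C / r' = C / r' ^ 2 * r' := by field_simp
      rw [this]; positivity
    linarith
  rw [Metric.tendsto_atTop']
  intro ε hε
  obtain ⟨r₁, hr₁, hCr₁⟩ : ∃ r₁, S.radius ((v + 1 - u₁) / 2) ≤ r₁ ∧ C / r₁ < ε / 4 := by
    have h1 : Tendsto (fun r : ℝ => C / r) atTop (𝓝 0) := tendsto_const_nhds.div_atTop tendsto_id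
    exact ((eventually_ge_atTop _).and (h1.eventually (gt_mem_nhds (by positivity)))).exists
  have hr₁2 : 2 * S.M < r₁ := (radius_gt S _).trans_le hr₁
  have hreg : ∀ v', S.v₀ ≤ v' → v' ≤ v + 1 → (v', r₁) ∈ S.region u₁ := fun v' h1 h2 => by
    refine ⟨⟨h1, hr₁2⟩, ?_⟩
    have := (radius_le_iff hr₁2).1 hr₁
    rw [u_mk]; linarith
  -- `c` is a nearly correct value of `L f` for all r ≥ r₁ and v' slightly above v. The plan is to
  -- show that `c` is small, because `f` itself has the same limit 0 at v and at v + δ.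
  set c := S.L f (v, r₁) with hc
  obtain ⟨δ, hδ0, hδ1, hδ⟩ : ∃ δ, 0 < δ ∧ δ ≤ 1 ∧ ∀ v', v ≤ v' → v' ≤ v + δ →
      |S.L f (v', r₁) - c| < ε / 4 := by
    have hcont : ContinuousWithinAt (fun v' => S.L f (v', r₁)) (Ici v) v :=
      ((ContDiffOn.continuousOn hf.L) (v, r₁) ⟨hv, hr₁2⟩).comp (f := fun v' => (v', r₁))
        (by fun_prop) fun v' hv' => ⟨hv.trans hv', hr₁2⟩
    obtain ⟨δ, hδ, h⟩ := Metric.continuousWithinAt_iff.1 hcont (ε / 4) (by positivity)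
    refine ⟨min (δ / 2) 1, by positivity, min_le_right _ _, fun v' h1 h2 => ?_⟩
    have := h (x := v') h1 (by
      rw [Real.dist_eq, abs_of_nonneg (by linarith)]
      linarith [min_le_left (δ / 2) 1])
    rwa [Real.dist_eq] at this
  have hnear : ∀ v' r', v ≤ v' → v' ≤ v + δ → r₁ ≤ r' → |S.L f (v', r') - c| ≤ ε / 2 := by
    intro v' r' h1 h2 h3
    have h4 := hsub v' r₁ r' (hreg v' (hv.trans h1) (by linarith)) h3
    have h5 := hδ v' h1 h2
    have h6 := abs_sub_le (S.L f (v', r')) (S.L f (v', r₁)) c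
    linarith
  -- Along the outgoing curve from (v, r), v grows by δ once r* has grown by δ/2. The function f - c
  -- v has `L`-derivative at most ε/2 on that piece.
  have hint : ∀ r, r₁ ≤ r →
      |f (v + δ, S.radius (S.rstar r + δ / 2)) - f (v, r) - c * δ| ≤ ε / 2 * δ := by
    intro r hr
    have hr2 : 2 * S.M < r := hr₁2.trans_le hr
    have hle : r ≤ S.radius (S.rstar r + δ / 2) := (le_radius_iff hr2).2 (by linarith)
    have hs : S.IsSmooth fun q => f q + -c * q.1 :=
      ContDiffOn.add hf (contDiffOn_const.mul contDiffOn_fst)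
    have h1 := abs_sub_le_of_abs_drOut_le (w := v - 2 * S.rstar r)
      (B := fun x => ε / 2 * (2 * S.rstar x)) (B' := fun x => 2 / S.D x * (ε / 2)) hs hr2
      (by linarith) hle
      (fun x hx => by
        have := ((hasDerivAt_rstar (hr2.trans_le hx.1)).const_mul 2).const_mul (ε / 2)
        exact this.congr_deriv (by rw [div_eq_mul_inv 2 (S.D x)]; ring))
      (fun x hx => by
        have hx2 := hr2.trans_le hx.1
        have h1 := rstar_le_rstar hr2 hx.1
        have h2 := (le_radius_iff hx2).1 hx.2
        have hm : (v - 2 * S.rstar r + 2 * S.rstar x, x) ∈ S.exterior :=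
          ⟨by simp only [mem_Ici]; linarith, hx2⟩
        have hD := D_pos hx2
        rw [drOut_sub_const_mul_fst hf _ hm, abs_mul, abs_of_pos (by positivity)]
        gcongr
        exact hnear _ _ (by linarith) (by linarith) (hr.trans hx.1))
    simp only [rstar_radius] at h1
    rw [show v - 2 * S.rstar r + 2 * (S.rstar r + δ / 2) = v + δ by ring,
      show v - 2 * S.rstar r + 2 * S.rstar r = v by ring] at h1
    convert h1 using 1
    · congr 1; ring
    · ring
  have hlim : |c * δ| ≤ ε / 2 * δ := by
    have h1 : Tendsto (fun r => S.radius (S.rstar r + δ / 2)) atTop atTop := by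
      refine tendsto_atTop_mono' atTop ?_ tendsto_id
      filter_upwards [Ioi_mem_atTop (2 * S.M)] with r hr
      exact (le_radius_iff hr).2 (by linarith)
    have h2 := (((h0 (v + δ) (by linarith)).comp h1).sub (h0 v hv)).sub_const (c * δ)
    have h3 := h2.abs
    simp only [sub_self, zero_sub, abs_neg] at h3
    refine le_of_tendsto h3 ?_
    filter_upwards [Ici_mem_atTop r₁] with r hr
    exact hint r hr
  have hc2 : |c| ≤ ε / 2 := by
    rw [abs_mul, abs_of_pos hδ0] at hlim
    exact le_of_mul_le_mul_right hlim hδ0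
  refine ⟨r₁, fun r hr => ?_⟩
  rw [Real.dist_eq, sub_zero]
  have h1 := hsub v r₁ r (hreg v hv (by linarith)) (le_of_lt hr)
  have h2 := abs_sub_abs_le_abs_sub (S.L f (v, r)) c
  rw [← hc] at h1
  linarith

/-- Integration of the bound `r^{-q} / (1 + u₁ - u)` along ingoing cones from past null
infinity. -/
lemma exists_abs_le_rpow_of_abs_drIn_le (hf : S.IsSmooth f)
    (h0 : ∀ v, S.v₀ ≤ v → Tendsto (fun r => f (v, r)) atTop (𝓝 0)) {C q η : ℝ} (hC : 0 ≤ C)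
    (hη : 0 < η) (hq : η ≤ q)
    (h : ∀ p ∈ S.region u₁, |S.drIn f p| ≤ 2 / S.D p.2 * (C * ((S.delay u₁ p)⁻¹ * p.2 ^ (-q)))) :
    ∃ B, 0 ≤ B ∧ ∀ p ∈ S.region u₁, |f p| ≤ B * p.2 ^ (-q + η) := by
  obtain ⟨κ, hκ, hd⟩ := exists_delay_le S u₁
  refine ⟨C * κ ^ η / η, by positivity, ?_⟩
  rintro ⟨v, r⟩ hp
  have hr0 : 0 < r := pos_of_mem hp.1
  have h1 := abs_le_of_delay (f := f) (u₁ := u₁)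
    (b := fun y => (C * r ^ (-q + η) * κ ^ η) / η * y ^ (-η))
    (b' := fun y => (C * r ^ (-q + η) * κ ^ η) * y ^ (-1 - η)) hf (h0 v hp.1.1) hp
    (fun y hy => hasDerivAt_mul_rpow_neg _ hη.ne' hy)
    (fun y hy => by have : 0 < y := by linarith
                    positivity)
    (fun x hx => by
      have hm := region_mono_r hp hx
      have hx0 : 0 < x := hr0.trans_le hx
      have hd0 := delay_pos hm
      have hD := D_pos hm.1.2
      refine (h _ hm).trans ?_
      simp only
      gcongr 2 / S.D x * ?_
      -- The factor r^(-η) is given up and turned into delay^(-η), which makes delay^(-1)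
      -- integrable.
      have e1 : x ^ (-q) = x ^ (-q + η) * x ^ (-η) := by rw [← Real.rpow_add hx0]; ring_nf
      have h2 : x ^ (-q + η) ≤ r ^ (-q + η) :=
        Real.rpow_le_rpow_of_nonpos hr0 hx (by linarith)
      have h3 : x ^ (-η) ≤ κ ^ η * S.delay u₁ (v, x) ^ (-η) := by
        have h4 : S.delay u₁ (v, x) / κ ≤ x := by
          rw [div_le_iff₀ hκ, mul_comm]; exact hd _ hm
        calc x ^ (-η) ≤ (S.delay u₁ (v, x) / κ) ^ (-η) :=
              Real.rpow_le_rpow_of_nonpos (by positivity) h4 (by linarith)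
          _ = _ := by
              rw [Real.div_rpow hd0.le hκ.le, Real.rpow_neg hκ.le, div_inv_eq_mul, mul_comm]
      calc C * ((S.delay u₁ (v, x))⁻¹ * x ^ (-q))
          ≤ C * ((S.delay u₁ (v, x))⁻¹ * (r ^ (-q + η) * (κ ^ η * S.delay u₁ (v, x) ^ (-η)))) := by
            rw [e1]; gcongr
        _ = _ := by
            rw [show -1 - η = -1 + -η by ring, Real.rpow_add hd0, Real.rpow_neg_one]
            ring)
  refine h1.trans ?_
  have h2 : S.delay u₁ (v, r) ^ (-η) ≤ 1 :=
    Real.rpow_le_one_of_one_le_of_nonpos (one_le_delay hp) (by linarith)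
  calc _ ≤ C * r ^ (-q + η) * κ ^ η / η * 1 := by gcongr
    _ = _ := by ring

lemma exists_two_div_D_le {a : ℝ} (ha : 2 * S.M < a) :
    ∃ c, 0 < c ∧ ∀ r, a ≤ r → 2 / S.D r ≤ c := by
  have hM := S.M_pos
  have hDa := D_pos ha
  refine ⟨2 / S.D a, by positivity, fun r hr => ?_⟩
  gcongr
  simp only [D]
  have : 0 < a := by linarith
  gcongr

/-- Since `Lbar` commutes with `L`, the source for L^(k+1) f is the k-th `L`-derivative of potential
times f, of size delay⁻¹ r^(-3-k). It is integrated from past null infinity, where L^(k+1) f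
vanishes; η pays for the logarithm in that integral. -/
lemma IsWave.exists_abs_iterate_L_le (hf : S.IsSmooth f) (hw : S.IsWave f)
    (h0 : ∀ v, S.v₀ ≤ v → Tendsto (fun r => f (v, r)) atTop (𝓝 0)) {B : ℝ} (hB0 : 0 ≤ B)
    (hB : ∀ p ∈ S.region u₁, |f p| ≤ B / S.delay u₁ p) (k : ℕ) {η : ℝ} (hη : 0 < η)
    (hη1 : η < 1) :
    ∃ C, 0 ≤ C ∧ ∀ p ∈ S.region u₁, |S.L^[k + 1] f p| ≤ C * p.2 ^ (-3 - k + η : ℝ) := by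
  have hM := S.M_pos
  have hΓ : S.region u₁ ⊆ S.exterior := region_subset_exterior
  have hwt : ∀ p ∈ S.region u₁, 0 ≤ (S.delay u₁ p)⁻¹ := fun p hp => by
    have := delay_pos hp; positivity
  obtain ⟨κ, hκ, hd⟩ := exists_delay_le S u₁
  obtain ⟨c, hc, hcD⟩ := exists_two_div_D_le (two_M_lt_innerRadius (S := S) (u₁ := u₁))
  have step : ∀ k, S.IsSymbol (S.region u₁) (fun p => (S.delay u₁ p)⁻¹) k 0 f →
      (∀ v, S.v₀ ≤ v → Tendsto (fun r => S.L^[k] f (v, r)) atTop (𝓝 0)) →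
      (∀ v, S.v₀ ≤ v → Tendsto (fun r => S.L^[k + 1] f (v, r)) atTop (𝓝 0)) ∧
      ∀ η, 0 < η → η < 1 →
        ∃ C, 0 ≤ C ∧ ∀ p ∈ S.region u₁, |S.L^[k + 1] f p| ≤ C * p.2 ^ (-3 - k + η : ℝ) := by
    intro k hsym hlim
    have hKs : S.IsSmooth fun p => S.D p.2 / 2 * (S.M / p.2 ^ 3) :=
      isSmooth_radial ((contDiffOn_D.div_const 2).mul (contDiffOn_const_div_pow S.M 3))
    have hKf := ((isSymbol_potential hΓ k).mul hΓ hwt hKs hf hsym).neg hΓ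
    obtain ⟨C, hC, hKf⟩ := hKf k le_rfl
    have hdr : ∀ p ∈ S.region u₁, |S.drIn (S.L^[k + 1] f) p|
        ≤ 2 / S.D p.2 * (C * ((S.delay u₁ p)⁻¹ * p.2 ^ (-(3 + k : ℝ)))) := by
      intro p hp
      have hD := D_pos hp.1.2
      have e : S.L^[k] (S.Lbar (S.L f)) p
          = S.L^[k] (fun p => -(S.D p.2 / 2 * (S.M / p.2 ^ 3) * f p)) p :=
        iterate_L_congr (fun q hq => by rw [hw.Lbar_L hf hq]; ring) k hp.1
      rw [drIn_eq_Lbar hp.1, abs_mul, abs_neg, abs_of_pos (by positivity),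
        Function.iterate_succ_apply, Lbar_iterate_L hf.L k hp.1, e]
      gcongr 2 / S.D p.2 * ?_
      have := hKf p hp
      rwa [show (-3 + 0 - k : ℝ) = -(3 + k) by ring] at this
    have hlim' : ∀ v, S.v₀ ≤ v → Tendsto (fun r => S.L^[k + 1] f (v, r)) atTop (𝓝 0) := by
      rw [Function.iterate_succ_apply'] at hdr ⊢
      refine tendsto_L_zero (hf.iterate_L k) hlim
        (C := c * (C * (2 * S.M) ^ (-(3 + k : ℝ) - -2))) fun p hp => (hdr p hp).trans ?_
      have hr0 := pos_of_mem hp.1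
      have h1 := rpow_le_const_mul_rpow (q := -(3 + k : ℝ)) (q' := -2)
        (by positivity : 0 < 2 * S.M) (mem_exterior.1 hp.1).2.le
        (by have : (0 : ℝ) ≤ k := Nat.cast_nonneg k
            linarith)
      have h2 : (S.delay u₁ p)⁻¹ ≤ 1 := inv_le_one_of_one_le₀ (one_le_delay hp)
      have h3 := hcD p.2 (innerRadius_le hp)
      have h4 : p.2 ^ (-2 : ℝ) = 1 / p.2 ^ 2 := by
        rw [Real.rpow_neg hr0.le, show (2 : ℝ) = (2 : ℕ) by norm_num, Real.rpow_natCast, one_div]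
      rw [h4] at h1
      have h5 := hwt p hp
      calc 2 / S.D p.2 * (C * ((S.delay u₁ p)⁻¹ * p.2 ^ (-(3 + k : ℝ))))
          ≤ c * (C * (1 * ((2 * S.M) ^ (-(3 + k : ℝ) - -2) * (1 / p.2 ^ 2)))) := by gcongr
        _ = _ := by ring
    refine ⟨hlim', fun η hη hη1 => ?_⟩
    obtain ⟨C', hC', h'⟩ := exists_abs_le_rpow_of_abs_drIn_le (hf.iterate_L (k + 1)) hlim' hC hη
      (by have : (0 : ℝ) ≤ k := Nat.cast_nonneg k
          linarith : η ≤ 3 + k) hdr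
    refine ⟨C', hC', fun p hp => ?_⟩
    rw [show (-3 - k + η : ℝ) = -(3 + k) + η by ring]
    exact h' p hp
  have main : ∀ k, S.IsSymbol (S.region u₁) (fun p => (S.delay u₁ p)⁻¹) k 0 f ∧
      (∀ v, S.v₀ ≤ v → Tendsto (fun r => S.L^[k] f (v, r)) atTop (𝓝 0)) := by
    intro k
    induction k with
    | zero =>
      refine ⟨fun j hj => ?_, h0⟩
      obtain rfl : j = 0 := by omega
      refine ⟨B, hB0, fun p hp => ?_⟩
      simpa [div_eq_mul_inv] using hB p hp
    | succ k ih =>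
      obtain ⟨h1, h2⟩ := step k ih.1 ih.2
      refine ⟨fun j hj => ?_, h1⟩
      rcases Nat.lt_or_ge j (k + 1) with hj' | hj'
      · exact ih.1 j (by omega)
      obtain rfl : j = k + 1 := by omega
      -- There is room to spare: r^(-3-k+1/2) is dominated by r⁻¹ r^(-(k+1)), and r⁻¹ is at most
      -- κ/delay. This restores the weighted symbol bound at order k + 1.
      obtain ⟨C, hC, h3⟩ := h2 (1 / 2) (by norm_num) (by norm_num)
      refine ⟨C * ((2 * S.M) ^ (-3 - k + 1 / 2 - (-2 - k) : ℝ) * κ), by positivity,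
        fun p hp => (h3 p hp).trans ?_⟩
      have hr0 := pos_of_mem hp.1
      have hd0 := delay_pos hp
      have h4 := rpow_le_const_mul_rpow (q := (-3 - k + 1 / 2 : ℝ)) (q' := -2 - k)
        (by positivity : 0 < 2 * S.M) (mem_exterior.1 hp.1).2.le (by linarith)
      have h5 : p.2 ^ (-2 - k : ℝ) ≤ κ * ((S.delay u₁ p)⁻¹ * p.2 ^ (0 - (k + 1 : ℕ) : ℝ)) := by
        have e : p.2 ^ (-2 - k : ℝ) = p.2⁻¹ * p.2 ^ (0 - (k + 1 : ℕ) : ℝ) := by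
          rw [← Real.rpow_neg_one, ← Real.rpow_add hr0]; push_cast; ring_nf
        rw [e, ← mul_assoc]
        gcongr
        rw [inv_le_iff_one_le_mul₀ hr0]
        have := hd p hp
        rw [mul_assoc, mul_comm, mul_assoc, inv_mul_eq_div, le_div_iff₀ hd0]
        linarith
      calc C * p.2 ^ (-3 - k + 1 / 2 : ℝ)
          ≤ C * ((2 * S.M) ^ (-3 - k + 1 / 2 - (-2 - k) : ℝ) *
            (κ * ((S.delay u₁ p)⁻¹ * p.2 ^ (0 - (k + 1 : ℕ) : ℝ)))) := by
            gcongr C * ?_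
            exact h4.trans (by gcongr)
        _ = _ := by ring
  exact (step k (main k).1 (main k).2).2 η hη hη1

end

section

variable {S : Setting} {f g : ℝ × ℝ → ℝ} {p : ℝ × ℝ} {u₁ : ℝ}

/-! ### The expansion along outgoing cones -/

lemma hasDerivAt_two_div_D {r : ℝ} (hr : 2 * S.M < r) :
    HasDerivAt (fun r => 2 / S.D r) (-(4 * S.M / (r ^ 2 * S.D r ^ 2))) r := by
  have hr0 : r ≠ 0 := by linarith [S.M_pos]
  have h := ((hasDerivAt_D (S := S) hr0).inv (D_pos hr).ne').const_mul 2
  simp only [Pi.inv_apply, ← div_eq_mul_inv] at h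
  refine h.congr_deriv ?_
  have := (D_pos hr).ne'
  field_simp
  ring

lemma drOut_radial_mul {k : ℝ → ℝ} {k' : ℝ} (hk : ContDiffOn ℝ ∞ k (Ioi (2 * S.M)))
    (hg : S.IsSmooth g) (hp : p ∈ S.exterior) (hk' : HasDerivAt k k' p.2) :
    S.drOut (fun q => k q.2 * g q) p = k' * g p + k p.2 * S.drOut g p := by
  have := along_radial_mul (X := fun p => (2 / S.D p.2, 1)) hk hg hp hk'
  simp only [one_mul] at this
  exact this

lemma drOut_drOut (hf : S.IsSmooth f) (hp : p ∈ S.exterior) :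
    S.drOut (S.drOut f) p = -(4 * S.M / (p.2 ^ 2 * S.D p.2 ^ 2)) * S.L f p
      + (2 / S.D p.2) ^ 2 * S.L (S.L f) p := by
  have h1 : S.drOut (S.drOut f) p = S.drOut (fun q => 2 / S.D q.2 * S.L f q) p :=
    along_congr (fun q hq => drOut_eq_L hq) hp
  rw [h1, drOut_radial_mul contDiffOn_two_div_D hf.L hp (hasDerivAt_two_div_D hp.2),
    drOut_eq_L hp]
  ring

lemma drIn_L_comm (hf : S.IsSmooth f) (hp : p ∈ S.exterior) :
    S.drIn (S.L f) p = S.L (S.drIn f) p + S.M / p.2 ^ 2 * S.drIn f p := by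
  rw [drIn_L_eq hf hp, L_eq (S.drIn f), T_drIn hf hp]; ring

lemma IsWave.drIn_L_L (hf : S.IsSmooth f) (hw : S.IsWave f) (hp : p ∈ S.exterior) :
    S.drIn (S.L (S.L f)) p = -(3 * S.M * S.D p.2 / (2 * p.2 ^ 4)) * f p + S.M / p.2 ^ 3 * S.L f p
      + S.M ^ 2 / p.2 ^ 5 * f p := by
  have hr := (pos_of_mem hp).ne'
  have h1 : S.L (S.drIn (S.L f)) p = S.L (fun q => S.M / q.2 ^ 3 * f q) p :=
    along_congr (fun q hq => hw.drIn_L hf hq) hp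
  have h2 : S.L (fun q => S.M / q.2 ^ 3 * f q) p
      = S.D p.2 / 2 * (-((3 : ℕ) * S.M) / p.2 ^ (3 + 1)) * f p + S.M / p.2 ^ 3 * S.L f p :=
    along_radial_mul (contDiffOn_const_div_pow S.M 3) hf hp (hasDerivAt_const_div_pow S.M 3 hr)
  rw [drIn_L_comm hf.L hp, h1, h2, hw.drIn_L hf hp]
  push_cast
  field_simp

/-- On the ingoing cone that meets u = u₁ at radius r₀ the delay is 1 + 2(r*(x) - r*(r₀)). With
`exists_delay_le_two_mul_sub` it is 1 + 2(x - r₀) up to a relative error O(1/r₀). -/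
lemma two_mul_sub_le_delay {r₀ x : ℝ} (h₀ : 2 * S.M < r₀) (h : r₀ ≤ x) :
    2 * (x - r₀) ≤ S.delay u₁ (u₁ + 2 * S.rstar r₀, x) - 1 := by
  have := sub_le_rstar_sub h₀ h
  simp only [delay, u]; linarith

lemma exists_delay_le_two_mul_sub {a : ℝ} (ha : 2 * S.M < a) :
    ∃ c, 0 < c ∧ ∀ u₁ r₀ x, a ≤ r₀ → r₀ ≤ x →
      S.delay u₁ (u₁ + 2 * S.rstar r₀, x) - 1 ≤ 2 * (x - r₀) + c * ((x - r₀) / r₀) := by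
  have hM := S.M_pos
  have ha0 : 0 < a - 2 * S.M := by linarith
  have ha1 : 0 < a := by linarith
  refine ⟨4 * S.M * (a / (a - 2 * S.M)), by positivity, fun u₁ r₀ x h₀ h => ?_⟩
  have hr0 : 0 < r₀ := by linarith
  have hr1 : 0 < r₀ - 2 * S.M := by linarith
  have h1 := rstar_sub_le (S := S) (by linarith) h
  have h2 : (x - r₀) / (r₀ - 2 * S.M) ≤ a / (a - 2 * S.M) * ((x - r₀) / r₀) := by
    rw [div_mul_div_comm, div_le_div_iff₀ hr1 (by positivity)]
    have h3 : (a - 2 * S.M) * r₀ ≤ a * (r₀ - 2 * S.M) := by nlinarith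
    have h4 : 0 ≤ x - r₀ := by linarith
    nlinarith [mul_le_mul_of_nonneg_left h3 h4]
  have e : S.delay u₁ (u₁ + 2 * S.rstar r₀, x) - 1 = 2 * (S.rstar x - S.rstar r₀) := by
    simp only [delay, u]; ring
  rw [e]
  nlinarith

/-- Comparison of decay in `r` with decay in the retarded time. -/
lemma rpow_le_rpow_mul_delay {κ r₀ x d s t : ℝ} (hκ : 0 < κ) (hr₀ : 0 < r₀) (hx : r₀ ≤ x)
    (hd : 0 < d) (hdx : d ≤ κ * x) (ht : 0 ≤ t) (hs : 0 ≤ s) :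
    x ^ (-(s + t)) ≤ κ ^ t * (r₀ ^ (-s) * d ^ (-t)) := by
  have hx0 : 0 < x := hr₀.trans_le hx
  have h1 : x ^ (-s) ≤ r₀ ^ (-s) := Real.rpow_le_rpow_of_nonpos hr₀ hx (by linarith)
  have h2 : x ^ (-t) ≤ κ ^ t * d ^ (-t) := by
    calc x ^ (-t) ≤ (d / κ) ^ (-t) :=
          Real.rpow_le_rpow_of_nonpos (by positivity) (by rwa [div_le_iff₀' hκ]) (by linarith)
      _ = _ := by rw [Real.div_rpow hd.le hκ.le, Real.rpow_neg hκ.le, div_inv_eq_mul, mul_comm]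
  rw [neg_add, Real.rpow_add hx0]
  calc x ^ (-s) * x ^ (-t) ≤ r₀ ^ (-s) * (κ ^ t * d ^ (-t)) := by gcongr
    _ = _ := by ring

/-- The algebraic estimate behind `exists_abs_scaling_le`: `ψ` stands for the radiation field and
`d` for the delay, at the distance `t` to the cone of radius `r₀`. -/
lemma abs_mul_sub_le {t r₀ d ψ I B c δ : ℝ} (ht : 0 ≤ t) (hr₀ : 0 < r₀) (hd : 1 ≤ d) (hc : 0 < c)
    (hδ1 : δ ≤ 1) (h1 : 2 * t ≤ d - 1) (h2 : d - 1 ≤ 2 * t + c * (t / r₀))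
    (h3 : |ψ - 2 * I / d| ≤ B * d ^ (-1 - δ)) :
    |t * ψ - I| ≤ (B + |I|) * d ^ (-δ) + |I| * c * r₀⁻¹ := by
  have hd0 : 0 < d := by linarith
  have e : t * ψ - I = t * (ψ - 2 * I / d) + I * ((2 * t - d) / d) := by field_simp; ring
  have h4 : |t * (ψ - 2 * I / d)| ≤ B * d ^ (-δ) := by
    rw [abs_mul, abs_of_nonneg ht]
    calc t * |ψ - 2 * I / d| ≤ d * (B * d ^ (-1 - δ)) := by gcongr; linarith
      _ = B * d ^ (-δ) := by
        rw [sub_eq_add_neg, Real.rpow_add hd0, Real.rpow_neg_one]; field_simp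
  have h5 : |(2 * t - d) / d| ≤ d ^ (-δ) + c * r₀⁻¹ := by
    rw [abs_div, abs_of_pos hd0, abs_of_nonpos (by linarith)]
    have h6 : d⁻¹ ≤ d ^ (-δ) := by
      rw [← Real.rpow_neg_one]; exact Real.rpow_le_rpow_of_exponent_le hd (by linarith)
    have h7 : -(2 * t - d) ≤ 1 + c * (d / r₀) := by
      have : c * (t / r₀) ≤ c * (d / r₀) := by gcongr; linarith
      linarith
    calc -(2 * t - d) / d ≤ (1 + c * (d / r₀)) / d := by gcongr
      _ = d⁻¹ + c * r₀⁻¹ := by field_simp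
      _ ≤ _ := by gcongr
  rw [e]
  refine (abs_add_le _ _).trans ?_
  rw [abs_mul I]
  have := mul_le_mul_of_nonneg_left h5 (abs_nonneg I)
  nlinarith

/-- The radius of the target point is frozen as r₀ in the coefficient 2r₀, and the combination is
integrated along the ingoing cone. The sources of 3Lf and 2r₀L²f combine to leading order into
(3M/x⁴)(x - r₀)f. There (x - r₀)f ≈ I because f ≈ 2I/delay and delay ≈ 2(x - r₀), and MI/x³ cancels
this limit. The vanishing factor x - r₀ is what removes the logarithm. -/
lemma IsWave.exists_abs_scaling_le (hf : S.IsSmooth f) (hw : S.IsWave f) {B I β δ : ℝ}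
    (hβ : 0 < β) (hβδ : β < δ) (hδ1 : δ ≤ 1) (hB0 : 0 ≤ B)
    (hB : ∀ p ∈ S.region u₁, |f p| ≤ B / S.delay u₁ p)
    (hBI : ∀ p ∈ S.region u₁, |f p - 2 * I / S.delay u₁ p| ≤ B * S.delay u₁ p ^ (-1 - δ))
    {C : ℝ} (hC0 : 0 ≤ C) (hL : ∀ p ∈ S.region u₁, |S.L f p| ≤ C * p.2 ^ (-2 - δ))
    (hLL : ∀ p ∈ S.region u₁, |S.L (S.L f) p| ≤ C * p.2 ^ (-3 - δ)) :
    ∃ P, 0 ≤ P ∧ ∀ r, S.innerRadius u₁ ≤ r →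
      |3 * S.L f (u₁ + 2 * S.rstar r, r) + 2 * r * S.L (S.L f) (u₁ + 2 * S.rstar r, r)
        + S.M * I / r ^ 3| ≤ P * r ^ (-3 - β) := by
  have hM := S.M_pos
  have ha0 : 0 < S.innerRadius u₁ := innerRadius_pos
  obtain ⟨κ, hκ, hdκ⟩ := exists_delay_le S u₁
  obtain ⟨c, hc, hdc⟩ := exists_delay_le_two_mul_sub (two_M_lt_innerRadius (S := S) (u₁ := u₁))
  set a := S.innerRadius u₁ with ha
  set K₁ := κ ^ (1 - β) with hK₁
  set K₂ := κ ^ (1 + (δ - β)) with hK₂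
  set A := 3 * S.M * (B + |I|) * K₁ + 3 * S.M * |I| * c * a ^ (-1 - -δ) * K₂
    + 8 * S.M ^ 2 * B * K₁ + 2 * S.M * C * K₂ with hA
  have hK₁0 : 0 < K₁ := by positivity
  have hK₂0 : 0 < K₂ := by positivity
  have hA0 : 0 ≤ A := by positivity
  refine ⟨A / (δ - β), div_nonneg hA0 (by linarith), fun r₀ hr₀ => ?_⟩
  have hr₀2 : 2 * S.M < r₀ := two_M_lt_innerRadius.trans_le hr₀
  have hr₀0 : 0 < r₀ := by linarith
  set v := u₁ + 2 * S.rstar r₀ with hv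
  have hv₀ : S.v₀ ≤ v := by
    have := (radius_le_iff hr₀2).1 hr₀
    linarith
  have hm₀ : (v, r₀) ∈ S.region u₁ := ⟨⟨hv₀, hr₀2⟩, by rw [u_mk]; linarith⟩
  have hs1 : S.IsSmooth fun q => 3 * S.L f q := contDiffOn_const.mul hf.L
  have hs2 : S.IsSmooth fun q => 2 * r₀ * S.L (S.L f) q := contDiffOn_const.mul hf.L.L
  have hs3 : S.IsSmooth fun q => S.M * I / q.2 ^ 3 :=
    isSmooth_radial (contDiffOn_const_div_pow _ _)
  have hs : S.IsSmooth fun q => 3 * S.L f q + 2 * r₀ * S.L (S.L f) q + S.M * I / q.2 ^ 3 :=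
    (hs1.add hs2).add hs3
  have hdr : ∀ q ∈ S.exterior,
      S.drIn (fun q => 3 * S.L f q + 2 * r₀ * S.L (S.L f) q + S.M * I / q.2 ^ 3) q
        = 3 * S.M / q.2 ^ 4 * ((q.2 - r₀) * f q - I) + 8 * S.M ^ 2 * r₀ / q.2 ^ 5 * f q
          + 2 * S.M * r₀ / q.2 ^ 3 * S.L f q := by
    intro q hq
    have hq0 := (pos_of_mem hq).ne'
    have c1 : ∀ c : ℝ, ContDiffOn ℝ ∞ (fun _ : ℝ => c) (Ioi (2 * S.M)) :=
      fun c => contDiffOn_const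
    rw [drIn_add (hs1.add hs2) hs3 hq, drIn_add hs1 hs2 hq,
      drIn_radial_mul (c1 3) hf.L hq (hasDerivAt_const _ _),
      drIn_radial_mul (c1 (2 * r₀)) hf.L.L hq (hasDerivAt_const _ _), hw.drIn_L_L hf hq,
      hw.drIn_L hf hq]
    have e : S.drIn (fun q => S.M * I / q.2 ^ 3) q = 1 * (-((3 : ℕ) * (S.M * I)) / q.2 ^ (3 + 1)) :=
      along_radial hq (hasDerivAt_const_div_pow _ 3 hq0)
    rw [e, D]
    push_cast
    field_simp
    ring
  have hlim : Tendsto (fun x => 3 * S.L f (v, x) + 2 * r₀ * S.L (S.L f) (v, x)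
      + S.M * I / x ^ 3) atTop (𝓝 0) := by
    have hz : ∀ {g : ℝ × ℝ → ℝ} {s : ℝ}, 0 < s → (∀ p ∈ S.region u₁, |g p| ≤ C * p.2 ^ (-s)) →
        Tendsto (fun x => g (v, x)) atTop (𝓝 0) := by
      intro g s hs hg
      have h1 := (tendsto_rpow_neg_atTop hs).const_mul C
      rw [mul_zero] at h1
      refine squeeze_zero_norm' ?_ h1
      filter_upwards [Ici_mem_atTop r₀] with x hx
      exact hg _ (region_mono_r hm₀ hx)
    have h1 := hz (s := 2 + δ) (by linarith) (g := S.L f)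
      fun p hp => by rw [neg_add']; exact hL p hp
    have h2 := hz (s := 3 + δ) (by linarith) (g := S.L (S.L f))
      fun p hp => by rw [neg_add']; exact hLL p hp
    have h3 : Tendsto (fun x : ℝ => S.M * I / x ^ 3) atTop (𝓝 0) :=
      tendsto_const_nhds.div_atTop (tendsto_pow_atTop (by norm_num))
    have := ((h1.const_mul 3).add (h2.const_mul (2 * r₀))).add h3
    simpa using this
  -- Every term is split as r₀^(-3-β) times delay^(-1-(δ-β)), which is integrable since β < δ; the
  -- cone u = u₁ itself is at delay 1.
  have key := abs_le_of_delay (u₁ := u₁)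
    (b := fun y => A * r₀ ^ (-3 - β) / (δ - β) * y ^ (-(δ - β)))
    (b' := fun y => A * r₀ ^ (-3 - β) * y ^ (-1 - (δ - β))) hs hlim hm₀
    (fun y hy => hasDerivAt_mul_rpow_neg _ (by linarith) hy)
    (fun y hy => by
      have : 0 < y := by linarith
      have : 0 < δ - β := by linarith
      positivity)
    (fun x hx => by
      have hm := region_mono_r hm₀ hx
      have hx0 : 0 < x := hr₀0.trans_le hx
      have hd1 := one_le_delay hm
      have hd0 := delay_pos hm
      have hD := D_pos hm.1.2
      have hD1 : 1 ≤ 2 / S.D x := by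
        rw [le_div_iff₀ hD]; linarith [D_le_one (le_of_lt hm.1.2)]
      set d := S.delay u₁ (v, x) with hd
      have hdx : d ≤ κ * x := hdκ _ hm
      have b1 := abs_mul_sub_le (I := I) (sub_nonneg.2 hx) hr₀0 hd1 hc hδ1
        (two_mul_sub_le_delay hr₀2 hx) (hdc u₁ r₀ x hr₀ hx) (hBI _ hm)
      have b2 : |f (v, x)| ≤ B * d ^ (-δ) := (hB _ hm).trans (by
        rw [div_eq_mul_inv, ← Real.rpow_neg_one]
        gcongr ?_ * ?_
        exact Real.rpow_le_rpow_of_exponent_le hd1 (by linarith))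
      have b3 : |S.L f (v, x)| ≤ C * x ^ (-2 - δ) := hL _ hm
      have hpw : ∀ n : ℕ, x ^ (-(n : ℝ)) = 1 / x ^ n := fun n => by
        rw [Real.rpow_neg hx0.le, Real.rpow_natCast, one_div]
      -- Of the four powers of x, 3 + β become powers of r₀ and 1 - β become powers of the delay.
      -- The two estimates after this one distribute their powers in the same manner.
      have w1 : 1 / x ^ 4 * d ^ (-δ) ≤ K₁ * (r₀ ^ (-3 - β) * d ^ (-1 - (δ - β))) := by
        have h := rpow_le_rpow_mul_delay (s := 3 + β) (t := 1 - β) hκ hr₀0 hx hd0 hdx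
          (by linarith) (by linarith)
        rw [show -(3 + β + (1 - β)) = -((4 : ℕ) : ℝ) by push_cast; ring, hpw] at h
        calc 1 / x ^ 4 * d ^ (-δ) ≤ κ ^ (1 - β) * (r₀ ^ (-(3 + β)) * d ^ (-(1 - β))) * d ^ (-δ) := by
              gcongr
          _ = K₁ * (r₀ ^ (-(3 + β)) * (d ^ (-(1 - β)) * d ^ (-δ))) := by ring
          _ = _ := by rw [← Real.rpow_add hd0]; ring_nf
      have w2 : 1 / x ^ 4 * r₀⁻¹ ≤ a ^ (-1 - -δ) * K₂ * (r₀ ^ (-3 - β) * d ^ (-1 - (δ - β))) := by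
        have h := rpow_le_rpow_mul_delay (s := 3 - (δ - β)) (t := 1 + (δ - β)) hκ hr₀0 hx hd0 hdx
          (by linarith) (by linarith)
        rw [show -(3 - (δ - β) + (1 + (δ - β))) = -((4 : ℕ) : ℝ) by push_cast; ring, hpw] at h
        have h' := rpow_le_const_mul_rpow (q := -1) (q' := -δ) ha0 hr₀ (by linarith)
        rw [Real.rpow_neg_one] at h'
        calc 1 / x ^ 4 * r₀⁻¹ ≤ (κ ^ (1 + (δ - β)) * (r₀ ^ (-(3 - (δ - β))) * d ^ (-(1 + (δ - β))))) *
              (a ^ (-1 - -δ) * r₀ ^ (-δ)) := by gcongr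
          _ = a ^ (-1 - -δ) * K₂ * ((r₀ ^ (-(3 - (δ - β))) * r₀ ^ (-δ)) * d ^ (-(1 + (δ - β)))) := by
              ring
          _ = _ := by rw [← Real.rpow_add hr₀0]; ring_nf
      have w3 : r₀ / x ^ 3 * x ^ (-2 - δ) ≤ K₂ * (r₀ ^ (-3 - β) * d ^ (-1 - (δ - β))) := by
        have h := rpow_le_rpow_mul_delay (s := 3 + β) (t := 1 + (δ - β)) hκ hr₀0 hx hd0 hdx
          (by linarith) (by linarith)
        calc r₀ / x ^ 3 * x ^ (-2 - δ) ≤ x / x ^ 3 * x ^ (-2 - δ) := by gcongr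
          _ = x ^ (-((2 : ℕ) : ℝ)) * x ^ (-2 - δ) := by rw [hpw]; field_simp
          _ = x ^ (-(3 + β + (1 + (δ - β)))) := by
              rw [← Real.rpow_add hx0]; push_cast; ring_nf
          _ ≤ _ := h
          _ = _ := by rw [hK₂]; ring_nf
      set W := r₀ ^ (-3 - β) * d ^ (-1 - (δ - β)) with hW
      have hW0 : 0 ≤ W := by positivity
      rw [hdr _ hm.1]
      simp only
      have t1 : |3 * S.M / x ^ 4 * ((x - r₀) * f (v, x) - I)|
          ≤ (3 * S.M * (B + |I|) * K₁ + 3 * S.M * |I| * c * a ^ (-1 - -δ) * K₂) * W := by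
        rw [abs_mul, abs_of_pos (by positivity)]
        calc _ ≤ 3 * S.M / x ^ 4 * ((B + |I|) * d ^ (-δ) + |I| * c * r₀⁻¹) := by gcongr
          _ = 3 * S.M * (B + |I|) * (1 / x ^ 4 * d ^ (-δ))
              + 3 * S.M * |I| * c * (1 / x ^ 4 * r₀⁻¹) := by ring
          _ ≤ 3 * S.M * (B + |I|) * (K₁ * W)
              + 3 * S.M * |I| * c * (a ^ (-1 - -δ) * K₂ * W) := by gcongr
          _ = _ := by ring
      have t2 : |8 * S.M ^ 2 * r₀ / x ^ 5 * f (v, x)| ≤ 8 * S.M ^ 2 * B * K₁ * W := by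
        rw [abs_mul, abs_of_pos (by positivity)]
        calc _ ≤ 8 * S.M ^ 2 * x / x ^ 5 * (B * d ^ (-δ)) := by gcongr
          _ = 8 * S.M ^ 2 * B * (1 / x ^ 4 * d ^ (-δ)) := by field_simp
          _ ≤ 8 * S.M ^ 2 * B * (K₁ * W) := by gcongr
          _ = _ := by ring
      have t3 : |2 * S.M * r₀ / x ^ 3 * S.L f (v, x)| ≤ 2 * S.M * C * K₂ * W := by
        rw [abs_mul, abs_of_pos (by positivity)]
        calc _ ≤ 2 * S.M * r₀ / x ^ 3 * (C * x ^ (-2 - δ)) := by gcongr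
          _ = 2 * S.M * C * (r₀ / x ^ 3 * x ^ (-2 - δ)) := by ring
          _ ≤ 2 * S.M * C * (K₂ * W) := by gcongr
          _ = _ := by ring
      have t4 : A * W ≤ 2 / S.D x * (A * W) := le_mul_of_one_le_left (by positivity) hD1
      refine (abs_add_le _ _).trans ((add_le_add_left (abs_add_le _ _) _).trans ?_)
      have e : A * W = (3 * S.M * (B + |I|) * K₁ + 3 * S.M * |I| * c * a ^ (-1 - -δ) * K₂) * W
          + 8 * S.M ^ 2 * B * K₁ * W + 2 * S.M * C * K₂ * W := by rw [hA]; ring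
      rw [mul_assoc A, ← hW]
      linarith)
  have hd1 : S.delay u₁ (v, r₀) = 1 := by simp only [delay, u]; ring
  simp only [hd1, Real.one_rpow, mul_one] at key
  refine key.trans (le_of_eq (by ring))

lemma exists_tendsto_of_abs_drOut_le {F : ℝ × ℝ → ℝ} (hF : S.IsSmooth F) {P β : ℝ}
    (hβ : 0 < β) (h : ∀ r, S.innerRadius u₁ ≤ r →
      |S.drOut F (u₁ + 2 * S.rstar r, r)| ≤ P * r ^ (-1 - β)) :
    ∃ J, ∀ r, S.innerRadius u₁ ≤ r → |F (u₁ + 2 * S.rstar r, r) - J| ≤ P / β * r ^ (-β) := by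
  have ha0 : 0 < S.innerRadius u₁ := innerRadius_pos
  obtain ⟨J, -, hJ⟩ := exists_tendsto_of_abs_sub_le (f := fun r => F (u₁ + 2 * S.rstar r, r))
    (b := fun r => P / β * r ^ (-β)) (a := S.innerRadius u₁)
    (by simpa using (tendsto_rpow_neg_atTop hβ).const_mul (P / β)) (fun x y hx hxy => by
      have hx2 : 2 * S.M < x := two_M_lt_innerRadius.trans_le hx
      have := abs_sub_le_of_abs_drOut_le (w := u₁) (B := fun r => -(P / β * r ^ (-β)))
        (B' := fun r => P * r ^ (-1 - β)) hF hx2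
        (by have := (radius_le_iff hx2).1 hx
            linarith) hxy
        (fun z hz => by
          have hz0 : z ≠ 0 := by linarith [hz.1]
          have h1 := ((Real.hasDerivAt_rpow_const (p := -β) (Or.inl hz0)).const_mul (P / β)).neg
          refine h1.congr_deriv ?_
          rw [show -β - 1 = -1 - β by ring]
          field_simp)
        (fun z hz => h z (hx.trans hz.1))
      linarith)
  exact ⟨J, hJ⟩

/-- The expansion of the outgoing derivative of the radiation field towards future null
infinity. -/
lemma IsWave.exists_expansion (hf : S.IsSmooth f) (hw : S.IsWave f) {B I β δ : ℝ}
    (hβ : 0 < β) (hβδ : β < δ) (hδ1 : δ ≤ 1) (hB0 : 0 ≤ B)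
    (hB : ∀ p ∈ S.region u₁, |f p| ≤ B / S.delay u₁ p)
    (hBI : ∀ p ∈ S.region u₁, |f p - 2 * I / S.delay u₁ p| ≤ B * S.delay u₁ p ^ (-1 - δ))
    {C : ℝ} (hC0 : 0 ≤ C) (hL : ∀ p ∈ S.region u₁, |S.L f p| ≤ C * p.2 ^ (-2 - δ))
    (hLL : ∀ p ∈ S.region u₁, |S.L (S.L f) p| ≤ C * p.2 ^ (-3 - δ)) :
    ∃ J P, 0 ≤ P ∧ ∀ r, S.innerRadius u₁ ≤ r →
      |r ^ 3 * S.drOut f (u₁ + 2 * S.rstar r, r) + 2 * S.M * I * Real.log r - J|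
        ≤ P * r ^ (-β) := by
  have hM := S.M_pos
  have ha0 : 0 < S.innerRadius u₁ := innerRadius_pos
  obtain ⟨P, hP, hQ⟩ := hw.exists_abs_scaling_le hf hβ hβδ hδ1 hB0 hB hBI hC0 hL hLL
  obtain ⟨c, hc, hcD⟩ := exists_two_div_D_le (two_M_lt_innerRadius (S := S) (u₁ := u₁))
  set a := S.innerRadius u₁ with ha
  have hs3 : ContDiffOn ℝ ∞ (fun r : ℝ => r ^ 3) (Ioi (2 * S.M)) := contDiffOn_id.pow 3
  have hslog : ContDiffOn ℝ ∞ (fun r : ℝ => 2 * S.M * I * Real.log r) (Ioi (2 * S.M)) :=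
    contDiffOn_const.mul (contDiffOn_id.log fun r hr => by
      have : 2 * S.M < r := hr
      simp only [id]; linarith)
  have hF : S.IsSmooth fun p => p.2 ^ 3 * S.drOut f p + 2 * S.M * I * Real.log p.2 :=
    ((isSmooth_radial hs3).mul hf.drOut).add (isSmooth_radial hslog)
  set A := c * P + (3 * S.M * c ^ 2 * C) * a ^ (-δ - -β)
    + 2 * S.M ^ 2 * |I| * c * a ^ (-2 - (-1 - β)) with hA
  obtain ⟨J, hJ⟩ := exists_tendsto_of_abs_drOut_le (u₁ := u₁) (P := A) (β := β) hF hβ (fun r hr => by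
      have hr2 : 2 * S.M < r := two_M_lt_innerRadius.trans_le hr
      have hr0 : 0 < r := by linarith
      have hm : (u₁ + 2 * S.rstar r, r) ∈ S.region u₁ := by
        refine ⟨⟨?_, hr2⟩, (u_outgoing _ _).le⟩
        have := (radius_le_iff hr2).1 hr
        simp only [mem_Ici]; linarith
      have hD := D_pos hr2
      have q1 := hQ r hr
      have q2 := hL _ hm
      have q3 := hLL _ hm
      have q4 := hcD r hr
      set Y := S.L f (u₁ + 2 * S.rstar r, r) with hY
      set Z := S.L (S.L f) (u₁ + 2 * S.rstar r, r) with hZ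
      -- The derivative 2MI/r of the logarithm completes the scaling combination. The terms left
      -- over come from D ≠ 1 and are of lower order.
      have e1 : S.drOut (fun p => p.2 ^ 3 * S.drOut f p + 2 * S.M * I * Real.log p.2)
          (u₁ + 2 * S.rstar r, r) = 2 / S.D r * (r ^ 2 * (3 * Y + 2 * r * Z + S.M * I / r ^ 3))
            + ((2 / S.D r) ^ 2 * (2 * S.M * r ^ 2 * Z) + -((2 / S.D r) ^ 2 * (S.M * r * Y))
            + -(2 / S.D r * (2 * S.M ^ 2 * I / r ^ 2))) := by
        have h1 : S.drOut (fun p => p.2 ^ 3 * S.drOut f p + 2 * S.M * I * Real.log p.2)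
          (u₁ + 2 * S.rstar r, r) = _ :=
            along_add ((isSmooth_radial hs3).mul hf.drOut) (isSmooth_radial hslog) hm.1
        have h2 : S.drOut (fun p => 2 * S.M * I * Real.log p.2) (u₁ + 2 * S.rstar r, r)
            = 1 * (2 * S.M * I * r⁻¹) :=
          along_radial hm.1 ((Real.hasDerivAt_log hr0.ne').const_mul (2 * S.M * I))
        rw [h1]
        change S.drOut _ _ + S.drOut _ _ = _
        rw [h2, drOut_radial_mul hs3 hf.drOut hm.1 (hasDerivAt_pow 3 r), drOut_drOut hf hm.1,
          drOut_eq_L hm.1, ← hY, ← hZ]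
        simp only
        have hr2' : r - 2 * S.M ≠ 0 := by linarith
        have hDe : S.D r = (r - 2 * S.M) / r := by rw [D]; field_simp
        rw [hDe]
        push_cast
        field_simp
        ring
      have hpw : ∀ (n : ℕ) (s : ℝ), r ^ n * r ^ s = r ^ (n + s) := fun n s => by
        rw [Real.rpow_add hr0, Real.rpow_natCast]
      have m1 : r ^ (-1 - δ) ≤ a ^ (-δ - -β) * r ^ (-1 - β) := by
        have := rpow_le_const_mul_rpow (q := -1 - δ) (q' := -1 - β) ha0 hr (by linarith)
        rwa [show -1 - δ - (-1 - β) = -δ - -β by ring] at this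
      have m2 := rpow_le_const_mul_rpow (q := -2) (q' := -1 - β) ha0 hr (by linarith)
      have m2' : r ^ (-2 : ℝ) = 1 / r ^ 2 := by
        rw [Real.rpow_neg hr0.le, show (2 : ℝ) = (2 : ℕ) by norm_num, Real.rpow_natCast, one_div]
      rw [m2'] at m2
      have t1 : |2 / S.D r * (r ^ 2 * (3 * Y + 2 * r * Z + S.M * I / r ^ 3))|
          ≤ c * P * r ^ (-1 - β) := by
        rw [abs_mul, abs_mul, abs_of_pos (by positivity), abs_of_pos (by positivity)]
        calc _ ≤ c * (r ^ 2 * (P * r ^ (-3 - β))) := by gcongr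
          _ = c * P * (r ^ 2 * r ^ (-3 - β)) := by ring
          _ = _ := by rw [hpw]; push_cast; ring_nf
      have t2 : |(2 / S.D r) ^ 2 * (2 * S.M * r ^ 2 * Z)|
          ≤ 2 * S.M * c ^ 2 * C * (a ^ (-δ - -β) * r ^ (-1 - β)) := by
        rw [abs_mul, abs_mul, abs_of_pos (by positivity), abs_of_pos (by positivity)]
        calc _ ≤ c ^ 2 * (2 * S.M * r ^ 2 * (C * r ^ (-3 - δ))) := by gcongr
          _ = 2 * S.M * c ^ 2 * C * (r ^ 2 * r ^ (-3 - δ)) := by ring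
          _ = 2 * S.M * c ^ 2 * C * r ^ (-1 - δ) := by rw [hpw]; push_cast; ring_nf
          _ ≤ _ := by gcongr
      have t3 : |-((2 / S.D r) ^ 2 * (S.M * r * Y))|
          ≤ S.M * c ^ 2 * C * (a ^ (-δ - -β) * r ^ (-1 - β)) := by
        rw [abs_neg, abs_mul, abs_mul, abs_of_pos (by positivity), abs_of_pos (by positivity)]
        calc _ ≤ c ^ 2 * (S.M * r * (C * r ^ (-2 - δ))) := by gcongr
          _ = S.M * c ^ 2 * C * (r ^ 1 * r ^ (-2 - δ)) := by ring
          _ = S.M * c ^ 2 * C * r ^ (-1 - δ) := by rw [hpw]; push_cast; ring_nf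
          _ ≤ _ := by gcongr
      have t4 : |-(2 / S.D r * (2 * S.M ^ 2 * I / r ^ 2))|
          ≤ 2 * S.M ^ 2 * |I| * c * (a ^ (-2 - (-1 - β)) * r ^ (-1 - β)) := by
        rw [abs_neg, abs_mul, abs_of_pos (by positivity : 0 < 2 / S.D r), abs_div, abs_mul,
          abs_of_pos (by positivity : 0 < 2 * S.M ^ 2), abs_of_pos (by positivity : 0 < r ^ 2)]
        calc _ ≤ c * (2 * S.M ^ 2 * |I| / r ^ 2) := by gcongr
          _ = 2 * S.M ^ 2 * |I| * c * (1 / r ^ 2) := by ring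
          _ ≤ _ := by gcongr
      rw [e1]
      refine (abs_add_le _ _).trans ((add_le_add_right (abs_add_three _ _ _) _).trans ?_)
      have e : A * r ^ (-1 - β) = c * P * r ^ (-1 - β)
          + 3 * S.M * c ^ 2 * C * (a ^ (-δ - -β) * r ^ (-1 - β))
          + 2 * S.M ^ 2 * |I| * c * (a ^ (-2 - (-1 - β)) * r ^ (-1 - β)) := by rw [hA]; ring
      linarith)
  exact ⟨J, A / β, by positivity, hJ⟩

end

section

variable {S : Setting} {f g : ℝ × ℝ → ℝ} {p : ℝ × ℝ}

/-! ### The hypersurface `Σ₀` -/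

lemma D_nonneg {r : ℝ} (hr : 2 * S.M ≤ r) : 0 ≤ S.D r := by
  have h0 : 0 < r := by linarith [S.M_pos]
  have : 2 * S.M / r ≤ 1 := (div_le_one h0).2 hr
  simp only [D]; linarith

/-- Wherever h ≠ 0 one has D h ≤ 2 and r > rH, and 2/D is bounded for r ≥ rH. -/
lemma exists_h_le (S : Setting) : ∃ H, 0 ≤ H ∧ ∀ r, 2 * S.M ≤ r → 0 ≤ S.h r ∧ S.h r ≤ H := by
  obtain ⟨c, hc, hcD⟩ := exists_two_div_D_le S.two_M_lt_rH
  refine ⟨c, hc.le, fun r hr => ?_⟩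
  rcases le_or_gt r S.rH with h1 | h1
  · rw [S.h_inner r hr h1]; exact ⟨le_rfl, hc.le⟩
  have hr2 : 2 * S.M < r := S.two_M_lt_rH.trans h1
  have hD := D_pos hr2
  rcases lt_or_ge r S.R with h2 | h2
  · obtain ⟨h3, h4⟩ := S.h_spacelike r h1 h2
    refine ⟨h3.le, le_trans ?_ (hcD r h1.le)⟩
    rw [le_div_iff₀ hD, mul_comm]
    exact h4.le
  · have e : S.h r = 2 / S.D r := S.h_outer r h2
    rw [e]
    exact ⟨by positivity, hcD r h1.le⟩

/-- A point off the break points lies strictly between its two neighbouring break points, where h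
coincides with a smooth function. -/
lemma exists_finset_continuousOn {h : ℝ → ℝ} {a b : ℝ}
    (H : PiecewiseSmoothOn h a b) : ∃ s : Finset ℝ, ContinuousOn h (Ioo a b \ s) := by
  obtain ⟨s, ha, hb, hs⟩ := H
  refine ⟨s, fun z hz => ContinuousAt.continuousWithinAt ?_⟩
  have hl : (s.filter (· < z)).Nonempty := ⟨a, Finset.mem_filter.2 ⟨ha, hz.1.1⟩⟩
  have hu : (s.filter (z < ·)).Nonempty := ⟨b, Finset.mem_filter.2 ⟨hb, hz.1.2⟩⟩
  obtain ⟨hx1, hx2⟩ := Finset.mem_filter.1 (Finset.max'_mem _ hl)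
  obtain ⟨hy1, hy2⟩ := Finset.mem_filter.1 (Finset.min'_mem _ hu)
  obtain ⟨g, hg, hgh⟩ := hs _ hx1 _ hy1 (hx2.trans hy2) (by
    rintro t ht ⟨h1, h2⟩
    rcases lt_trichotomy t z with h3 | h3 | h3
    · exact absurd (Finset.le_max' _ t (Finset.mem_filter.2 ⟨ht, h3⟩)) (not_le.2 h1)
    · exact hz.2 (h3 ▸ ht)
    · exact absurd (Finset.min'_le _ t (Finset.mem_filter.2 ⟨ht, h3⟩)) (not_le.2 h2))
  refine (hg.continuous.continuousAt).congr ?_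
  filter_upwards [Ioo_mem_nhds hx2 hy2] with t ht
  exact (hgh t ht).symm

lemma intervalIntegrable_h {r : ℝ} (hr : 2 * S.M ≤ r) :
    IntervalIntegrable S.h volume (2 * S.M) r := by
  obtain ⟨H, hH0, hH⟩ := exists_h_le S
  have hrH := S.two_M_lt_rH
  obtain ⟨s, hs⟩ := exists_finset_continuousOn S.h_piecewise
  have hmeas : AEStronglyMeasurable S.h (volume.restrict (Ioo S.rH S.R)) := by
    have hm : MeasurableSet (Ioo S.rH S.R \ (s : Set ℝ)) :=
      measurableSet_Ioo.diff s.measurableSet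
    have e : (Ioo S.rH S.R \ (s : Set ℝ) : Set ℝ) =ᵐ[volume] Ioo S.rH S.R :=
      sdiff_null_ae_eq_self (s.finite_toSet.measure_zero _)
    rw [← Measure.restrict_congr_set e]
    exact hs.aestronglyMeasurable hm
  have hin : AEStronglyMeasurable S.h (volume.restrict (Icc (2 * S.M) S.rH)) :=
    ((continuousOn_const (c := (0 : ℝ))).congr
      fun x hx => S.h_inner x hx.1 hx.2).aestronglyMeasurable measurableSet_Icc
  have hout : AEStronglyMeasurable S.h (volume.restrict (Ici S.R)) := by
    have : ContinuousOn S.h (Ici S.R) :=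
      (contDiffOn_two_div_D.continuousOn.mono fun x hx => two_M_lt_R.trans_le hx).congr
        fun x hx => S.h_outer x hx
    exact this.aestronglyMeasurable measurableSet_Ici
  have hcover : AEStronglyMeasurable S.h (volume.restrict (Ioc (2 * S.M) r)) := by
    refine (aestronglyMeasurable_union_iff.2 ⟨aestronglyMeasurable_union_iff.2 ⟨hin, hmeas⟩,
      hout⟩).mono_set fun x hx => ?_
    rcases le_or_gt x S.rH with h1 | h1
    · exact Or.inl (Or.inl ⟨hx.1.le, h1⟩)
    rcases lt_or_ge x S.R with h2 | h2
    · exact Or.inl (Or.inr ⟨h1, h2⟩)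
    · exact Or.inr h2
  rw [intervalIntegrable_iff_integrableOn_Ioc_of_le hr]
  refine IntegrableOn.of_bound (by simp) hcover H ?_
  filter_upwards [ae_restrict_mem measurableSet_Ioc] with x hx
  obtain ⟨h1, h2⟩ := hH x hx.1.le
  rwa [Real.norm_eq_abs, abs_of_nonneg h1]

/-- Both sides have slope 2/D for r ≥ R, and the additive constant of `rstar` makes them agree at R.
-/
lemma vSigma_outer {r : ℝ} (hr : S.R ≤ r) : S.vSigma r = 2 * S.rstar r := by
  have h1 := two_M_lt_R (S := S)
  have i1 := intervalIntegrable_h (S := S) h1.le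
  have i2 := intervalIntegrable_h (S := S) (h1.le.trans hr)
  have e1 : S.vSigma r = S.vSigma S.R + ∫ s in S.R..r, S.h s := by
    rw [vSigma, vSigma, add_assoc,
      intervalIntegral.integral_add_adjacent_intervals i1 (i1.symm.trans i2)]
  have e2 : ∫ s in S.R..r, S.h s = ∫ s in S.R..r, 2 * (S.D s)⁻¹ := by
    refine intervalIntegral.integral_congr fun x hx => ?_
    rw [uIcc_of_le hr] at hx
    have : S.h x = 2 / S.D x := S.h_outer x hx.1
    simp only [this, div_eq_mul_inv]
  rw [e1, e2, intervalIntegral.integral_const_mul, rstar]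
  ring

lemma le_vSigma {r : ℝ} (hr : 2 * S.M ≤ r) : S.v₀ ≤ S.vSigma r := by
  obtain ⟨H, -, hH⟩ := exists_h_le S
  have : 0 ≤ ∫ s in (2 * S.M)..r, S.h s :=
    intervalIntegral.integral_nonneg hr fun x hx => (hH x hx.1).1
  rw [vSigma]; linarith

lemma exists_vSigma_le (S : Setting) (b : ℝ) :
    ∃ V, ∀ r, 2 * S.M ≤ r → r ≤ b → S.vSigma r ≤ V := by
  obtain ⟨H, hH0, hH⟩ := exists_h_le S
  refine ⟨S.v₀ + H * (b - 2 * S.M), fun r hr hrb => ?_⟩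
  have h1 : ‖∫ s in (2 * S.M)..r, S.h s‖ ≤ H * |r - 2 * S.M| :=
    intervalIntegral.norm_integral_le_of_norm_le_const fun x hx => by
      rw [uIoc_of_le hr] at hx
      obtain ⟨h1, h2⟩ := hH x hx.1.le
      rwa [Real.norm_eq_abs, abs_of_nonneg h1]
  rw [abs_of_nonneg (by linarith)] at h1
  have h2 := (le_abs_self _).trans h1
  have h3 : H * (r - 2 * S.M) ≤ H * (b - 2 * S.M) := by gcongr
  rw [vSigma]; linarith

variable (S) in
/-- The outgoing null part `{u = 0, r ≥ R}` of `Σ₀`. -/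
def outgoingCone : Set (ℝ × ℝ) := {p | ∃ r, S.R ≤ r ∧ p = (2 * S.rstar r, r)}

lemma R_pos (S : Setting) : 0 < S.R := by linarith [S.lt_R, S.M_pos]

lemma outgoingCone_subset_region : S.outgoingCone ⊆ S.region 0 := by
  rintro _ ⟨r, hr, rfl⟩
  refine ⟨⟨?_, two_M_lt_R.trans_le hr⟩, by rw [u_mk]; linarith⟩
  rw [← vSigma_outer hr]
  exact le_vSigma (two_M_lt_R.le.trans hr)

lemma outgoingCone_subset_exterior : S.outgoingCone ⊆ S.exterior := fun _ hp =>
  (outgoingCone_subset_region hp).1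

lemma vSigma_mem_outgoingCone {r : ℝ} (hr : S.R ≤ r) : (S.vSigma r, r) ∈ S.outgoingCone :=
  ⟨r, hr, by rw [vSigma_outer hr]⟩

/-! ### Finiteness of the energies -/

lemma lintegral_Ioi_lt_top {F : ℝ → ℝ} {a C s : ℝ} (ha : 0 < a) (hs : s < -1)
    (h : ∀ r, a < r → F r ≤ C * r ^ s) : ∫⁻ r in Ioi a, ENNReal.ofReal (F r) < ⊤ := by
  have hi : IntegrableOn (fun r : ℝ => C * r ^ s) (Ioi a) :=
    (integrableOn_Ioi_rpow_of_lt hs ha).const_mul C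
  refine lt_of_le_of_lt (setLIntegral_mono' measurableSet_Ioi fun r hr => ?_) hi.lintegral_lt_top
  exact ENNReal.ofReal_le_ofReal (h r hr)

lemma outerNorm_lt_top {q s C : ℝ} (hqs : q + 2 * s < -1)
    (h : ∀ p ∈ S.outgoingCone, |f p| ≤ C * p.2 ^ s) : S.outerNorm q f < ⊤ := by
  rw [outerNorm, setLIntegral_congr Ioi_ae_eq_Ici.symm]
  refine lintegral_Ioi_lt_top (R_pos S) hqs (C := C ^ 2) fun r hr => ?_
  have hr0 : 0 < r := (R_pos S).trans hr
  have h1 := h _ (vSigma_mem_outgoingCone (le_of_lt hr))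
  simp only at h1
  have h2 : f (S.vSigma r, r) ^ 2 ≤ (C * r ^ s) ^ 2 := by
    rw [← sq_abs]; gcongr
  calc _ ≤ r ^ q * (C * r ^ s) ^ 2 := by gcongr
    _ = C ^ 2 * (r ^ q * (r ^ s * r ^ s)) := by ring
    _ = _ := by rw [← Real.rpow_add hr0, ← Real.rpow_add hr0, two_mul]

/-- The normal of a null cone is tangent to it, so the flux of J^T contains only the derivative
along the cone; the cross terms with `T f` cancel. -/
lemma emTensor_outer {r : ℝ} (hr : S.R ≤ r) :
    S.emTensor f (S.vSigma r, r) (S.Nv r, S.Nr r) (S.normal r)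
      = S.D r / 2 * S.drOut f (S.vSigma r, r) ^ 2 := by
  have hD := (D_pos (S := S) (two_M_lt_R.trans_le hr)).ne'
  have h1 : S.h r = 2 / S.D r := S.h_outer r hr
  obtain ⟨h2, h3⟩ := S.N_outer r hr
  have e1 : S.normal r = (2 / S.D r, 1) := by
    rw [normal, h1]; congr 1; field_simp; norm_num
  rw [e1, h2, h3]
  have e2 : fderivWithin ℝ f S.dom (S.vSigma r, r) (2 / S.D r, 1) = S.drOut f (S.vSigma r, r) := rfl
  have e3 : fderivWithin ℝ f S.dom (S.vSigma r, r) (1, 0) = S.T f (S.vSigma r, r) := rfl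
  rw [emTensor, e2, e3, drOut_eq, metric]
  simp only
  field_simp
  ring

lemma exists_abs_le_of_continuous {k : ℝ → ℝ} (hk : Continuous k) (a b : ℝ) :
    ∃ A, ∀ r, a ≤ r → r ≤ b → |k r| ≤ A := by
  obtain ⟨A, hA⟩ := (isCompact_Icc (a := a) (b := b)).exists_bound_of_continuousOn hk.continuousOn
  exact ⟨A, fun r h1 h2 => hA r ⟨h1, h2⟩⟩

/-- This piece of Σ₀ reaches the horizon, so smoothness on `dom`, not merely on `exterior`, is used:
the differential is continuous on a compact box. -/
lemma exists_emTensor_inner_le (hf : ContDiffOn ℝ ∞ f S.dom) :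
    ∃ B, ∀ r, 2 * S.M ≤ r → r ≤ S.R →
      S.emTensor f (S.vSigma r, r) (S.Nv r, S.Nr r) (S.normal r) ≤ B := by
  obtain ⟨V, hV⟩ := exists_vSigma_le S S.R
  obtain ⟨H, hH0, hH⟩ := exists_h_le S
  obtain ⟨A₁, hA₁⟩ := exists_abs_le_of_continuous S.Nv_smooth.continuous (2 * S.M) S.R
  obtain ⟨A₂, hA₂⟩ := exists_abs_le_of_continuous S.Nr_smooth.continuous (2 * S.M) S.R
  have hc : ContinuousOn (fderivWithin ℝ f S.dom) S.dom :=
    (hf.fderivWithin uniqueDiffOn_dom (m := ∞) (by simp)).continuousOn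
  obtain ⟨b, hb⟩ := (isCompact_Icc.prod isCompact_Icc :
    IsCompact (Icc S.v₀ V ×ˢ Icc (2 * S.M) S.R)).exists_bound_of_continuousOn
      (hc.mono (prod_mono Icc_subset_Ici_self Icc_subset_Ici_self))
  set A := max (max A₁ A₂) (H + 1) with hA
  refine ⟨b * A * (b * A) + 1 / 2 * ((A * A + A * A + A * A) * (2 * b * b + b * b)),
    fun r h1 h2 => ?_⟩
  have hb' := hb (S.vSigma r, r) ⟨⟨le_vSigma h1, hV r h1 h2⟩, ⟨h1, h2⟩⟩
  have hb0 : 0 ≤ b := (norm_nonneg _).trans hb'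
  have hA0 : 0 ≤ A := by
    have : H + 1 ≤ A := le_max_right _ _
    linarith
  have hD0 := D_nonneg (S := S) h1
  have hD1 := D_le_one (S := S) h1
  obtain ⟨hh0, hh1⟩ := hH r h1
  have x1 : |S.Nv r| ≤ A := (hA₁ r h1 h2).trans ((le_max_left _ _).trans (le_max_left _ _))
  have x2 : |S.Nr r| ≤ A := (hA₂ r h1 h2).trans ((le_max_right _ _).trans (le_max_left _ _))
  have hA1 : H + 1 ≤ A := le_max_right _ _
  have y1 : |S.h r| ≤ A := by rw [abs_of_nonneg hh0]; linarith
  have y2 : |S.D r * S.h r - 1| ≤ A := by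
    have : S.D r * S.h r ≤ H := by nlinarith
    have : 0 ≤ S.D r * S.h r := by positivity
    rw [abs_le]; constructor <;> linarith
  have hDabs : |S.D r| ≤ 1 := by rwa [abs_of_nonneg hD0]
  have hdf : ∀ X : ℝ × ℝ, ∀ a, ‖X‖ ≤ a → |fderivWithin ℝ f S.dom (S.vSigma r, r) X| ≤ b * a := by
    intro X a hX
    refine ((fderivWithin ℝ f S.dom (S.vSigma r, r)).le_opNorm X).trans ?_
    gcongr
  have d1 := hdf (S.Nv r, S.Nr r) A (max_le x1 x2)
  have d2 := hdf (S.normal r) A (max_le y1 y2)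
  have d3 : |S.T f (S.vSigma r, r)| ≤ b := by
    have := hdf (1, 0) 1 (by simp)
    rwa [mul_one] at this
  have d4 : |S.drIn f (S.vSigma r, r)| ≤ b := by
    have := hdf (0, 1) 1 (by simp)
    rwa [mul_one] at this
  have m1 : |S.metric r (S.Nv r, S.Nr r) (S.normal r)| ≤ A * A + A * A + A * A := by
    simp only [metric, normal]
    refine (abs_add_three _ _ _).trans ?_
    simp only [abs_mul, abs_neg]
    have : |S.D r| * |S.Nv r| * |S.h r| ≤ 1 * A * A := by gcongr
    rw [one_mul] at this
    gcongr
  have m2 : |2 * S.T f (S.vSigma r, r) * S.drIn f (S.vSigma r, r)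
      + S.D r * S.drIn f (S.vSigma r, r) ^ 2| ≤ 2 * b * b + b * b := by
    refine (abs_add_le _ _).trans ?_
    simp only [abs_mul, abs_pow, abs_two]
    have : |S.D r| * |S.drIn f (S.vSigma r, r)| ^ 2 ≤ 1 * b ^ 2 := by gcongr
    rw [one_mul, sq] at this
    rw [← sq] at this ⊢
    gcongr
  refine (le_abs_self _).trans ?_
  rw [emTensor]
  refine (abs_sub _ _).trans ?_
  rw [abs_mul, mul_assoc (1 / 2 : ℝ), abs_mul (1 / 2 : ℝ), abs_mul (S.metric _ _ _),
    abs_of_pos (by norm_num : (0 : ℝ) < 1 / 2)]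
  gcongr

lemma fluxN_lt_top {C : ℝ} (hf : ContDiffOn ℝ ∞ f S.dom)
    (h : ∀ r, S.R < r → |S.drOut f (S.vSigma r, r)| ≤ C * r ^ (-2 : ℝ)) : S.fluxN f < ⊤ := by
  obtain ⟨B, hB⟩ := exists_emTensor_inner_le hf
  have hM := S.M_pos
  have hR := two_M_lt_R (S := S)
  rw [fluxN, ← Icc_union_Ioi_eq_Ici hR.le]
  refine lt_of_le_of_lt (lintegral_union_le _ _ _) (ENNReal.add_lt_top.2 ⟨?_, ?_⟩)
  · refine lt_of_le_of_lt (setLIntegral_mono' (g := fun _ => ENNReal.ofReal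
      (4 * Real.pi * S.R ^ 2 * |B|)) measurableSet_Icc fun r hr => ?_) ?_
    · refine ENNReal.ofReal_le_ofReal ?_
      have h0 : 0 ≤ r := by linarith [hr.1]
      have h1 := (hB r hr.1 hr.2).trans (le_abs_self B)
      have h2 : r ^ 2 ≤ S.R ^ 2 := by have := hr.2; gcongr
      calc _ ≤ 4 * Real.pi * r ^ 2 * |B| := by gcongr
        _ ≤ _ := by gcongr
    · rw [setLIntegral_const]
      exact ENNReal.mul_lt_top ENNReal.ofReal_lt_top (by simp)
  · refine lintegral_Ioi_lt_top (R_pos S) (s := -2) (C := 2 * Real.pi * C ^ 2) (by norm_num)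
      fun r hr => ?_
    have hr0 : 0 < r := (R_pos S).trans hr
    have hD := D_pos (S := S) (hR.trans hr)
    have hD1 := D_le_one (S := S) (hR.trans hr).le
    rw [emTensor_outer (le_of_lt hr)]
    have h1 : S.drOut f (S.vSigma r, r) ^ 2 ≤ (C * r ^ (-2 : ℝ)) ^ 2 := by
      rw [← sq_abs]; have := h r hr; gcongr
    have h2 : r ^ (-2 : ℝ) = 1 / r ^ 2 := by
      rw [Real.rpow_neg hr0.le, show (2 : ℝ) = (2 : ℕ) by norm_num, Real.rpow_natCast, one_div]
    calc _ ≤ 4 * Real.pi * r ^ 2 * (1 / 2 * (C * r ^ (-2 : ℝ)) ^ 2) := by gcongr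
      _ = _ := by rw [h2]; field_simp; ring

lemma contDiffOn_along {X : ℝ × ℝ → ℝ × ℝ} (hX : ContDiffOn ℝ ∞ X S.dom)
    (hf : ContDiffOn ℝ ∞ f S.dom) : ContDiffOn ℝ ∞ (S.along X f) S.dom :=
  (hf.fderivWithin uniqueDiffOn_dom (by simp)).clm_apply hX

lemma contDiffOn_T (hf : ContDiffOn ℝ ∞ f S.dom) : ContDiffOn ℝ ∞ (S.T f) S.dom :=
  contDiffOn_along contDiffOn_const hf

lemma contDiffOn_N (hf : ContDiffOn ℝ ∞ f S.dom) : ContDiffOn ℝ ∞ (S.N f) S.dom :=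
  contDiffOn_along ((S.Nv_smooth.comp contDiff_snd).contDiffOn.prodMk
    (S.Nr_smooth.comp contDiff_snd).contDiffOn) hf

lemma contDiffOn_iterate_T (hf : ContDiffOn ℝ ∞ f S.dom) (k : ℕ) :
    ContDiffOn ℝ ∞ (S.T^[k] f) S.dom := by
  induction k with
  | zero => exact hf
  | succ k ih => rw [Function.iterate_succ_apply']; exact contDiffOn_T ih

lemma N_eq_T_outer (f : ℝ × ℝ → ℝ) (hp : S.R ≤ p.2) : S.N f p = S.T f p := by
  obtain ⟨h1, h2⟩ := S.N_outer p.2 hp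
  rw [N, along_eq]
  simp [h1, h2]

lemma along_congr_outer {X : ℝ × ℝ → ℝ × ℝ} (h : ∀ q : ℝ × ℝ, S.R < q.2 → f q = g q)
    (hp : S.R < p.2) : S.along X f p = S.along X g p := by
  have : f =ᶠ[𝓝 p] g := by
    filter_upwards [continuous_snd.continuousAt.eventually (lt_mem_nhds hp)] with q hq
    exact h q hq
  rw [along, along, this.fderivWithin_eq_of_nhds]

/-! ### Bounds on the outgoing cone -/

lemma exists_abs_le_on_outgoingCone (hf : S.IsSmooth f) {η : ℝ} (hη1 : η < 1)
    (h : S.IsSymbol S.outgoingCone (fun _ => 1) 0 (-3 + η) (S.L f)) :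
    ∃ C, 0 ≤ C ∧ ∀ p ∈ S.outgoingCone, |f p| ≤ C := by
  obtain ⟨C, hC, h⟩ := h 0 le_rfl
  obtain ⟨c, hc, hcD⟩ := exists_two_div_D_le (two_M_lt_R (S := S))
  have hR := R_pos S
  have hη : 0 < 2 - η := by linarith
  refine ⟨|f (2 * S.rstar S.R, S.R)| + c * C / (2 - η) * S.R ^ (-(2 - η)), by positivity, ?_⟩
  rintro _ ⟨r, hr, rfl⟩
  have hm : ∀ x, S.R ≤ x → (0 + 2 * S.rstar x, x) ∈ S.outgoingCone := fun x hx =>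
    ⟨x, hx, by rw [zero_add]⟩
  have h1 := abs_sub_le_of_abs_drOut_le (w := 0) (f := f)
    (B := fun x => -(c * C / (2 - η) * x ^ (-(2 - η)))) (B' := fun x => c * C * x ^ (-3 + η)) hf
    two_M_lt_R (outgoingCone_subset_exterior (hm _ le_rfl)).1 hr
    (fun x hx => by
      have hx0 : x ≠ 0 := by linarith [hx.1]
      have h1 := ((Real.hasDerivAt_rpow_const (p := -(2 - η)) (Or.inl hx0)).const_mul
        (c * C / (2 - η))).neg
      refine h1.congr_deriv ?_
      rw [show -(2 - η) - 1 = -3 + η by ring]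
      field_simp)
    (fun x hx => by
      have hmx := hm x hx.1
      have hD := D_pos (outgoingCone_subset_exterior hmx).2
      have hx0 : 0 < x := by linarith [hx.1]
      have h2 := h _ hmx
      simp only [Function.iterate_zero, id, one_mul, Nat.cast_zero, sub_zero] at h2
      rw [drOut_eq_L (outgoingCone_subset_exterior hmx), abs_mul, abs_of_pos (by positivity),
        mul_assoc]
      gcongr
      exact hcD x hx.1)
  simp only [zero_add] at h1
  have h2 : 0 ≤ c * C / (2 - η) * r ^ (-(2 - η)) := by
    have : 0 < r := by linarith
    positivity
  have h3 := abs_sub_abs_le_abs_sub (f (2 * S.rstar r, r)) (f (2 * S.rstar S.R, S.R))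
  linarith

/-- Since T = L + ∂_u, L T f = L²f + ∂_u L f, and the wave equation turns the last term into
potential times f. Thus T costs one `L`-derivative, and only boundedness of f is needed. -/
lemma IsWave.isSymbol_L_T (hf : S.IsSmooth f) (hw : S.IsWave f) {Γ : Set (ℝ × ℝ)}
    (hΓ : Γ ⊆ S.exterior) {η : ℝ} (hη0 : 0 < η) (hη1 : η < 1)
    (hb : ∃ C, 0 ≤ C ∧ ∀ p ∈ Γ, |f p| ≤ C)
    (h : ∀ k, S.IsSymbol Γ (fun _ => 1) k (-3 + η) (S.L f)) (k : ℕ) :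
    S.IsSymbol Γ (fun _ => 1) k (-3 + η) (S.L (S.T f)) := by
  have hone : ∀ p ∈ Γ, (0 : ℝ) ≤ 1 := fun _ _ => zero_le_one
  have hf0 : S.IsSymbol Γ (fun _ => 1) k 0 f := by
    refine IsSymbol.of_le (isSymbol_succ_iff.2 ⟨?_, ?_⟩) (Nat.le_succ k)
    · simpa using hb
    · exact (h k).mono_exponent hΓ hone (by linarith)
  have hKs : S.IsSmooth fun p => S.D p.2 / 2 * (S.M / p.2 ^ 3) :=
    isSmooth_radial ((contDiffOn_D.div_const 2).mul (contDiffOn_const_div_pow S.M 3))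
  have h1 := (((isSymbol_potential hΓ k).mul hΓ hone hKs hf hf0).neg hΓ).mono_exponent
    (q' := -3 + η) hΓ hone (by linarith)
  have h2 := (isSymbol_succ_iff.1 (h (k + 1))).2.mono_exponent (q' := -3 + η) hΓ hone (by linarith)
  refine (h2.add hΓ hf.L.L (hKs.mul hf).neg h1).congr hΓ fun p hp => ?_
  have e : S.L (S.T f) p = S.L (fun q => S.L f q + S.Lbar f q) p :=
    along_congr (fun q _ => T_eq f q) hp
  have e2 : S.L (fun q => S.L f q + S.Lbar f q) p = S.L (S.L f) p + S.L (S.Lbar f) p :=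
    along_add hf.L hf.Lbar hp
  rw [e, e2, ← Setting.Lbar_L hf hp, hw.Lbar_L hf hp]
  ring

lemma IsWave.isSymbol_L_iterate_T (hf : S.IsSmooth f) (hw : S.IsWave f) {η : ℝ} (hη0 : 0 < η)
    (hη1 : η < 1) (h : ∀ k, S.IsSymbol S.outgoingCone (fun _ => 1) k (-3 + η) (S.L f)) (i : ℕ) :
    ∀ k, S.IsSymbol S.outgoingCone (fun _ => 1) k (-3 + η) (S.L (S.T^[i] f)) := by
  induction i with
  | zero => exact h
  | succ i ih =>
    rw [Function.iterate_succ_apply']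
    exact fun k => (hw.iterate_T hf i).isSymbol_L_T (hf.iterate_T i) outgoingCone_subset_exterior
      hη0 hη1 (exists_abs_le_on_outgoingCone (hf.iterate_T i) hη1 (ih 0)) ih k

lemma exists_abs_drOut_le {η : ℝ}
    (h : S.IsSymbol S.outgoingCone (fun _ => 1) 0 (-3 + η) (S.L f)) :
    ∃ C, 0 ≤ C ∧ ∀ p ∈ S.outgoingCone, |S.drOut f p| ≤ C * p.2 ^ (-3 + η) := by
  obtain ⟨C, hC, h⟩ := h 0 le_rfl
  obtain ⟨c, hc, hcD⟩ := exists_two_div_D_le (two_M_lt_R (S := S))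
  refine ⟨c * C, by positivity, fun p hp => ?_⟩
  have h2 := h p hp
  simp only [Function.iterate_zero, id, one_mul, Nat.cast_zero, sub_zero] at h2
  have hpe := outgoingCone_subset_exterior hp
  have hD := D_pos hpe.2
  have hr : S.R ≤ p.2 := by obtain ⟨r, hr, rfl⟩ := hp; exact hr
  rw [drOut_eq_L hpe, abs_mul, abs_of_pos (by positivity), mul_assoc]
  gcongr
  exact hcD _ hr

lemma exists_abs_drOut_drOut_le (hf : S.IsSmooth f) {η : ℝ}
    (h : S.IsSymbol S.outgoingCone (fun _ => 1) 1 (-3 + η) (S.L f)) :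
    ∃ C, 0 ≤ C ∧ ∀ p ∈ S.outgoingCone, |S.drOut (S.drOut f) p| ≤ C * p.2 ^ (-4 + η) := by
  have hM := S.M_pos
  have hR := R_pos S
  obtain ⟨C₁, hC₁, h1⟩ := h 0 (Nat.zero_le _)
  obtain ⟨C₂, hC₂, h2⟩ := h 1 le_rfl
  obtain ⟨c, hc, hcD⟩ := exists_two_div_D_le (two_M_lt_R (S := S))
  refine ⟨S.M * c ^ 2 * C₁ * S.R⁻¹ + c ^ 2 * C₂, by positivity, fun p hp => ?_⟩
  have h1 := h1 p hp
  have h2 := h2 p hp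
  simp only [Function.iterate_zero, id, one_mul, Nat.cast_zero, sub_zero] at h1
  simp only [Function.iterate_one, one_mul, Nat.cast_one] at h2
  rw [show -3 + η - 1 = -4 + η by ring] at h2
  have hpe := outgoingCone_subset_exterior hp
  have hD := D_pos hpe.2
  have hr : S.R ≤ p.2 := by obtain ⟨r, hr, rfl⟩ := hp; exact hr
  have hr0 := pos_of_mem hpe
  have e : 4 * S.M / (p.2 ^ 2 * S.D p.2 ^ 2) = S.M * (2 / S.D p.2) ^ 2 * (p.2⁻¹ * p.2⁻¹) := by
    field_simp; norm_num
  have h3 : p.2⁻¹ ≤ S.R⁻¹ := by gcongr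
  have h4 : p.2⁻¹ * p.2 ^ (-3 + η) = p.2 ^ (-4 + η) := by
    rw [← Real.rpow_neg_one, ← Real.rpow_add hr0]; ring_nf
  have h5 := hcD _ hr
  rw [drOut_drOut hf hpe, e]
  refine (abs_add_le _ _).trans ?_
  rw [abs_mul, abs_mul, abs_neg, abs_of_pos (by positivity),
    abs_of_pos (by positivity : 0 < (2 / S.D p.2) ^ 2), add_mul]
  refine add_le_add ?_ ?_
  · calc _ ≤ S.M * c ^ 2 * (S.R⁻¹ * p.2⁻¹) * (C₁ * p.2 ^ (-3 + η)) := by gcongr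
      _ = S.M * c ^ 2 * C₁ * S.R⁻¹ * (p.2⁻¹ * p.2 ^ (-3 + η)) := by ring
      _ = _ := by rw [h4]
  · calc _ ≤ c ^ 2 * (C₂ * p.2 ^ (-4 + η)) := by gcongr
      _ = _ := by ring

/-- The fluxes involve f rather than r f. Its outgoing derivative is dominated by -(r f)/r², with r
f bounded on the cone, whence only r⁻². -/
lemma exists_abs_drOut_le_of_rad (hf : S.IsSmooth f) {η : ℝ} (hη1 : η < 1)
    (h : S.IsSymbol S.outgoingCone (fun _ => 1) 0 (-3 + η) (S.L (rad f))) :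
    ∃ C, ∀ p ∈ S.outgoingCone, |S.drOut f p| ≤ C * p.2 ^ (-2 : ℝ) := by
  have hR := R_pos S
  obtain ⟨C₁, hC₁, h1⟩ := exists_abs_drOut_le h
  obtain ⟨C₂, hC₂, h2⟩ := exists_abs_le_on_outgoingCone hf.rad hη1 h
  refine ⟨C₁ * S.R ^ (-3 + η - -1) + C₂, fun p hp => ?_⟩
  have hpe := outgoingCone_subset_exterior hp
  have hr : S.R ≤ p.2 := by obtain ⟨r, hr, rfl⟩ := hp; exact hr
  have hr0 := pos_of_mem hpe
  have h1 := h1 p hp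
  have h2 := h2 p hp
  have e1 : S.drOut (rad f) p = 1 * f p + p.2 * S.drOut f p := along_rad hf hpe
  have e2 : rad f p = p.2 * f p := rfl
  have e3 : S.drOut f p = p.2⁻¹ * S.drOut (rad f) p - (p.2 ^ 2)⁻¹ * rad f p := by
    rw [e1, e2]; field_simp; ring
  have h3 := rpow_le_const_mul_rpow (q := -3 + η) (q' := -1) hR hr (by linarith)
  have h4 : p.2 ^ (-2 : ℝ) = (p.2 ^ 2)⁻¹ := by
    rw [Real.rpow_neg hr0.le, show (2 : ℝ) = (2 : ℕ) by norm_num, Real.rpow_natCast]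
  rw [Real.rpow_neg_one] at h3
  rw [e3, h4, add_mul]
  refine (abs_sub _ _).trans ?_
  rw [abs_mul, abs_mul, abs_of_pos (by positivity : 0 < p.2⁻¹),
    abs_of_pos (by positivity : 0 < (p.2 ^ 2)⁻¹)]
  refine add_le_add ?_ ?_
  · calc _ ≤ p.2⁻¹ * (C₁ * (S.R ^ (-3 + η - -1) * p.2⁻¹)) := by gcongr; exact h1.trans (by gcongr)
      _ = _ := by rw [sq, mul_inv]; ring
  · rw [mul_comm]; gcongr

end

/-! ### The four conclusions for scattering solutions. -/

section

variable {S : Setting} {f : ℝ × ℝ → ℝ}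

/-- The estimates for the radiation field in the region to the past of an outgoing cone. -/
lemma IsScatteringSolution.exists_bounds {φ : ℝ × ℝ → ℝ} {I ε δ : ℝ}
    (hφ : S.IsScatteringSolution φ I ε) (hδ0 : 0 < δ) (hδε : δ ≤ ε) (hδ1 : δ < 1) (u₁ : ℝ) :
    S.IsSmooth φ ∧ S.IsWave (rad φ) ∧ ∃ B, 0 ≤ B ∧
      (∀ p ∈ S.region u₁, |rad φ p| ≤ B / S.delay u₁ p ∧
        |S.Lbar (rad φ) p - 2 * I / S.delay u₁ p ^ 2| ≤ B * S.delay u₁ p ^ (-2 - δ) ∧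
        |rad φ p - 2 * I / S.delay u₁ p| ≤ B * S.delay u₁ p ^ (-1 - δ)) ∧
      ∃ J P, 0 ≤ P ∧ ∀ r, S.innerRadius u₁ ≤ r →
        |r ^ 3 * S.drOut (rad φ) (u₁ + 2 * S.rstar r, r) + 2 * S.M * I * Real.log r - J|
          ≤ P * r ^ (-(δ / 2)) := by
  have hs : S.IsSmooth φ := hφ.smooth.mono exterior_subset_dom
  have hw : S.IsWave (rad φ) := isWave_rad hs fun p hp => hφ.wave p (exterior_subset_dom hp)
  obtain ⟨C, hC, hdata⟩ := hφ.data.exists_abs_Lbar_sub_le hs.rad hδ0 hδε hδ1.le u₁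
  obtain ⟨B, hB0, hB⟩ := hw.exists_abs_sub_le_delay_rpow hs.rad hφ.noIncoming hC hδ0 hδ1.le hdata
  refine ⟨hs, hw, B, hB0, hB, ?_⟩
  -- With η = 1 - δ the exponents -3 + η and -4 + η are the -2 - δ and -3 - δ required by the
  -- expansion, which is then used with β = δ/2.
  obtain ⟨C₁, hC₁, h1⟩ := hw.exists_abs_iterate_L_le hs.rad hφ.noIncoming hB0
    (fun p hp => (hB p hp).1) 0 (by linarith : 0 < 1 - δ) (by linarith)
  obtain ⟨C₂, hC₂, h2⟩ := hw.exists_abs_iterate_L_le hs.rad hφ.noIncoming hB0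
    (fun p hp => (hB p hp).1) 1 (by linarith : 0 < 1 - δ) (by linarith)
  refine hw.exists_expansion hs.rad (C := C₁ + C₂) (by linarith) (by linarith) hδ1.le hB0
    (fun p hp => (hB p hp).1) (fun p hp => (hB p hp).2.2) (by positivity) (fun p hp => ?_)
    fun p hp => ?_
  · have := h1 p hp
    simp only [zero_add, Function.iterate_one, Nat.cast_zero] at this
    rw [show -3 - 0 + (1 - δ) = -2 - δ by ring] at this
    have hr := pos_of_mem hp.1
    refine this.trans ?_
    gcongr; linarith
  · have := h2 p hp
    simp only [Nat.reduceAdd, Function.iterate_succ, Function.iterate_zero, Function.comp,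
      Nat.cast_one, id] at this
    rw [show -3 - 1 + (1 - δ) = -3 - δ by ring] at this
    have hr := pos_of_mem hp.1
    refine this.trans ?_
    gcongr; linarith

lemma tendsto_D : Tendsto S.D atTop (𝓝 1) := by
  have h := (tendsto_const_nhds (x := (1 : ℝ)) (f := atTop)).sub
    ((tendsto_const_nhds (x := 2 * S.M)).div_atTop tendsto_id)
  rw [sub_zero] at h
  exact h

lemma tendsto_rstar_div : Tendsto (fun r => S.rstar r / r) atTop (𝓝 1) := by
  have h1 : Tendsto (fun r => r - 2 * S.M) atTop atTop :=
    tendsto_atTop_add_const_right _ _ tendsto_id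
  have h2 := (Real.tendsto_pow_log_div_mul_add_atTop 1 (2 * S.M) 1 one_ne_zero).comp h1
  have h3 := ((tendsto_const_nhds (x := S.vSigma S.R / 2 - S.R
    - 2 * S.M * Real.log (S.R - 2 * S.M))).div_atTop tendsto_id).add
      ((tendsto_const_nhds (x := (1 : ℝ))).add (h2.const_mul (2 * S.M)))
  rw [mul_zero, add_zero, zero_add] at h3
  refine h3.congr' ?_
  filter_upwards [Ioi_mem_atTop (2 * S.M)] with r hr
  have hr0 : r ≠ 0 := by linarith [S.M_pos, mem_Ioi.1 hr]
  rw [rstar_eq hr]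
  simp only [id, Function.comp, pow_one, one_mul, sub_add_cancel]
  field_simp

lemma tendsto_div_delay (u₁ v : ℝ) :
    Tendsto (fun r => r / S.delay u₁ (v, r)) atTop (𝓝 (1 / 2)) := by
  have h1 := ((tendsto_const_nhds (x := 1 + (u₁ - v))).div_atTop tendsto_id).add
    ((tendsto_rstar_div (S := S)).const_mul 2)
  have h2 := h1.inv₀ (by norm_num)
  rw [show ((0 : ℝ) + 2 * 1)⁻¹ = 1 / 2 by norm_num] at h2
  refine h2.congr' ?_
  filter_upwards [Ioi_mem_atTop 0] with r hr
  have hr0 : r ≠ 0 := ne_of_gt hr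
  have e : (1 + (u₁ - v)) / id r + 2 * (S.rstar r / r) = S.delay u₁ (v, r) / r := by
    simp only [delay, u, id]; field_simp; ring
  rw [e, inv_div]

/-- `drIn` is -(2/D) times `Lbar`, `Lbar` of the radiation field is 2I/delay² to leading order, and
r/delay tends to 1/2: the limit is -2 · 2I · (1/4). -/
lemma IsScatteringSolution.tendsto_drIn {φ : ℝ × ℝ → ℝ} {I ε : ℝ} (hε : 0 < ε)
    (hφ : S.IsScatteringSolution φ I ε) {v : ℝ} (hv : S.v₀ ≤ v) :
    Tendsto (fun r => r ^ 2 * S.drIn (rad φ) (v, r)) atTop (𝓝 (-I)) := by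
  set δ := min ε (1 / 2) with hδ
  have hδ0 : 0 < δ := lt_min hε (by norm_num)
  have hδ1 : δ < 1 := (min_le_right _ _).trans_lt (by norm_num)
  obtain ⟨-, -, B, hB0, hB, -⟩ := hφ.exists_bounds hδ0 (min_le_left _ _) hδ1 0
  have hreg : ∀ᶠ r in atTop, (v, r) ∈ S.region 0 := by
    filter_upwards [Ioi_mem_atTop (2 * S.M), Ici_mem_atTop (S.radius (v / 2))] with r h1 h2
    refine ⟨⟨hv, h1⟩, ?_⟩
    have := (radius_le_iff h1).1 h2
    rw [u_mk]; linarith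
  have hq := tendsto_div_delay (S := S) 0 v
  have herr : Tendsto (fun r => r ^ 2 * (S.Lbar (rad φ) (v, r) - 2 * I / S.delay 0 (v, r) ^ 2))
      atTop (𝓝 0) := by
    have h1 := ((hq.pow 2).const_mul B).mul
      ((tendsto_rpow_neg_atTop hδ0).comp (tendsto_delay S 0 v))
    rw [mul_zero] at h1
    refine squeeze_zero_norm' ?_ h1
    filter_upwards [hreg] with r hr
    have hd := delay_pos hr
    have h2 := (hB _ hr).2.1
    rw [Real.norm_eq_abs, abs_mul, abs_of_nonneg (sq_nonneg r)]
    calc _ ≤ r ^ 2 * (B * S.delay 0 (v, r) ^ (-2 - δ)) := by gcongr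
      _ = _ := by
        rw [show -2 - δ = -((2 : ℕ) : ℝ) + -δ by push_cast; ring, Real.rpow_add hd,
          Real.rpow_neg hd.le, Real.rpow_natCast]
        simp only [Function.comp]
        field_simp
  have hD := (tendsto_const_nhds (x := (2 : ℝ)) (f := atTop)).div (tendsto_D (S := S)) one_ne_zero
  have hmain := (hD.mul (herr.add ((hq.pow 2).const_mul (2 * I)))).neg
  rw [show -(2 / 1 * (0 + 2 * I * (1 / 2) ^ 2)) = -I by ring] at hmain
  refine hmain.congr' ?_
  filter_upwards [hreg] with r hr
  have hd := (delay_pos hr).ne'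
  simp only [Pi.div_apply]
  rw [drIn_eq_Lbar hr.1, div_pow]
  ring

/-- Division of the expansion by log r removes J and the remainder; u₁ was arbitrary. -/
lemma IsScatteringSolution.hasNPConstant {φ : ℝ × ℝ → ℝ} {I ε : ℝ} (hε : 0 < ε)
    (hφ : S.IsScatteringSolution φ I ε) (u₁ : ℝ) :
    S.HasNPConstant (fun r => r ^ 3 / Real.log r) φ u₁ (-2 * S.M * I) := by
  set δ := min ε (1 / 2) with hδ
  have hδ0 : 0 < δ := lt_min hε (by norm_num)
  have hδ1 : δ < 1 := (min_le_right _ _).trans_lt (by norm_num)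
  obtain ⟨-, -, B, hB0, hB, J, P, hP, h⟩ := hφ.exists_bounds hδ0 (min_le_left _ _) hδ1 u₁
  have h0 : Tendsto (fun r : ℝ => (|J| + P * r ^ (-(δ / 2))) / Real.log r) atTop (𝓝 0) := by
    have h1 := ((tendsto_rpow_neg_atTop (half_pos hδ0)).const_mul P).const_add |J|
    exact h1.div_atTop Real.tendsto_log_atTop
  rw [HasNPConstant, tendsto_iff_norm_sub_tendsto_zero]
  refine squeeze_zero' (Eventually.of_forall fun _ => norm_nonneg _) ?_ h0
  filter_upwards [Ici_mem_atTop (S.innerRadius u₁), Ioi_mem_atTop 1] with r h1 h2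
  have hlog : 0 < Real.log r := Real.log_pos h2
  have h3 := h r h1
  set G := r ^ 3 * S.drOut (rad φ) (u₁ + 2 * S.rstar r, r) + 2 * S.M * I * Real.log r with hG
  have e : r ^ 3 / Real.log r * S.drOut (rad φ) (u₁ + 2 * S.rstar r, r) - -2 * S.M * I
      = G / Real.log r := by rw [hG]; field_simp; ring
  rw [e, Real.norm_eq_abs, abs_div, abs_of_pos hlog]
  gcongr
  have := abs_sub_abs_le_abs_sub G J
  linarith

lemma IsScatteringSolution.exists_expansion {φ : ℝ × ℝ → ℝ} {I ε : ℝ} (hε : 0 < ε)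
    (hφ : S.IsScatteringSolution φ I ε) :
    ∃ J P β : ℝ, 0 < P ∧ 0 < β ∧ β < ε ∧ β < 1 ∧ ∀ r, S.R ≤ r →
      |S.drOut (rad φ) (S.vSigma r, r) - (-2 * S.M * I) * (Real.log r / r ^ 3) - J / r ^ 3|
        ≤ P * r ^ (-3 - β) := by
  set δ := min ε (1 / 2) with hδ
  have hδ0 : 0 < δ := lt_min hε (by norm_num)
  have hδε : δ ≤ ε := min_le_left _ _
  have hδ1 : δ < 1 := (min_le_right _ _).trans_lt (by norm_num)
  obtain ⟨-, -, B, hB0, hB, J, P, hP, h⟩ := hφ.exists_bounds hδ0 hδε hδ1 0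
  refine ⟨J, P + 1, δ / 2, by linarith, by linarith, by linarith, by linarith, fun r hr => ?_⟩
  have hr0 : 0 < r := (R_pos S).trans_le hr
  have hm := outgoingCone_subset_region (vSigma_mem_outgoingCone hr)
  have h1 := h r (innerRadius_le hm)
  rw [zero_add, ← vSigma_outer hr] at h1
  have e : S.drOut (rad φ) (S.vSigma r, r) - (-2 * S.M * I) * (Real.log r / r ^ 3) - J / r ^ 3
      = (r ^ 3 * S.drOut (rad φ) (S.vSigma r, r) + 2 * S.M * I * Real.log r - J) / r ^ 3 := by
    field_simp; ring
  rw [e, abs_div, abs_of_pos (by positivity : 0 < r ^ 3), div_le_iff₀ (by positivity)]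
  have e2 : (P + 1) * r ^ (-3 - δ / 2) * r ^ 3 = (P + 1) * r ^ (-(δ / 2)) := by
    rw [mul_assoc, ← Real.rpow_natCast, ← Real.rpow_add hr0]; push_cast; ring_nf
  rw [e2]
  refine h1.trans ?_
  gcongr; linarith

lemma IsScatteringSolution.energy_lt_top {φ : ℝ × ℝ → ℝ} {I εφ : ℝ} (hεφ : 0 < εφ)
    (hφ : S.IsScatteringSolution φ I εφ) {ε : ℝ} (hε : 0 < ε) :
    S.energyTilde ε 1 φ + S.fluxN (S.N (S.N φ)) < ⊤ := by
  set δ := min εφ (1 / 2) with hδ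
  have hδ0 : 0 < δ := lt_min hεφ (by norm_num)
  have hδ1 : δ < 1 := (min_le_right _ _).trans_lt (by norm_num)
  obtain ⟨hs, hw, B, hB0, hB, -⟩ := hφ.exists_bounds hδ0 (min_le_left _ _) hδ1 0
  -- On the cone the first and second outgoing derivatives are O(r^(-3+η)) and O(r^(-4+η)), so
  -- weights r^q are integrable for q < 5 - 2η and q < 7 - 2η. The weights 5 - ε and 7 - ε therefore
  -- need 2η < ε.
  set η := min ε 1 / 4 with hη
  have hη0 : 0 < η := by have := lt_min hε one_pos; positivity
  have hηε : 4 * η ≤ ε := by linarith [min_le_left ε 1]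
  have hη1 : 4 * η ≤ 1 := by linarith [min_le_right ε 1]
  have hη1' : η < 1 := by linarith
  have hsym : ∀ k, S.IsSymbol S.outgoingCone (fun _ => 1) k (-3 + η) (S.L (rad φ)) := by
    intro k j _
    obtain ⟨C, hC, h⟩ := hw.exists_abs_iterate_L_le hs.rad hφ.noIncoming hB0
      (fun p hp => (hB p hp).1) j hη0 hη1'
    refine ⟨C, hC, fun p hp => ?_⟩
    have := h p (outgoingCone_subset_region hp)
    rwa [Function.iterate_succ_apply, show (-3 - j + η : ℝ) = -3 + η - j by ring,
      ← one_mul (p.2 ^ _)] at this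
  have hsymT := hw.isSymbol_L_iterate_T hs.rad hη0 hη1' hsym
  have hX : ∀ (i : ℕ) (q : ℝ), q < 5 - 2 * η → S.outerNorm q (S.drOut (S.T^[i] (rad φ))) < ⊤ := by
    intro i q hq
    obtain ⟨C, -, h⟩ := exists_abs_drOut_le (hsymT i 0)
    exact outerNorm_lt_top (by linarith) h
  have hXX : ∀ (i : ℕ) (q : ℝ), q < 7 - 2 * η →
      S.outerNorm q (S.drOut (S.drOut (S.T^[i] (rad φ)))) < ⊤ := by
    intro i q hq
    obtain ⟨C, -, h⟩ := exists_abs_drOut_drOut_le (hs.rad.iterate_T i) (hsymT i 1)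
    exact outerNorm_lt_top (by linarith) h
  have htail : ∀ i : ℕ, ∃ C, ∀ p ∈ S.outgoingCone, |S.drOut (S.T^[i] φ) p| ≤ C * p.2 ^ (-2 : ℝ) :=
    fun i => exists_abs_drOut_le_of_rad (hs.iterate_T i) hη1'
      ((hsymT i 0).congr outgoingCone_subset_exterior (along_congr (iterate_T_rad hs i)))
  have hflux : ∀ (i : ℕ) (F : ℝ × ℝ → ℝ), ContDiffOn ℝ ∞ F S.dom →
      (∀ q : ℝ × ℝ, S.R < q.2 → F q = S.T^[i] φ q) → S.fluxN F < ⊤ := by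
    intro i F hF hFT
    obtain ⟨C, hC⟩ := htail i
    refine fluxN_lt_top hF (C := C) fun r hr => ?_
    have e : S.drOut F (S.vSigma r, r) = S.drOut (S.T^[i] φ) (S.vSigma r, r) :=
      along_congr_outer hFT hr
    rw [e]
    exact hC _ (vSigma_mem_outgoingCone hr.le)
  have hNT : ∀ i, S.fluxN (S.N (S.T^[i] φ)) < ⊤ := fun i =>
    hflux (i + 1) _ (contDiffOn_N (contDiffOn_iterate_T hφ.smooth i)) fun q hq => by
      rw [N_eq_T_outer _ hq.le, Function.iterate_succ_apply']
  refine ENNReal.add_lt_top.2 ⟨ENNReal.add_lt_top.2 ⟨?_, ?_⟩, ?_⟩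
  · refine ENNReal.add_lt_top.2 ⟨ENNReal.add_lt_top.2 ⟨ENNReal.add_lt_top.2 ⟨?_, ?_⟩, ?_⟩, ?_⟩
    · exact ENNReal.sum_lt_top.2 fun i _ =>
        hflux i _ (contDiffOn_iterate_T hφ.smooth i) fun _ _ => rfl
    · exact hXX 0 _ (by push_cast; linarith)
    · refine ENNReal.sum_lt_top.2 fun i _ => ENNReal.add_lt_top.2 ⟨ENNReal.add_lt_top.2
        ⟨ENNReal.add_lt_top.2 ⟨ENNReal.add_lt_top.2 ⟨hX _ _ ?_, hX _ _ ?_⟩, hX _ _ ?_⟩,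
          hX _ _ ?_⟩, hX _ _ ?_⟩ <;> linarith
    · refine ENNReal.sum_lt_top.2 fun m hm => ENNReal.sum_lt_top.2 fun i _ => ?_
      have hm2 : m < 2 := Finset.mem_range.1 hm
      interval_cases m
      · exact hX i _ (by push_cast; linarith)
      · exact hXX i _ (by push_cast; linarith)
  · exact ENNReal.sum_lt_top.2 fun i _ => hNT i
  -- Beyond R the field N is T, so N²φ = T²φ in the tail; the bounded piece of Σ₀ needs only
  -- smoothness.
  · refine hflux 2 _ (contDiffOn_N (contDiffOn_N hφ.smooth)) fun q hq => ?_
    rw [N_eq_T_outer _ hq.le]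
    exact along_congr_outer (fun q' hq' => N_eq_T_outer _ hq'.le) hq

end

end Setting

end

end Schwarzschild

theorem theorem7p1 (S : Schwarzschild.Setting) (φ : ℝ × ℝ → ℝ) (I εφ : ℝ) (hεφ : 0 < εφ)
    (hφ : S.IsScatteringSolution φ I εφ) :
    (∀ v, S.v₀ ≤ v → Tendsto (fun r => r ^ 2 * S.drIn (Schwarzschild.rad φ) (v, r)) atTop (𝓝 (-I))) ∧
    (∀ u₁, S.HasNPConstant (fun r => r ^ 3 / Real.log r) φ u₁ (-2 * S.M * I)) ∧
    (∃ J P β : ℝ, 0 < P ∧ 0 < β ∧ β < εφ ∧ β < 1 ∧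
      ∀ r, S.R ≤ r →
        |S.drOut (Schwarzschild.rad φ) (S.vSigma r, r)
            - (-2 * S.M * I) * (Real.log r / r ^ 3) - J / r ^ 3|
          ≤ P * r ^ (-3 - β)) ∧
    (∀ ε : ℝ, 0 < ε → S.energyTilde ε 1 φ + S.fluxN (S.N (S.N φ)) < ⊤) := by
  exact ⟨fun v hv => hφ.tendsto_drIn hεφ hv, fun u₁ => hφ.hasNPConstant hεφ u₁,
    hφ.exists_expansion hεφ, fun ε hε => hφ.energy_lt_top hεφ hε⟩
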